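/- Let $M$ be a smooth manifold (real, finite-dimensional, without boundary) with a generalized Kähler structure $(g,J_+,J_-)$: $g$ is a Riemannian metric, $J_+,J_-$ are integrable almost complex structures (i.e. each is induced by a holomorphic atlas), both compatible with $g$ ($g(J_\pm\cdot,J_\pm\cdot)=g(\cdot,\cdot)$), and the fundamental 2-forms $F_\pm=gJ_\pm$ satisfy $$d^c_+F_++d^c_-F_-=0,\qquad dd^c_+F_+=0,$$ where $d^c_\pm=i(\bar\partial_\pm-\partial_\pm)$ are the operators associated with $J_\pm$. Suppose that $[J_+,J_-]=0$, put $Q=J_+J_-$ and, for $\varepsilon=\pm1$, let $T_\varepsilon M=\ker(Q-\varepsilon\,\mathrm{id})\subset TM$. Then: 1. $TM=T_+M\oplus T_-M$, and this splitting is $g$-orthogonal. 2. For each sign $\varepsilon$, $T_\varepsilon M$ is a smooth sub-bundle of $TM$ which is involutive (closed under the Lie bracket of vector fields). For each $J\in\{J_+,J_-\}$ it is a $J$-holomorphic sub-bundle: it is $J$-invariant and preserved by the Cauchy–Riemann operator $\bar\partial_XY=\tfrac12([X,Y]+J[JX,Y])$ of $TM$. 3. For each sign $\varepsilon$ and each $J\in\{J_+,J_-\}$,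 $T_\varepsilon M$ is tangent to a $J$-holomorphic foliation: around every point there is a $J$-holomorphic chart $(\varphi_1,\varphi_2)$ with values in $\mathbb C^a\times\mathbb C^b$ such that $T_\varepsilon M=\ker d\varphi_2$ on its domain. Hence $T_+M$ and $T_-M$ define two transverse holomorphic foliations. 4. On the leaves of each of the two foliations $g$ restricts to a Kähler metric. More precisely, for each sign $\varepsilon$, each $J\in\{J_+,J_-\}$ and every immersion $\iota:L\to M$ of a smooth manifold with $d\iota(T_pL)=T_\varepsilon M_{\iota(p)}$ for all $p\in L$ (in particular for every leaf), $J$ induces an integrable almost complex structure $j$ on $L$ with $d\iota\circ j=J\circ d\iota$, and $(\iota^*g,j)$ is a Kähler structure, i.e. $\iota^*g$ is compatible with $j$ and its fundamental form is closed. -/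

import Mathlib

open scoped Manifold ContDiff Topology Bundle

noncomputable section

namespace GenKahler

section Forms

variable {E : Type*} [NormedAddCommGroup E] [NormedSpace ℝ E]
  (M : Type*) [TopologicalSpace M] [ChartedSpace E M]

/-- Differential `k`-forms on the manifold `M` modelled on `E` (smoothness is not bundled). -/
abbrev Form (E : Type*) [NormedAddCommGroup E] [NormedSpace ℝ E]
    (M : Type*) [TopologicalSpace M] [ChartedSpace E M] (k : ℕ) : Type _ :=
  ∀ x : M, (TangentSpace 𝓘(ℝ, E) x) [⋀^Fin k]→L[ℝ] ℝ

variable {M}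

/-- The differential at `x` of the preferred chart around `x`, with values in the model space. -/
def chartDiff (x : M) : TangentSpace 𝓘(ℝ, E) x →L[ℝ] E :=
  mfderiv 𝓘(ℝ, E) 𝓘(ℝ, E) (extChartAt 𝓘(ℝ, E) x) x

/-- The differential at `y` of the inverse of the preferred chart around `x`. -/
def chartSymmDiff (x : M) (y : E) :
    E →L[ℝ] TangentSpace 𝓘(ℝ, E) ((extChartAt 𝓘(ℝ, E) x).symm y) :=
  mfderiv 𝓘(ℝ, E) 𝓘(ℝ, E) (extChartAt 𝓘(ℝ, E) x).symm y

/-- The expression of a form in the preferred chart around `x`: its pull-back by the inverse of the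
chart, a form on (an open subset of) the model space. -/
def inChart {k : ℕ} (η : Form E M k) (x : M) : E → E [⋀^Fin k]→L[ℝ] ℝ := fun y =>
  (η ((extChartAt 𝓘(ℝ, E) x).symm y)).compContinuousLinearMap (chartSymmDiff x y)

/-- The exterior derivative on `M`: at `x`, compute the exterior derivative in the preferred chart
around `x` and pull it back by that chart. -/
def extD {k : ℕ} (η : Form E M k) : Form E M (k + 1) := fun x =>
  (extDeriv (inChart η x) (extChartAt 𝓘(ℝ, E) x x)).compContinuousLinearMap (chartDiff x)

end Forms

section Structures

variable (E : Type*) [NormedAddCommGroup E] [NormedSpace ℝ E]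
  (M : Type*) [TopologicalSpace M] [ChartedSpace E M] [IsManifold 𝓘(ℝ, E) ∞ M]

/-- Smooth Riemannian metrics on `M`. -/
abbrev RiemMetric : Type _ :=
  Bundle.ContMDiffRiemannianMetric 𝓘(ℝ, E) ∞ E (fun x : M => TangentSpace 𝓘(ℝ, E) x)

/-- Smooth almost complex structures on `M`. -/
structure AlmostComplex where
  /-- the endomorphism of each tangent space -/
  J (x : M) : TangentSpace 𝓘(ℝ, E) x →L[ℝ] TangentSpace 𝓘(ℝ, E) x
  smooth : ContMDiff 𝓘(ℝ, E) (𝓘(ℝ, E).prod 𝓘(ℝ, E →L[ℝ] E)) ∞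
    (fun x => Bundle.TotalSpace.mk' (E →L[ℝ] E)
      (E := fun x : M => TangentSpace 𝓘(ℝ, E) x →L[ℝ] TangentSpace 𝓘(ℝ, E) x) x (J x))
  sq (x : M) (v : TangentSpace 𝓘(ℝ, E) x) : J x (J x v) = -v

variable {E M}

/-- The differential at `y` of a map into a complex normed space `F`, with values in `F`. -/
def diff {F : Type*} [NormedAddCommGroup F] [NormedSpace ℂ F] (φ : M → F) (y : M) :
    TangentSpace 𝓘(ℝ, E) y →L[ℝ] F :=
  mfderiv 𝓘(ℝ, E) 𝓘(ℝ, F) φ y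

/-- `φ` is a `J`-holomorphic chart: a diffeomorphism from an open subset of `M` onto an open subset
of the complex space `F` whose differential intertwines `J` and multiplication by `i`. -/
structure IsHolomorphicChart (J : AlmostComplex E M)
    {F : Type*} [NormedAddCommGroup F] [NormedSpace ℂ F] (φ : OpenPartialHomeomorph M F) : Prop where
  smooth : ContMDiffOn 𝓘(ℝ, E) 𝓘(ℝ, F) ∞ φ φ.source
  smooth_symm : ContMDiffOn 𝓘(ℝ, F) 𝓘(ℝ, E) ∞ φ.symm φ.target
  holomorphic : ∀ y ∈ φ.source, ∀ v : TangentSpace 𝓘(ℝ, E) y,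
    diff φ y (J.J y v) = Complex.I • diff φ y v

/-- `J` is integrable: it is the almost complex structure of a complex manifold, that is, `M` is
covered by `J`-holomorphic charts with values in `ℂⁿ`. -/
def AlmostComplex.Integrable (J : AlmostComplex E M) : Prop :=
  ∀ x : M, ∃ (n : ℕ) (φ : OpenPartialHomeomorph M (Fin n → ℂ)),
    x ∈ φ.source ∧ IsHolomorphicChart J φ

/-- The metric `g` is compatible with `J`: `g(J·, J·) = g(·, ·)`. -/
def Compatible (g : RiemMetric E M) (J : AlmostComplex E M) : Prop :=
  ∀ (x : M) (v w : TangentSpace 𝓘(ℝ, E) x), g.inner x (J.J x v) (J.J x w) = g.inner x v w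

/-- The fundamental 2-form `F = gJ`, i.e. `F(v, w) = g(Jv, w)`, of a compatible pair `(g, J)`. -/
def fundamentalForm (g : RiemMetric E M) (J : AlmostComplex E M) (h : Compatible g J) :
    Form E M 2 := fun x =>
  { toFun := fun v => g.inner x (J.J x (v 0)) (v 1)
    map_update_add' := by
      intro inst v i a b
      rw [Subsingleton.elim inst (instDecidableEqFin 2)]
      fin_cases i <;> simp
    map_update_smul' := by
      intro inst v i c a
      rw [Subsingleton.elim inst (instDecidableEqFin 2)]
      fin_cases i <;> simp
    cont := by
      let B : E →L[ℝ] E →L[ℝ] ℝ := g.inner x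
      let A : E →L[ℝ] E := J.J x
      have h : Continuous fun v : Fin 2 → E => B (A (v 0)) (v 1) := by fun_prop
      exact h
    map_eq_zero_of_eq' := by
      intro v i j hij hne
      have h01 : v 0 = v 1 := by
        fin_cases i <;> fin_cases j <;> simp_all
      have h1 := h x (v 1) (J.J x (v 1))
      have h2 := g.symm x (J.J x (v 1)) (v 1)
      rw [J.sq, map_neg] at h1
      show g.inner x (J.J x (v 0)) (v 1) = 0
      rw [h01]
      linarith }

/-- The action of `J` on `k`-forms: the algebra automorphism which on 1-forms is
`(Jα)(v) = -α(Jv)`. -/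
def AlmostComplex.act (J : AlmostComplex E M) {k : ℕ} (η : Form E M k) : Form E M k := fun x =>
  (η x).compContinuousLinearMap (-(J.J x))

/-- The inverse of the action of `J` on `k`-forms: on 1-forms `(J⁻¹α)(v) = α(Jv)`. -/
def AlmostComplex.actInv (J : AlmostComplex E M) {k : ℕ} (η : Form E M k) : Form E M k := fun x =>
  (η x).compContinuousLinearMap (J.J x)

/-- The real operator `dᶜ = J ∘ d ∘ J⁻¹`. For integrable `J` this is `i(∂̄ - ∂)`, because `J` acts
on forms of type `(p,q)` as multiplication by `(-i)ᵖ iᑫ`. -/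
def AlmostComplex.dc (J : AlmostComplex E M) {k : ℕ} (η : Form E M k) : Form E M (k + 1) :=
  J.act (extD (J.actInv η))

/-- `(g, J)` is a Kähler structure: `J` is integrable, `g` is compatible with `J` and the
fundamental form is closed. -/
def IsKahler (g : RiemMetric E M) (J : AlmostComplex E M) : Prop :=
  J.Integrable ∧ ∃ h : Compatible g J, extD (fundamentalForm g J h) = 0

variable (E M) in
/-- Generalized Kähler structures `(g, J₊, J₋)`: `J₊` and `J₋` are integrable, `g` is compatible
with both, `dᶜ₊F₊ + dᶜ₋F₋ = 0` and `d dᶜ₊F₊ = 0`. -/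
structure GeneralizedKahler where
  /-- the Riemannian metric -/
  g : RiemMetric E M
  /-- the complex structure `J₊` -/
  Jp : AlmostComplex E M
  /-- the complex structure `J₋` -/
  Jm : AlmostComplex E M
  integrable_p : Jp.Integrable
  integrable_m : Jm.Integrable
  compatible_p : Compatible g Jp
  compatible_m : Compatible g Jm
  dc_add : Jp.dc (fundamentalForm g Jp compatible_p) +
    Jm.dc (fundamentalForm g Jm compatible_m) = 0
  d_dc : extD (Jp.dc (fundamentalForm g Jp compatible_p)) = 0

/-- The operator `Q = J₊J₋`. -/
def GeneralizedKahler.Q (K : GeneralizedKahler E M) (x : M) :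
    TangentSpace 𝓘(ℝ, E) x →ₗ[ℝ] TangentSpace 𝓘(ℝ, E) x :=
  (K.Jp.J x).toLinearMap ∘ₗ (K.Jm.J x).toLinearMap

/-- The eigenspaces of `Q` for the eigenvalue `ε`. -/
def GeneralizedKahler.T (K : GeneralizedKahler E M) (ε : ℝ) (x : M) :
    Submodule ℝ (TangentSpace 𝓘(ℝ, E) x) :=
  Module.End.eigenspace (K.Q x) ε

end Structures

section Distributions

variable {E : Type*} [NormedAddCommGroup E] [NormedSpace ℝ E]
  {M : Type*} [TopologicalSpace M] [ChartedSpace E M] [IsManifold 𝓘(ℝ, E) ∞ M]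

/-- `X` is a smooth vector field on the set `U`. -/
def SmoothFieldOn (X : ∀ x : M, TangentSpace 𝓘(ℝ, E) x) (U : Set M) : Prop :=
  ContMDiffOn 𝓘(ℝ, E) 𝓘(ℝ, E).tangent ∞ (fun x => (⟨x, X x⟩ : TangentBundle 𝓘(ℝ, E) M)) U

/-- `D` is a smooth sub-bundle of the tangent bundle: it has smooth local frames. -/
def IsSmoothSubbundle (D : ∀ x : M, Submodule ℝ (TangentSpace 𝓘(ℝ, E) x)) : Prop :=
  ∀ x : M, ∃ U : Set M, IsOpen U ∧ x ∈ U ∧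
    ∃ (r : ℕ) (s : Fin r → ∀ y : M, TangentSpace 𝓘(ℝ, E) y),
      (∀ i, SmoothFieldOn (s i) U) ∧
      ∀ y ∈ U, LinearIndependent ℝ (fun i => s i y) ∧
        Submodule.span ℝ (Set.range fun i => s i y) = D y

/-- `D` is involutive: the Lie bracket of two local smooth sections of `D` is a section of `D`. -/
def IsInvolutive (D : ∀ x : M, Submodule ℝ (TangentSpace 𝓘(ℝ, E) x)) : Prop :=
  ∀ U : Set M, IsOpen U → ∀ X Y : ∀ x : M, TangentSpace 𝓘(ℝ, E) x,
    SmoothFieldOn X U → SmoothFieldOn Y U → (∀ y ∈ U, X y ∈ D y) → (∀ y ∈ U, Y y ∈ D y) →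
    ∀ y ∈ U, VectorField.mlieBracket 𝓘(ℝ, E) X Y y ∈ D y

/-- The Cauchy-Riemann operator `∂̄_X Y = ½([X,Y] + J[JX,Y])` of the holomorphic structure which
an integrable `J` induces on the tangent bundle. -/
def AlmostComplex.dbar (J : AlmostComplex E M) (X Y : ∀ x : M, TangentSpace 𝓘(ℝ, E) x) (x : M) :
    TangentSpace 𝓘(ℝ, E) x :=
  (1 / 2 : ℝ) • (VectorField.mlieBracket 𝓘(ℝ, E) X Y x +
    J.J x (VectorField.mlieBracket 𝓘(ℝ, E) (fun y => J.J y (X y)) Y x))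

/-- `D` is a `J`-holomorphic sub-bundle of the tangent bundle: a smooth `J`-complex sub-bundle
which is preserved by the Cauchy-Riemann operator of `J`. -/
structure IsHolomorphicSubbundle (J : AlmostComplex E M)
    (D : ∀ x : M, Submodule ℝ (TangentSpace 𝓘(ℝ, E) x)) : Prop where
  smooth : IsSmoothSubbundle D
  invariant : ∀ x : M, ∀ v ∈ D x, J.J x v ∈ D x
  dbar_mem : ∀ U : Set M, IsOpen U → ∀ X Y : ∀ x : M, TangentSpace 𝓘(ℝ, E) x,
    SmoothFieldOn X U → SmoothFieldOn Y U → (∀ y ∈ U, Y y ∈ D y) →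
    ∀ y ∈ U, J.dbar X Y y ∈ D y

/-- `D` is tangent to a `J`-holomorphic foliation: around every point there is a `J`-holomorphic
chart `φ = (φ₁, φ₂)` with values in `ℂᵃ × ℂᵇ` in which `D` is the tangent distribution of the
plaques `φ₂ = const`. -/
def IsHolomorphicFoliation (J : AlmostComplex E M)
    (D : ∀ x : M, Submodule ℝ (TangentSpace 𝓘(ℝ, E) x)) : Prop :=
  ∀ x : M, ∃ (a b : ℕ) (φ : OpenPartialHomeomorph M ((Fin a → ℂ) × (Fin b → ℂ))),
    x ∈ φ.source ∧ IsHolomorphicChart J φ ∧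
      ∀ y ∈ φ.source, ∀ v : TangentSpace 𝓘(ℝ, E) y, v ∈ D y ↔ (diff φ y v).2 = 0

variable (E' : Type*) [NormedAddCommGroup E'] [NormedSpace ℝ E']
  {L : Type*} [TopologicalSpace L] [ChartedSpace E' L] [IsManifold 𝓘(ℝ, E') ∞ L]

/-- `ι : L → M` is an immersed integral manifold of `D`: an immersion whose tangent spaces are the
spaces of `D`. If `D` is tangent to a foliation, its leaves are such integral manifolds (they are
the maximal connected injectively immersed ones), and so are the open subsets of its leaves. -/
structure IsIntegralManifold (ι : L → M)
    (D : ∀ x : M, Submodule ℝ (TangentSpace 𝓘(ℝ, E) x)) : Prop where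
  smooth : ContMDiff 𝓘(ℝ, E') 𝓘(ℝ, E) ∞ ι
  injective : ∀ p : L, Function.Injective (mfderiv 𝓘(ℝ, E') 𝓘(ℝ, E) ι p)
  tangent : ∀ p : L, (mfderiv 𝓘(ℝ, E') 𝓘(ℝ, E) ι p).toLinearMap.range = D (ι p)

/-- `(g, J)` restricts along `ι : L → M` to a Kähler structure on `L`: the differential of `ι`
intertwines `J` with an almost complex structure `j` on `L`, the pull-back of `g` is a Riemannian
metric `h` on `L`, and `(h, j)` is Kähler. -/
def RestrictsToKahler (g : RiemMetric E M) (J : AlmostComplex E M) (ι : L → M) : Prop :=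
  ∃ (h : RiemMetric E' L) (j : AlmostComplex E' L),
    (∀ (p : L) (v w : TangentSpace 𝓘(ℝ, E') p),
      h.inner p v w = g.inner (ι p) (mfderiv 𝓘(ℝ, E') 𝓘(ℝ, E) ι p v)
        (mfderiv 𝓘(ℝ, E') 𝓘(ℝ, E) ι p w)) ∧
    (∀ (p : L) (v : TangentSpace 𝓘(ℝ, E') p),
      mfderiv 𝓘(ℝ, E') 𝓘(ℝ, E) ι p (j.J p v) =
        J.J (ι p) (mfderiv 𝓘(ℝ, E') 𝓘(ℝ, E) ι p v)) ∧
    IsKahler h j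

end Distributions

end GenKahler

end

/-! Since $J_+$ and $J_-$ commute, $Q$ is a $g$-symmetric involution, which gives the orthogonal
splitting with smooth projections $\frac12(1\pm Q)$. The space $T_\varepsilon M$ is given by
$J_-v=-\varepsilon J_+v$ (`eig`). This is symmetric in the two structures because $\varepsilon^2=1$,
so it is enough to argue for the first member of an `IsCommutingPair`.

Two facts about the forms carry the metric part. If one argument lies in $T_\varepsilon M$, then
$F_-=-\varepsilon F_+$. On vectors from $T_a,T_b,T_c$ the condition on $d^cF_\pm$ becomes
$dF_+=abc\,dF_-$ (`extD_add_mul`). For $X,Y$ in $T_\varepsilon$ and $Z$ in $T_{-\varepsilon}$,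
Cartan's formula for $dF_\pm$ leaves only $F_+([X,Y],Z)=0$. So $J_+[X,Y]$ is orthogonal to
$T_{-\varepsilon}$, and $T_\varepsilon$ is involutive (`mlieBracket_mem`). For three vectors in
$T_\varepsilon$ the two facts give $dF_+=-dF_+$, so $F_+$ is closed along the leaves
(`extD_eq_zero`).

The operator $\bar\partial_XY$ preserves sections $Y$ of $T_\varepsilon$: for $X$ in $T_\varepsilon$
by involutivity, for $X$ in $T_{-\varepsilon}$ by adding the vanishing Nijenhuis tensors of $J_+$
and $J_-$ (`dbar_mem_of_mem_neg`).

In a suitable holomorphic chart the distribution is the graph of $A(z):\mathbb C^a\to\mathbb C^b$.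
Then $J$-invariance makes $A(z)$ complex linear, $\bar\partial$-invariance makes it holomorphic in
$z$, and involutivity is the compatibility condition of $D_1f=A(u,f)$. The holomorphic Frobenius
theorem (`exists_frobenius_chart`) straightens the distribution. It solves the equation along rays
by Picard iteration and uses compatibility to pass to all directions. The iteration rests on
standard facts on holomorphic maps of several variables.

On an integral manifold the first component of a foliation chart is a holomorphic chart. It yields
smoothness and integrability of the induced structure, and closedness of the pulled-back form
follows because $d$ commutes with pull-back (`extD_pullForm`). -/

noncomputable section

open Filter Metric Set MeasureTheory VectorField
open scoped Interval

namespace GenKahler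

/-! ### Holomorphic maps of several complex variables. -/

section SeveralComplexVariables

variable {E F : Type*} [NormedAddCommGroup E] [NormedSpace ℂ E] [NormedAddCommGroup F]
  [NormedSpace ℂ F]

/-- Cauchy's estimate for the differential of a bounded holomorphic map on a ball. -/
theorem norm_fderiv_le_of_norm_le {f : E → F} {z : E} {R C ρ : ℝ} (hρ : 0 < ρ) (hρR : ρ < R)
    (hC : 0 ≤ C) (hf : DifferentiableOn ℂ f (ball z R)) (hb : ∀ y ∈ ball z R, ‖f y‖ ≤ C) :
    ‖fderiv ℂ f z‖ ≤ C / ρ := by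
  refine ContinuousLinearMap.opNorm_le_bound _ (by positivity) fun v => ?_
  rcases eq_or_ne v 0 with rfl | hv
  · simp
  have hv' : 0 < ‖v‖ := norm_pos_iff.2 hv
  -- The disc of radius `ρ / ‖v‖` is sent by `ζ ↦ z + ζ • v` into the closed `ρ`-ball, which reduces
  -- the bound to Cauchy's estimate in one variable.
  have hmem : ∀ ζ ∈ closedBall (0 : ℂ) (ρ / ‖v‖), z + ζ • v ∈ ball z R := by
    intro ζ hζ
    simp only [mem_closedBall, dist_zero_right] at hζ
    rw [mem_ball, dist_eq_norm, add_sub_cancel_left, norm_smul]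
    exact ((le_div_iff₀ hv').1 hζ).trans_lt hρR
  have hzd : DifferentiableAt ℂ f z :=
    hf.differentiableAt (ball_mem_nhds z (hρ.trans hρR))
  have hderiv : deriv (fun ζ : ℂ => f (z + ζ • v)) 0 = fderiv ℂ f z v := by
    have h1 : HasDerivAt (fun ζ : ℂ => z + ζ • v) v 0 := by
      simpa using ((hasDerivAt_id (0 : ℂ)).smul_const v).const_add z
    have h2 : HasFDerivAt f (fderiv ℂ f z) (z + (0 : ℂ) • v) := by
      simpa using hzd.hasFDerivAt
    exact (h2.comp_hasDerivAt (0 : ℂ) h1).deriv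
  have hd : DifferentiableOn ℂ (fun ζ : ℂ => f (z + ζ • v)) (closedBall 0 (ρ / ‖v‖)) :=
    hf.comp (by fun_prop) hmem
  have hdc : DiffContOnCl ℂ (fun ζ : ℂ => f (z + ζ • v)) (ball 0 (ρ / ‖v‖)) := by
    apply DifferentiableOn.diffContOnCl
    rwa [closure_ball _ (by positivity)]
  have := Complex.norm_deriv_le_of_forall_mem_sphere_norm_le (by positivity) hdc
    (fun ζ hζ => hb _ (hmem ζ (sphere_subset_closedBall hζ)))
  rw [hderiv] at this
  refine this.trans (le_of_eq ?_)
  field_simp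

/-- A uniform limit of holomorphic maps is holomorphic. -/
theorem differentiableAt_of_tendstoUniformlyOn [CompleteSpace F] {f : ℕ → E → F} {g : E → F}
    {x : E} {R : ℝ} (hR : 0 < R) (hf : ∀ n, DifferentiableOn ℂ (f n) (ball x R))
    (hfg : TendstoUniformlyOn f g atTop (ball x R)) : DifferentiableAt ℂ g x := by
  have hsub : ∀ y ∈ ball x (R / 2), ball y (R / 2) ⊆ ball x R := fun y hy =>
    ball_subset_ball' (by rw [mem_ball] at hy; linarith)
  -- Cauchy's estimate for `f m - f n` on balls of radius `R / 2` makes the derivatives uniformly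
  -- Cauchy on the half ball.
  have hc : UniformCauchySeqOn (fun n => fderiv ℂ (f n)) atTop (ball x (R / 2)) := by
    rw [Metric.uniformCauchySeqOn_iff]
    intro ε hε
    obtain ⟨N, hN⟩ := Metric.uniformCauchySeqOn_iff.1 hfg.uniformCauchySeqOn (ε * R / 8)
      (by positivity)
    refine ⟨N, fun m hm n hn y hy => ?_⟩
    have hd : ∀ k, DifferentiableAt ℂ (f k) y := fun k =>
      (hf k).differentiableAt (isOpen_ball.mem_nhds (ball_subset_ball (by linarith) hy))
    rw [dist_eq_norm, ← fderiv_sub (hd m) (hd n)]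
    have := norm_fderiv_le_of_norm_le (f := f m - f n) (z := y) (R := R / 2) (C := ε * R / 8)
      (ρ := R / 4) (by linarith) (by linarith) (by positivity)
      (((hf m).mono (hsub y hy)).sub ((hf n).mono (hsub y hy)))
      (fun w hw => by
        have := hN m hm n hn w (hsub y hy hw)
        rw [dist_eq_norm] at this
        exact this.le)
    refine this.trans_lt ?_
    have : ε * R / 8 / (R / 4) = ε / 2 := by field_simp; norm_num
    rw [this]; linarith
  have hlim : ∀ y : E, ∃ L, y ∈ ball x (R / 2) →
      Tendsto (fun n => fderiv ℂ (f n) y) atTop (𝓝 L) := by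
    intro y
    by_cases hy : y ∈ ball x (R / 2)
    · obtain ⟨L, hL⟩ := cauchySeq_tendsto_of_complete (hc.cauchySeq hy)
      exact ⟨L, fun _ => hL⟩
    · exact ⟨0, fun h => absurd h hy⟩
  choose g' hg' using hlim
  have hu : TendstoUniformlyOn (fun n => fderiv ℂ (f n)) g' atTop (ball x (R / 2)) :=
    hc.tendstoUniformlyOn_of_tendsto fun y hy => hg' y hy
  refine (hasFDerivAt_of_tendstoLocallyUniformlyOn isOpen_ball hu.tendstoLocallyUniformlyOn
    (fun n y hy => ((hf n).differentiableAt
      (isOpen_ball.mem_nhds (ball_subset_ball (by linarith) hy))).hasFDerivAt)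
    (fun y hy => hfg.tendsto_at (ball_subset_ball (by linarith) hy))
    (mem_ball_self (by linarith))).differentiableAt

/-- The integral of a bounded family of holomorphic maps is holomorphic. -/
theorem differentiableAt_integral_of_norm_le [FiniteDimensional ℂ E] [CompleteSpace F]
    {G : E → ℝ → F} {x : E}
    {R C a b : ℝ} (hR : 0 < R) (hab : a ≤ b)
    (hG : ∀ s ∈ Icc a b, DifferentiableOn ℂ (fun z => G z s) (ball x R))
    (hcont : ∀ z ∈ ball x R, ContinuousOn (G z) (Icc a b))
    (hC : ∀ s ∈ Icc a b, ∀ z ∈ ball x R, ‖G z s‖ ≤ C) :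
    DifferentiableAt ℂ (fun z => ∫ s in a..b, G z s) x := by
  have hC0 : 0 ≤ C := (norm_nonneg _).trans (hC a ⟨le_rfl, hab⟩ x (mem_ball_self hR))
  have hsub : ∀ y ∈ ball x (R / 2), ball y (R / 2) ⊆ ball x R := fun y hy =>
    ball_subset_ball' (by rw [mem_ball] at hy; linarith)
  have hI : Ι a b ⊆ Icc a b := by rw [uIoc_of_le hab]; exact Ioc_subset_Icc_self
  have hmeas : ∀ z ∈ ball x R, AEStronglyMeasurable (G z) (volume.restrict (Ι a b)) :=
    fun z hz => ((hcont z hz).mono hI).aestronglyMeasurable measurableSet_uIoc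
  have hD : ∀ s ∈ Icc a b, ∀ y ∈ ball x (R / 2), DifferentiableAt ℂ (fun z => G z s) y :=
    fun s hs y hy => (hG s hs).differentiableAt
      (isOpen_ball.mem_nhds (ball_subset_ball (by linarith) hy))
  have hx2 : x ∈ ball x (R / 2) := mem_ball_self (by linarith)
  refine (intervalIntegral.hasFDerivAt_integral_of_dominated_of_fderiv_le
    (F' := fun y s => fderiv ℂ (fun z => G z s) y) (s := ball x (R / 2))
    (bound := fun _ => C / (R / 4)) (ball_mem_nhds x (by linarith))
    (by filter_upwards [ball_mem_nhds x hR] with z hz using hmeas z hz)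
    ((hcont x (mem_ball_self hR)).intervalIntegrable_of_Icc hab) ?_
    (ae_of_all _ fun s hs y hy => norm_fderiv_le_of_norm_le (R := R / 2) (by linarith)
      (by linarith) hC0 ((hG s (hI hs)).mono (hsub y hy))
      fun w hw => hC s (hI hs) w (hsub y hy hw))
    intervalIntegrable_const
    (ae_of_all _ fun s hs y hy => (hD s (hI hs) y hy).hasFDerivAt)).differentiableAt
  -- What remains is measurability in `s` of the derivative at `x`. It is a limit of difference
  -- quotients along a basis; `n0` keeps the shifted points inside the ball.
  let B := Module.finBasis ℂ E
  let c : ∀ i, E →L[ℂ] ℂ := fun i => LinearMap.toContinuousLinearMap (B.coord i)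
  have hexp : ∀ T : E →L[ℂ] F, ∑ i, (c i).smulRight (T (B i)) = T := by
    intro T
    ext v
    have : T v = T (∑ i, B.repr v i • B i) := by rw [B.sum_repr]
    rw [this, map_sum]
    simp [c]
  have hsm : ∃ n0 : ℕ, ∀ n ≥ n0, ∀ i, x + ((n : ℂ) + 1)⁻¹ • B i ∈ ball x R := by
    have : ∀ i, ∀ᶠ n : ℕ in atTop, x + ((n : ℂ) + 1)⁻¹ • B i ∈ ball x R := by
      intro i
      have h1 : Tendsto (fun n : ℕ => x + ((n : ℂ) + 1)⁻¹ • B i) atTop (𝓝 (x + (0 : ℂ) • B i)) := by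
        refine Tendsto.const_add _ (Tendsto.smul_const ?_ _)
        have := tendsto_one_div_add_atTop_nhds_zero_nat (𝕜 := ℂ)
        simpa using this
      refine h1.eventually_mem ?_
      simpa using ball_mem_nhds x hR
    exact eventually_atTop.1 (eventually_all.2 this)
  obtain ⟨n0, hn0⟩ := hsm
  refine aestronglyMeasurable_of_tendsto_ae atTop
    (f := fun n s => ∑ i, (c i).smulRight (((n + n0 : ℕ) + 1 : ℂ) •
      (G (x + (((n + n0 : ℕ) : ℂ) + 1)⁻¹ • B i) s - G x s))) ?_ ?_
  · intro n
    refine Finset.aestronglyMeasurable_fun_sum _ fun i _ => ?_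
    have h1 := (((hmeas _ (hn0 (n + n0) (by omega) i)).sub (hmeas x (mem_ball_self hR))).const_smul
      ((n + n0 : ℕ) + 1 : ℂ))
    exact ((ContinuousLinearMap.smulRightL ℂ E F (c i)).continuous).comp_aestronglyMeasurable h1
  · rw [ae_restrict_iff' measurableSet_uIoc]
    refine ae_of_all _ fun s hs => ?_
    rw [← hexp (fderiv ℂ (fun z => G z s) x)]
    refine tendsto_finsetSum _ fun i _ => ?_
    refine ((ContinuousLinearMap.smulRightL ℂ E F (c i)).continuous.tendsto _).comp ?_
    refine (hD s (hI hs) x hx2).hasFDerivAt.lim (B i) (c := fun n : ℕ => ((n + n0 : ℕ) + 1 : ℂ)) ?_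
    refine tendsto_atTop_mono (fun n => ?_) tendsto_natCast_atTop_atTop
    rw [show ((n + n0 : ℕ) + 1 : ℂ) = ((n + n0 + 1 : ℕ) : ℂ) by push_cast; ring,
      Complex.norm_natCast]
    exact_mod_cast (by omega : n ≤ n + n0 + 1)

/-- Cauchy's formula writes the derivative along `v` as an integral over a circle whose radius does
not depend on the point, so it is an integral of holomorphic maps. -/
theorem differentiableAt_fderiv_apply [FiniteDimensional ℂ E] [CompleteSpace F] {f : E → F}
    {U : Set E} (hU : IsOpen U) (hf : DifferentiableOn ℂ f U) {x : E} (hx : x ∈ U) (v : E) :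
    DifferentiableAt ℂ (fun y => fderiv ℂ f y v) x := by
  have hcx : ContinuousAt f x := (hf.differentiableAt (hU.mem_nhds hx)).continuousAt
  obtain ⟨R, hR, hRU⟩ : ∃ R > 0, ∀ y ∈ ball x R, y ∈ U ∧ ‖f y‖ ≤ ‖f x‖ + 1 := by
    have h1 : ∀ᶠ y in 𝓝 x, ‖f y‖ < ‖f x‖ + 1 := hcx.norm.eventually_lt_const (by linarith)
    obtain ⟨R, hR, h⟩ := Metric.eventually_nhds_iff_ball.1 ((hU.eventually_mem hx).and h1)
    exact ⟨R, hR, fun y hy => ⟨(h y hy).1, (h y hy).2.le⟩⟩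
  set C := ‖f x‖ + 1
  have hfR : DifferentiableOn ℂ f (ball x R) := hf.mono fun y hy => (hRU y hy).1
  -- This radius gives `‖ζ • v‖ ≤ R / 2` on the disc; the `+ 1` covers `v = 0`.
  set ρ : ℝ := R / 2 / (‖v‖ + 1) with hρdef
  have hv1 : 0 < ‖v‖ + 1 := by positivity
  have hρ : 0 < ρ := by positivity
  have hmem : ∀ y ∈ ball x (R / 2), ∀ ζ ∈ closedBall (0 : ℂ) ρ, y + ζ • v ∈ ball x R := by
    intro y hy ζ hζ
    rw [mem_closedBall, dist_zero_right] at hζ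
    rw [mem_ball, dist_eq_norm] at hy ⊢
    have h1 : ‖ζ • v‖ ≤ R / 2 := by
      rw [norm_smul]
      calc ‖ζ‖ * ‖v‖ ≤ ρ * (‖v‖ + 1) := by gcongr; linarith
        _ = R / 2 := by rw [hρdef]; field_simp
    calc ‖y + ζ • v - x‖ = ‖(y - x) + ζ • v‖ := by congr 1; abel
      _ ≤ ‖y - x‖ + ‖ζ • v‖ := norm_add_le _ _
      _ < R := by linarith
  have hcirc : ∀ θ : ℝ, circleMap 0 ρ θ ∈ closedBall (0 : ℂ) ρ := fun θ =>
    sphere_subset_closedBall (circleMap_mem_sphere 0 hρ.le θ)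
  have hformula : ∀ y ∈ ball x (R / 2), fderiv ℂ f y v = (2 * Real.pi * Complex.I : ℂ)⁻¹ •
      ∫ θ in (0 : ℝ)..2 * Real.pi, deriv (circleMap 0 ρ) θ •
        (((circleMap 0 ρ θ) ^ 2)⁻¹ • f (y + circleMap 0 ρ θ • v)) := by
    intro y hy
    have h1 : HasDerivAt (fun ζ : ℂ => y + ζ • v) v 0 := by
      simpa using ((hasDerivAt_id (0 : ℂ)).smul_const v).const_add y
    have h2 : HasFDerivAt f (fderiv ℂ f y) (y + (0 : ℂ) • v) := by
      simpa using (hfR.differentiableAt (isOpen_ball.mem_nhds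
        (ball_subset_ball (by linarith) hy))).hasFDerivAt
    rw [← (h2.comp_hasDerivAt (0 : ℂ) h1).deriv]
    have hd : DifferentiableOn ℂ (fun ζ : ℂ => f (y + ζ • v)) (closedBall 0 ρ) :=
      hfR.comp (by fun_prop) (hmem y hy)
    have := hd.deriv_eq_smul_circleIntegral hρ
    rw [eq_inv_smul_iff₀ Complex.two_pi_I_ne_zero]
    simpa [circleIntegral, Function.comp_def] using this.symm
  have key : DifferentiableAt ℂ (fun y => ∫ θ in (0 : ℝ)..2 * Real.pi, deriv (circleMap 0 ρ) θ •
        (((circleMap 0 ρ θ) ^ 2)⁻¹ • f (y + circleMap 0 ρ θ • v))) x := by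
    refine differentiableAt_integral_of_norm_le (R := R / 2) (C := ρ * ((ρ ^ 2)⁻¹ * C))
      (by linarith) (by positivity) ?_ ?_ ?_
    · intro θ _
      refine DifferentiableOn.const_smul (DifferentiableOn.const_smul ?_ _) _
      exact hfR.comp (by fun_prop) (fun y hy => hmem y hy _ (hcirc θ))
    · intro y hy
      have h3 : ContinuousOn (fun θ : ℝ => f (y + circleMap 0 ρ θ • v)) (Icc 0 (2 * Real.pi)) :=
        hfR.continuousOn.comp (by fun_prop) fun θ _ => hmem y hy _ (hcirc θ)
      have h4 : ContinuousOn (fun θ : ℝ => ((circleMap 0 ρ θ) ^ 2)⁻¹) (Icc 0 (2 * Real.pi)) :=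
        ContinuousOn.inv₀ (by fun_prop) fun θ _ => pow_ne_zero 2 (circleMap_ne_center hρ.ne')
      have h5 : Continuous (deriv (circleMap 0 ρ)) := by
        simp only [funext (deriv_circleMap 0 ρ)]; fun_prop
      exact h5.continuousOn.smul (h4.smul h3)
    · intro θ _ y hy
      rw [norm_smul, norm_smul, deriv_circleMap, norm_mul, norm_inv, norm_pow,
        norm_circleMap_zero]
      simp only [Complex.norm_I, mul_one, abs_of_pos hρ]
      gcongr
      exact (hRU _ (hmem y hy _ (hcirc θ))).2
  refine (key.const_smul ((2 * Real.pi * Complex.I : ℂ)⁻¹)).congr_of_eventuallyEq ?_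
  filter_upwards [ball_mem_nhds x (half_pos hR)] with y hy using hformula y hy

/-- Holomorphic maps of several variables are smooth. -/
theorem contDiffOn_of_differentiableOn_complex [FiniteDimensional ℂ E] [CompleteSpace F]
    {f : E → F} {U : Set E} (hU : IsOpen U) (hf : DifferentiableOn ℂ f U) (n : ℕ∞) :
    ContDiffOn ℂ n f U := by
  -- The induction must range over all `f`, since its step applies to the directional derivatives of
  -- `f`.
  suffices h : ∀ (n : ℕ) (f : E → F), DifferentiableOn ℂ f U → ContDiffOn ℂ n f U by
    exact contDiffOn_iff_forall_nat_le.2 fun m _ => h m f hf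
  intro n
  induction n with
  | zero => exact fun f hf => contDiffOn_zero.2 hf.continuousOn
  | succ n ih =>
    intro f hf
    rw [Nat.cast_add, Nat.cast_one, contDiffOn_succ_iff_fderiv_of_isOpen hU]
    refine ⟨hf, by simp, contDiffOn_clm_apply.2 fun v => ih _ fun x hx => ?_⟩
    exact (differentiableAt_fderiv_apply hU hf hx v).differentiableWithinAt

end SeveralComplexVariables

/-! ### Inverse function theorem. -/

section InverseFunction

variable {𝕜 E F : Type*} [RCLike 𝕜] [NormedAddCommGroup E] [NormedSpace 𝕜 E] [CompleteSpace E]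
  [NormedAddCommGroup F] [NormedSpace 𝕜 F]

/-- The inverse function theorem, with smoothness of the inverse on its whole domain. -/
theorem exists_openPartialHomeomorph_of_hasFDerivAt {f : E → F} {U : Set E} (hU : IsOpen U)
    (hf : ContDiffOn 𝕜 ∞ f U) {x : E} (hx : x ∈ U) (f' : E ≃L[𝕜] F)
    (hf' : HasFDerivAt f (f' : E →L[𝕜] F) x) :
    ∃ Ψ : OpenPartialHomeomorph E F, x ∈ Ψ.source ∧ Ψ.source ⊆ U ∧ (∀ z, Ψ z = f z) ∧
      ContDiffOn 𝕜 ∞ Ψ.symm Ψ.target := by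
  have hfx : ContDiffAt 𝕜 ∞ f x := hf.contDiffAt (hU.mem_nhds hx)
  have hn : (∞ : WithTop ℕ∞) ≠ 0 := by simp
  let Ψ₀ := hfx.toOpenPartialHomeomorph f hf' hn
  have hΨ₀ : ∀ z, Ψ₀ z = f z := fun z => rfl
  have hxΨ₀ : x ∈ Ψ₀.source := hfx.mem_toOpenPartialHomeomorph_source hf' hn
  have hcont : ContinuousOn (fderiv 𝕜 f) U := hf.continuousOn_fderiv_of_isOpen hU (by simp)
  -- Invertible maps form an open set. Shrinking to the points with invertible derivative makes the
  -- inverse smooth on the whole target.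
  let S : Set E := U ∩ fderiv 𝕜 f ⁻¹' range ((↑) : (E ≃L[𝕜] F) → E →L[𝕜] F)
  have hS : IsOpen S := hcont.isOpen_inter_preimage hU (ContinuousLinearEquiv.isOpen)
  have hxS : x ∈ S := ⟨hx, f', hf'.fderiv.symm⟩
  refine ⟨Ψ₀.restrOpen S hS, ⟨hxΨ₀, hxS⟩, fun z hz => hz.2.1, fun z => rfl, ?_⟩
  intro y hy
  have hyS := (Ψ₀.restrOpen S hS).map_target hy
  obtain ⟨L, hL⟩ := hyS.2.2
  have hd : HasFDerivAt f (L : E →L[𝕜] F) ((Ψ₀.restrOpen S hS).symm y) := by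
    rw [hL]
    exact ((hf.contDiffAt (hU.mem_nhds hyS.2.1)).differentiableAt hn).hasFDerivAt
  exact ((Ψ₀.restrOpen S hS).contDiffAt_symm hy hd
    (hf.contDiffAt (hU.mem_nhds hyS.2.1))).contDiffWithinAt

end InverseFunction

/-! ### Holomorphic Frobenius theorem for graphs. -/

section Frobenius

theorem exists_norm_le_of_continuousOn_Icc {X : Type*} [NormedAddCommGroup X] {g : ℝ → X} {a b : ℝ}
    (hg : ContinuousOn g (Icc a b)) : ∃ B, ∀ t ∈ Icc a b, ‖g t‖ ≤ B :=
  isCompact_Icc.exists_bound_of_continuousOn hg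

variable {V W : Type*} [NormedAddCommGroup V] [NormedSpace ℂ V] [NormedAddCommGroup W]

theorem norm_ofReal_smul_le {s : ℝ} (hs : s ∈ Icc (0 : ℝ) 1) (u : V) : ‖(s : ℂ) • u‖ ≤ ‖u‖ := by
  rw [norm_smul, Complex.norm_real, Real.norm_of_nonneg hs.1]
  exact mul_le_of_le_one_left (norm_nonneg _) hs.2

theorem radial_mem_ball {r : ℝ} {z : V × W} (hz : z ∈ ball (0 : V × W) r) {s : ℝ}
    (hs : s ∈ Icc (0 : ℝ) 1) : ((s : ℂ) • z.1, z.2) ∈ ball (0 : V × W) r := by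
  rw [mem_ball_zero_iff, Prod.norm_def, max_lt_iff] at hz ⊢
  exact ⟨(norm_ofReal_smul_le hs _).trans_lt hz.1, hz.2⟩

variable [NormedSpace ℂ W]

/-- The integral operator whose fixed points solve the radial equation `f(u, w) = w + ∫ A u`. -/
noncomputable def radialOp (A : V × W → V →L[ℂ] W) (f : V × W → W) (z : V × W) : W :=
  z.2 + ∫ s in (0 : ℝ)..1, A ((s : ℂ) • z.1, f ((s : ℂ) • z.1, z.2)) z.1

variable [FiniteDimensional ℂ W]

/-- Solutions of the radial equation satisfy `D f(u, w)(u, 0) = A(u, f(u, w)) u`. -/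
theorem fderiv_radial_solution {A : V × W → V →L[ℂ] W} {Ω : Set (V × W)}
    (hA : ContinuousOn A Ω) {r : ℝ} {f : V × W → W} (hf : DifferentiableOn ℂ f (ball 0 r))
    (hfΩ : ∀ z ∈ ball (0 : V × W) r, (z.1, f z) ∈ Ω)
    (hfA : ∀ z ∈ ball (0 : V × W) r, f z = radialOp A f z) {z : V × W}
    (hz : z ∈ ball (0 : V × W) r) :
    fderiv ℂ f z (z.1, 0) = A (z.1, f z) z.1 := by
  obtain ⟨u, w⟩ := z
  let c : ℝ → V × W := fun t => ((t : ℂ) • u, w)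
  have hc : Continuous c := by fun_prop
  let S : Set ℝ := c ⁻¹' ball 0 r
  have hS : IsOpen S := isOpen_ball.preimage hc
  have h1S : (1 : ℝ) ∈ S := by simpa [S, c] using hz
  have hSI : ∀ t ∈ S, ∀ s ∈ Icc (0 : ℝ) 1, s * t ∈ S := by
    intro t ht s hs
    have := radial_mem_ball (z := c t) ht hs
    simpa [S, c, smul_smul] using this
  let h : ℝ → W := fun t => A (((t : ℂ) • u), f (c t)) u
  have hh : ContinuousOn h S := by
    have h2 : ContinuousOn (fun t : ℝ => f (c t)) S :=
      hf.continuousOn.comp hc.continuousOn fun t ht => ht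
    have h3 : ContinuousOn (fun t : ℝ => ((t : ℂ) • u, f (c t))) S :=
      ContinuousOn.prodMk (by fun_prop) h2
    exact (hA.comp h3 fun t ht => hfΩ (c t) ht).clm_apply continuousOn_const
  have hIS : ∀ t ∈ S, 0 ≤ t → Icc 0 t ⊆ S := by
    intro t ht ht0 s hs
    rcases ht0.eq_or_lt with rfl | htpos
    · rw [Icc_self, mem_singleton_iff] at hs
      rwa [hs]
    · have := hSI t ht (s / t) ⟨div_nonneg hs.1 ht0, (div_le_one htpos).2 hs.2⟩
      rwa [div_mul_cancel₀ _ htpos.ne'] at this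
  -- The substitution `σ = s * t` turns the radial equation at `(t u, w)` into an integral over `[0,
  -- t]`; differentiating at `t = 1` gives the claim.
  have heq : ∀ t ∈ S, f (c t) = w + ∫ σ in (0 : ℝ)..t, h σ := by
    intro t ht
    rw [hfA (c t) ht, radialOp]
    congr 1
    have := intervalIntegral.smul_integral_comp_mul_right h t (a := 0) (b := 1)
    rw [zero_mul, one_mul] at this
    rw [← this, ← intervalIntegral.integral_smul]
    refine intervalIntegral.integral_congr fun s _ => ?_
    simp only [c, h, map_smul, smul_smul, Complex.ofReal_mul]
    rw [← Complex.coe_smul]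
  have hd1 : HasDerivAt (fun t => f (c t)) (h 1) 1 := by
    have h4 : HasDerivAt (fun t => w + ∫ σ in (0 : ℝ)..t, h σ) (h 1) 1 := by
      refine HasDerivAt.const_add _ (intervalIntegral.integral_hasDerivAt_right
        ((hh.mono (hIS 1 h1S zero_le_one)).intervalIntegrable_of_Icc zero_le_one)
        ?_ (hh.continuousAt (hS.mem_nhds h1S)))
      exact hh.stronglyMeasurableAtFilter hS 1 h1S
    refine h4.congr_of_eventuallyEq ?_
    filter_upwards [hS.mem_nhds h1S] with t ht using heq t ht
  have hc1 : HasDerivAt c (u, 0) 1 := by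
    have : HasDerivAt (fun t : ℝ => (t : ℂ) • u) ((1 : ℂ) • u) 1 :=
      (Complex.ofRealCLM.hasDerivAt (x := (1 : ℝ))).smul_const u
    rw [one_smul] at this
    exact this.prodMk (hasDerivAt_const _ _)
  have hcz : c 1 = (u, w) := by simp [c]
  have hd2 : HasDerivAt (fun t => f (c t)) (fderiv ℂ f (u, w) (u, 0)) 1 := by
    have h5 : HasFDerivAt f ((fderiv ℂ f (u, w)).restrictScalars ℝ) (c 1) := by
      rw [hcz]
      exact (hf.differentiableAt (isOpen_ball.mem_nhds hz)).hasFDerivAt.restrictScalars ℝ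
    exact h5.comp_hasDerivAt (1 : ℝ) hc1
  have := hd2.unique hd1
  rw [this]
  simp [h, c]

variable [FiniteDimensional ℂ V]

/-- Holomorphic solutions of the radial equation exist near the origin. -/
theorem exists_radial_solution {A : V × W → V →L[ℂ] W} {Ω : Set (V × W)} (hΩ : IsOpen Ω)
    (h0 : (0 : V × W) ∈ Ω) (hA : DifferentiableOn ℂ A Ω) :
    ∃ r > 0, ∃ f : V × W → W, DifferentiableOn ℂ f (ball 0 r) ∧
      (∀ z ∈ ball (0 : V × W) r, (z.1, f z) ∈ Ω) ∧
      ∀ z ∈ ball (0 : V × W) r, f z = radialOp A f z := by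
  have hA1 : ContDiffAt ℂ 1 A 0 :=
    (contDiffOn_of_differentiableOn_complex hΩ hA 1).contDiffAt (hΩ.mem_nhds h0)
  obtain ⟨K, t, ht, hK⟩ := hA1.exists_lipschitzOnWith
  obtain ⟨R, hR, hRb⟩ : ∃ R > 0, ∀ y ∈ ball (0 : V × W) R,
      (y ∈ Ω ∧ y ∈ t) ∧ ‖A y‖ < ‖A 0‖ + 1 :=
    Metric.eventually_nhds_iff_ball.1 (((hΩ.eventually_mem h0).and ht).and
      (hA1.continuousAt.norm.eventually_lt_const (by linarith)))
  set C := ‖A 0‖ + 1 with hCdef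
  have hC : 0 < C := by positivity
  have hK0 : (0 : ℝ) ≤ K := K.2
  -- The first two bounds make `radialOp` preserve `‖f‖ ≤ R / 2`; the third makes it a contraction
  -- with factor `1 / 2`.
  obtain ⟨r, hr, hr1, hr2, hr3⟩ : ∃ r > 0, r ≤ R / 4 ∧ C * r ≤ R / 4 ∧ K * r ≤ 1 / 2 := by
    refine ⟨min (R / 4) (min (R / 4 / C) (1 / 2 / (K + 1))), by positivity, min_le_left _ _, ?_, ?_⟩
    · rw [mul_comm, ← le_div_iff₀ hC]
      exact (min_le_right _ _).trans (min_le_left _ _)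
    · have h1 : min (R / 4) (min (R / 4 / C) (1 / 2 / (K + 1))) ≤ 1 / 2 / ((K : ℝ) + 1) :=
        (min_le_right _ _).trans (min_le_right _ _)
      calc (K : ℝ) * _ ≤ (K + 1) * (1 / 2 / (K + 1)) := by
            gcongr
            linarith
        _ = 1 / 2 := by field_simp
  have hmem : ∀ z ∈ ball (0 : V × W) r, ∀ y : W, ‖y‖ ≤ R / 2 → (z.1, y) ∈ ball (0 : V × W) R := by
    intro z hz y hy
    rw [mem_ball_zero_iff, Prod.norm_def, max_lt_iff] at hz ⊢
    exact ⟨by linarith [hz.1], by simp only; linarith⟩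
  have hz1 : ∀ z ∈ ball (0 : V × W) r, ‖z.1‖ ≤ r := fun z hz =>
    (norm_fst_le z).trans (mem_ball_zero_iff.1 hz).le
  have hz2 : ∀ z ∈ ball (0 : V × W) r, ‖z.2‖ ≤ r := fun z hz =>
    (norm_snd_le z).trans (mem_ball_zero_iff.1 hz).le
  -- The invariant class for Picard iteration: the bound `R / 2` keeps `(z.1, f z)` where `A` is
  -- holomorphic, bounded by `C` and `K`-Lipschitz.
  let Good : (V × W → W) → Prop := fun f =>
    DifferentiableOn ℂ f (ball 0 r) ∧ ∀ z ∈ ball (0 : V × W) r, ‖f z‖ ≤ R / 2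
  have hpt : ∀ f, Good f → ∀ z ∈ ball (0 : V × W) r, ∀ s ∈ Icc (0 : ℝ) 1,
      ((s : ℂ) • z.1, f ((s : ℂ) • z.1, z.2)) ∈ ball (0 : V × W) R := fun f hf z hz s hs =>
    hmem _ (radial_mem_ball hz hs) _ (hf.2 _ (radial_mem_ball hz hs))
  have hint : ∀ f, Good f → ∀ z ∈ ball (0 : V × W) r, ∀ s ∈ Icc (0 : ℝ) 1,
      ‖A ((s : ℂ) • z.1, f ((s : ℂ) • z.1, z.2)) z.1‖ ≤ R / 4 := by
    intro f hf z hz s hs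
    refine (ContinuousLinearMap.le_opNorm _ _).trans (le_trans ?_ hr2)
    exact mul_le_mul (hRb _ (hpt f hf z hz s hs)).2.le (hz1 z hz) (norm_nonneg _) hC.le
  have hcont : ∀ f, Good f → ∀ z ∈ ball (0 : V × W) r,
      ContinuousOn (fun s : ℝ => A ((s : ℂ) • z.1, f ((s : ℂ) • z.1, z.2)) z.1) (Icc 0 1) := by
    intro f hf z hz
    have h1 : ContinuousOn (fun s : ℝ => ((s : ℂ) • z.1, z.2)) (Icc (0 : ℝ) 1) := by fun_prop
    have h2 : ContinuousOn (fun s : ℝ => f ((s : ℂ) • z.1, z.2)) (Icc (0 : ℝ) 1) :=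
      hf.1.continuousOn.comp h1 fun s hs => radial_mem_ball hz hs
    have h3 : ContinuousOn (fun s : ℝ => ((s : ℂ) • z.1, f ((s : ℂ) • z.1, z.2)))
        (Icc (0 : ℝ) 1) := ContinuousOn.prodMk (by fun_prop) h2
    have h4 := hA.continuousOn.comp h3 fun s hs => (hRb _ (hpt f hf z hz s hs)).1.1
    exact h4.clm_apply continuousOn_const
  have hstep : ∀ f, Good f → Good (radialOp A f) := by
    intro f hf
    refine ⟨fun z hz => ?_, fun z hz => ?_⟩
    · obtain ⟨ρ, hρ, hρb⟩ := Metric.isOpen_iff.1 isOpen_ball z hz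
      refine DifferentiableAt.differentiableWithinAt (DifferentiableAt.add (by fun_prop) ?_)
      refine differentiableAt_integral_of_norm_le hρ zero_le_one ?_
        (fun y hy => hcont f hf y (hρb hy)) (fun s hs y hy => hint f hf y (hρb hy) s hs)
      intro s hs
      have h1 : DifferentiableOn ℂ (fun y : V × W => ((s : ℂ) • y.1, y.2)) (ball z ρ) := by
        fun_prop
      have h2 : DifferentiableOn ℂ (fun y : V × W => f ((s : ℂ) • y.1, y.2)) (ball z ρ) :=
        hf.1.comp h1 fun y hy => radial_mem_ball (hρb hy) hs
      have h3 : DifferentiableOn ℂ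
          (fun y : V × W => ((s : ℂ) • y.1, f ((s : ℂ) • y.1, y.2))) (ball z ρ) :=
        DifferentiableOn.prodMk (by fun_prop) h2
      have h4 := hA.comp h3 fun y hy => (hRb _ (hpt f hf y (hρb hy) s hs)).1.1
      exact h4.clm_apply (by fun_prop)
    · have h1 := intervalIntegral.norm_integral_le_of_norm_le_const
        (f := fun s : ℝ => A ((s : ℂ) • z.1, f ((s : ℂ) • z.1, z.2)) z.1) (a := 0) (b := 1)
        (C := R / 4) fun s hs => hint f hf z hz s (by
          rw [uIoc_of_le zero_le_one] at hs; exact Ioc_subset_Icc_self hs)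
      refine (norm_add_le _ _).trans ?_
      have := hz2 z hz
      simp only [sub_zero, abs_one, mul_one] at h1
      linarith
  have hcontr : ∀ f g, Good f → Good g → ∀ δ : ℝ,
      (∀ z ∈ ball (0 : V × W) r, ‖f z - g z‖ ≤ δ) →
      ∀ z ∈ ball (0 : V × W) r, ‖radialOp A f z - radialOp A g z‖ ≤ δ / 2 := by
    intro f g hf hg δ hδ z hz
    have hδ0 : 0 ≤ δ := (norm_nonneg _).trans (hδ z hz)
    rw [radialOp, radialOp, add_sub_add_left_eq_sub, ← intervalIntegral.integral_sub
      ((hcont f hf z hz).intervalIntegrable_of_Icc zero_le_one)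
      ((hcont g hg z hz).intervalIntegrable_of_Icc zero_le_one)]
    refine (intervalIntegral.norm_integral_le_of_norm_le_const (C := δ / 2) fun s hs => ?_).trans
      (by simp)
    replace hs : s ∈ Icc (0 : ℝ) 1 := by
      rw [uIoc_of_le zero_le_one] at hs; exact Ioc_subset_Icc_self hs
    rw [← sub_apply]
    refine (ContinuousLinearMap.le_opNorm _ _).trans ?_
    have h1 := hK.dist_le_mul _ (hRb _ (hpt f hf z hz s hs)).1.2 _ (hRb _ (hpt g hg z hz s hs)).1.2
    rw [dist_eq_norm, dist_eq_norm, Prod.mk_sub_mk, sub_self, Prod.norm_mk, norm_zero,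
      max_eq_right (norm_nonneg _)] at h1
    have h2 := hδ _ (radial_mem_ball hz hs)
    calc _ ≤ (K * δ) * r := by
          refine mul_le_mul (h1.trans ?_) (hz1 z hz) (norm_nonneg _) (by positivity)
          gcongr
      _ = (K * r) * δ := by ring
      _ ≤ 1 / 2 * δ := by gcongr
      _ = δ / 2 := by ring
  let f : ℕ → V × W → W := fun n => (radialOp A)^[n] Prod.snd
  have hf0 : Good Prod.snd := ⟨by fun_prop, fun z hz => by linarith [hz2 z hz]⟩
  have hfs : ∀ n, f (n + 1) = radialOp A (f n) := fun n =>
    Function.iterate_succ_apply' _ _ _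
  have hfn : ∀ n, Good (f n) := by
    intro n
    induction n with
    | zero => exact hf0
    | succ n ih => rw [hfs]; exact hstep _ ih
  have hgeo : ∀ n, ∀ z ∈ ball (0 : V × W) r, ‖f n z - f (n + 1) z‖ ≤ R * (1 / 2) ^ n := by
    intro n
    induction n with
    | zero =>
      intro z hz
      have h1 := (hfn 0).2 z hz
      have h2 := (hfn 1).2 z hz
      refine (norm_sub_le _ _).trans ?_
      simp only [pow_zero, mul_one, zero_add]
      linarith
    | succ n ih =>
      intro z hz
      rw [hfs (n + 1), hfs n]
      have := hcontr (f n) (f (n + 1)) (hfn n) (hfn (n + 1)) _ ih z hz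
      rw [hfs n] at this
      refine this.trans (le_of_eq ?_)
      rw [pow_succ]; ring
  have hlim : ∀ z : V × W, ∃ y, z ∈ ball (0 : V × W) r → Tendsto (fun n => f n z) atTop (𝓝 y) := by
    intro z
    by_cases hz : z ∈ ball (0 : V × W) r
    · obtain ⟨y, hy⟩ := cauchySeq_tendsto_of_complete (cauchySeq_of_le_geometric
        (f := fun n => f n z) (1 / 2) R (by norm_num) fun n => by
          rw [dist_eq_norm]; exact hgeo n z hz)
      exact ⟨y, fun _ => hy⟩
    · exact ⟨0, fun h => absurd h hz⟩
  choose F hF using hlim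
  have hFle : ∀ n, ∀ z ∈ ball (0 : V × W) r, ‖f n z - F z‖ ≤ R * (1 / 2) ^ n / (1 - 1 / 2) := by
    intro n z hz
    have := dist_le_of_le_geometric_of_tendsto (1 / 2) R (by norm_num)
      (fun n => by rw [dist_eq_norm]; exact hgeo n z hz) (hF z hz) n
    rwa [dist_eq_norm] at this
  have hto0 : Tendsto (fun n : ℕ => R * (1 / 2 : ℝ) ^ n / (1 - 1 / 2)) atTop (𝓝 0) := by
    have := ((tendsto_pow_atTop_nhds_zero_of_lt_one (r := (1 / 2 : ℝ)) (by norm_num)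
      (by norm_num)).const_mul R).div_const (1 - 1 / 2)
    simpa using this
  -- Geometric convergence is uniform on the ball, so the limit is again holomorphic.
  have hunif : TendstoUniformlyOn f F atTop (ball 0 r) := by
    rw [Metric.tendstoUniformlyOn_iff]
    intro ε hε
    filter_upwards [hto0.eventually_lt_const hε] with n hn z hz
    rw [dist_comm, dist_eq_norm]
    exact (hFle n z hz).trans_lt hn
  have hFgood : Good F := by
    refine ⟨fun z hz => ?_, fun z hz => ?_⟩
    · obtain ⟨ρ, hρ, hρb⟩ := Metric.isOpen_iff.1 isOpen_ball z hz
      exact (differentiableAt_of_tendstoUniformlyOn hρ (fun n => (hfn n).1.mono hρb)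
        (hunif.mono hρb)).differentiableWithinAt
    · exact le_of_tendsto (hF z hz).norm (Eventually.of_forall fun n => (hfn n).2 z hz)
  refine ⟨r, hr, F, hFgood.1, fun z hz => (hRb _ (hmem z hz _ (hFgood.2 z hz))).1.1,
    fun z hz => ?_⟩
  refine tendsto_nhds_unique ((tendsto_add_atTop_iff_nat 1).2 (hF z hz)) ?_
  rw [tendsto_iff_norm_sub_tendsto_zero]
  have hto1 := hto0.div_const 2
  rw [zero_div] at hto1
  refine squeeze_zero (fun _ => norm_nonneg _) (fun n => ?_) hto1
  rw [hfs]
  exact hcontr _ _ (hfn n) hFgood _ (hFle n) z hz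

/-- Under the integrability condition a radial solution solves the total differential equation
`D₁ f(u, w) v = A(u, f(u, w)) v`. -/
theorem fderiv_fst_radial_solution {A : V × W → V →L[ℂ] W} {Ω : Set (V × W)} (hΩ : IsOpen Ω)
    (hA : DifferentiableOn ℂ A Ω)
    (hint : ∀ z ∈ Ω, ∀ u v, fderiv ℂ A z (u, A z u) v = fderiv ℂ A z (v, A z v) u)
    {r : ℝ} {f : V × W → W} (hf : DifferentiableOn ℂ f (ball 0 r))
    (hfΩ : ∀ z ∈ ball (0 : V × W) r, (z.1, f z) ∈ Ω)
    (hfA : ∀ z ∈ ball (0 : V × W) r, f z = radialOp A f z) {z : V × W}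
    (hz : z ∈ ball (0 : V × W) r) (v : V) :
    fderiv ℂ f z (v, 0) = A (z.1, f z) v := by
  have hf2 : ContDiffOn ℂ 2 f (ball 0 r) := contDiffOn_of_differentiableOn_complex isOpen_ball hf 2
  have hfd : ∀ y ∈ ball (0 : V × W) r, HasFDerivAt f (fderiv ℂ f y) y := fun y hy =>
    (hf.differentiableAt (isOpen_ball.mem_nhds hy)).hasFDerivAt
  have hffd : ∀ y ∈ ball (0 : V × W) r,
      HasFDerivAt (fderiv ℂ f) (fderiv ℂ (fderiv ℂ f) y) y := fun y hy =>
    ((hf2.contDiffAt (isOpen_ball.mem_nhds hy)).fderiv_right (m := 1) (by norm_num)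
      |>.differentiableAt (by simp)).hasFDerivAt
  let A' : V × W → V →L[ℂ] W := fun y => A (y.1, f y)
  have hA' : ∀ y ∈ ball (0 : V × W) r, HasFDerivAt A'
      ((fderiv ℂ A (y.1, f y)).comp
        ((ContinuousLinearMap.fst ℂ V W).prod (fderiv ℂ f y))) y := by
    intro y hy
    have h1 : HasFDerivAt A (fderiv ℂ A (y.1, f y)) (y.1, f y) :=
      (hA.differentiableAt (hΩ.mem_nhds (hfΩ y hy))).hasFDerivAt
    exact h1.comp y (hasFDerivAt_fst.prodMk (hfd y hy))
  -- The defect of the equation in direction `v`. Differentiating the radial identity along `(v,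
  -- 0)`, with symmetry of $D^2f$ and the condition `hint`, gives $De(u,0)=D_2A(e)u-e$.
  let e : V × W → W := fun y => fderiv ℂ f y (v, 0) - A' y v
  have he : ∀ y ∈ ball (0 : V × W) r, DifferentiableAt ℂ e y ∧
      fderiv ℂ e y (y.1, 0) = fderiv ℂ A (y.1, f y) (0, e y) y.1 - e y := by
    intro y hy
    have hed := ((hffd y hy).clm_apply (hasFDerivAt_const (v, (0 : W)) y)).fun_sub
      ((hA' y hy).clm_apply (hasFDerivAt_const v y))
    refine ⟨hed.differentiableAt, ?_⟩
    have hrad : ∀ x ∈ ball (0 : V × W) r, fderiv ℂ f x (x.1, 0) = A' x x.1 := fun x hx =>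
      fderiv_radial_solution hA.continuousOn hf hfΩ hfA hx
    have hl := (hffd y hy).clm_apply
      ((hasFDerivAt_fst (𝕜 := ℂ) (p := y)).prodMk (hasFDerivAt_const (0 : W) y))
    have hr := (hA' y hy).clm_apply (hasFDerivAt_fst (𝕜 := ℂ) (p := y))
    have hlr : HasFDerivAt (fun x : V × W => A' x x.1) _ y := hl.congr_of_eventuallyEq (by
      filter_upwards [isOpen_ball.mem_nhds hy] with x hx using (hrad x hx).symm)
    have huniq := congrArg (fun T => T (v, (0 : W))) (hlr.unique hr)
    have hsymm : fderiv ℂ (fderiv ℂ f) y (v, 0) (y.1, 0) =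
        fderiv ℂ (fderiv ℂ f) y (y.1, 0) (v, 0) :=
      ((hf2.contDiffAt (isOpen_ball.mem_nhds hy)).isSymmSndFDerivAt (by simp)) _ _
    have hi := hint (y.1, f y) (hfΩ y hy) y.1 v
    have hradA : fderiv ℂ f y (y.1, 0) = A (y.1, f y) y.1 := hrad y hy
    have hfe : fderiv ℂ f y (v, 0) = A (y.1, f y) v + e y := by simp [e, A']
    have hsplit : fderiv ℂ A (y.1, f y) (v, A (y.1, f y) v + e y) y.1 =
        fderiv ℂ A (y.1, f y) (v, A (y.1, f y) v) y.1 + fderiv ℂ A (y.1, f y) (0, e y) y.1 := by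
      rw [← add_apply, ← map_add, Prod.mk_add_mk, add_zero]
    simp [hsymm, hfe, hsplit, A'] at huniq
    rw [show fderiv ℂ e y = _ from hed.fderiv]
    simp [hradA, hi]
    rw [add_assoc] at huniq
    rw [sub_eq_sub_iff_add_eq_add, add_comm _ (e y), add_left_cancel huniq, add_comm]
  obtain ⟨u, w⟩ := z
  let c : ℝ → V × W := fun t => ((t : ℂ) • u, w)
  have hc : Continuous c := by fun_prop
  have hcb : ∀ t ∈ Icc (0 : ℝ) 1, c t ∈ ball (0 : V × W) r := fun t ht =>
    radial_mem_ball (z := (u, w)) hz ht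
  have hcd : ∀ t : ℝ, HasDerivAt c (u, 0) t := by
    intro t
    have : HasDerivAt (fun t : ℝ => (t : ℂ) • u) ((1 : ℂ) • u) t :=
      (Complex.ofRealCLM.hasDerivAt (x := t)).smul_const u
    rw [one_smul] at this
    exact this.prodMk (hasDerivAt_const _ _)
  -- The factor `t` absorbs the term $-e$: $\eta$ solves the linear equation $\eta'=D_2A(\eta)u$
  -- with $\eta(0)=0$, so Grönwall's inequality forces $\eta=0$.
  let η : ℝ → W := fun t => (t : ℂ) • e (c t)
  have hη : ∀ t ∈ Icc (0 : ℝ) 1,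
      HasDerivAt η (fderiv ℂ A ((c t).1, f (c t)) (0, η t) u) t := by
    intro t ht
    have h1 : HasDerivAt (fun t => e (c t)) (fderiv ℂ e (c t) (u, 0)) t :=
      ((he _ (hcb t ht)).1.hasFDerivAt.restrictScalars ℝ).comp_hasDerivAt t (hcd t)
    have h2 := (Complex.ofRealCLM.hasDerivAt (x := t)).smul h1
    refine h2.congr_deriv ?_
    have h3 := (he _ (hcb t ht)).2
    have h4 : fderiv ℂ e (c t) ((c t).1, 0) = (t : ℂ) • fderiv ℂ e (c t) (u, 0) := by
      rw [← map_smul, Prod.smul_mk, smul_zero]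
    have h5 : fderiv ℂ A ((c t).1, f (c t)) (0, η t) u =
        fderiv ℂ A ((c t).1, f (c t)) (0, e (c t)) (c t).1 := by
      have : ((0 : V), η t) = (t : ℂ) • ((0 : V), e (c t)) := by simp [η]
      rw [this, map_smul]
      simp [c]
    rw [h5, sub_eq_iff_eq_add.1 h3.symm, h4]
    simp
  obtain ⟨B, hB⟩ : ∃ B, ∀ t ∈ Icc (0 : ℝ) 1, ‖fderiv ℂ A ((c t).1, f (c t))‖ ≤ B := by
    have hA1 : ContinuousOn (fderiv ℂ A) Ω :=
      (contDiffOn_of_differentiableOn_complex hΩ hA 1).continuousOn_fderiv_of_isOpen hΩ (by simp)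
    have h1 : ContinuousOn (fun t => fderiv ℂ A ((c t).1, f (c t))) (Icc (0 : ℝ) 1) := by
      refine hA1.comp (ContinuousOn.prodMk (by fun_prop) ?_) fun t ht => hfΩ _ (hcb t ht)
      exact hf.continuousOn.comp hc.continuousOn fun t ht => hcb t ht
    exact @exists_norm_le_of_continuousOn_Icc _ ContinuousLinearMap.toNormedAddCommGroup _ _ _ h1
  have hz1 := eq_zero_of_abs_deriv_le_mul_abs_self_of_eq_zero_right (f := η) (K := B * ‖u‖)
    (a := 0) (b := 1)
    (fun t ht => (hη t ht).continuousAt.continuousWithinAt)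
    (fun t ht => (hη t (Ico_subset_Icc_self ht)).hasDerivWithinAt) (by simp [η])
    (fun t ht => by
      have ht' := Ico_subset_Icc_self ht
      calc _ ≤ ‖fderiv ℂ A ((c t).1, f (c t)) (0, η t)‖ * ‖u‖ := ContinuousLinearMap.le_opNorm _ _
        _ ≤ (B * ‖η t‖) * ‖u‖ := by
          refine mul_le_mul_of_nonneg_right ?_ (norm_nonneg _)
          refine (ContinuousLinearMap.le_opNorm _ _).trans ?_
          have : ‖((0 : V), η t)‖ = ‖η t‖ := by simp
          rw [this]
          exact mul_le_mul_of_nonneg_right (hB t ht') (norm_nonneg _)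
        _ = B * ‖u‖ * ‖η t‖ := by ring) 1 (right_mem_Icc.2 zero_le_one)
  have : e (u, w) = 0 := by simpa [η, c] using hz1
  exact sub_eq_zero.1 this

/-- **Holomorphic Frobenius theorem** for distributions which are graphs of `A z : V → W`. -/
theorem exists_frobenius_chart {A : V × W → V →L[ℂ] W} {Ω : Set (V × W)} (hΩ : IsOpen Ω)
    (h0 : (0 : V × W) ∈ Ω) (hA : DifferentiableOn ℂ A Ω)
    (hint : ∀ z ∈ Ω, ∀ u v, fderiv ℂ A z (u, A z u) v = fderiv ℂ A z (v, A z v) u) :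
    ∃ Φ : OpenPartialHomeomorph (V × W) (V × W), (0 : V × W) ∈ Φ.source ∧ Φ.source ⊆ Ω ∧
      ContDiffOn ℂ ∞ Φ Φ.source ∧ ContDiffOn ℂ ∞ Φ.symm Φ.target ∧
      ∀ z ∈ Φ.source, ∀ v : V × W, (fderiv ℂ Φ z v).2 = 0 ↔ v.2 = A z v.1 := by
  obtain ⟨r, hr, f, hf, hfΩ, hfA⟩ := exists_radial_solution hΩ h0 hA
  have hf1 : ∀ z ∈ ball (0 : V × W) r, ∀ v, fderiv ℂ f z (v, 0) = A (z.1, f z) v := fun z hz v =>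
    fderiv_fst_radial_solution hΩ hA hint hf hfΩ hfA hz v
  have hf0 : ∀ w : W, ((0 : V), w) ∈ ball (0 : V × W) r → f (0, w) = w := by
    intro w hw
    rw [hfA _ hw, radialOp]
    simp
  have h0r : (0 : V × W) ∈ ball (0 : V × W) r := mem_ball_self hr
  have hfd : ∀ y ∈ ball (0 : V × W) r, HasFDerivAt f (fderiv ℂ f y) y := fun y hy =>
    (hf.differentiableAt (isOpen_ball.mem_nhds hy)).hasFDerivAt
  have hf2 : ∀ w, fderiv ℂ f 0 (0, w) = w := by
    have h1 : HasFDerivAt (fun w : W => f (0, w))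
        ((fderiv ℂ f 0).comp (ContinuousLinearMap.inr ℂ V W)) 0 :=
      (show HasFDerivAt f (fderiv ℂ f 0) (ContinuousLinearMap.inr ℂ V W 0) by
        rw [map_zero]; exact hfd 0 h0r).comp (0 : W) (ContinuousLinearMap.inr ℂ V W).hasFDerivAt
    have h2 : HasFDerivAt (fun w : W => f (0, w)) (ContinuousLinearMap.id ℂ W) 0 := by
      refine (hasFDerivAt_id (0 : W)).congr_of_eventuallyEq ?_
      filter_upwards [ball_mem_nhds (0 : W) hr] with w hw
      refine hf0 w ?_
      simpa [Prod.norm_def, hr] using hw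
    intro w
    have := congrArg (fun T => T w) (h1.unique h2)
    simpa using this
  -- The parametrization of the leaves: it sends each slice `w = const` to the leaf through `(0,
  -- w)`. The required chart is its inverse, whose second component labels the leaves.
  let Ψ : V × W → V × W := fun z => (z.1, f z)
  have hΨd : ∀ y ∈ ball (0 : V × W) r,
      HasFDerivAt Ψ ((ContinuousLinearMap.fst ℂ V W).prod (fderiv ℂ f y)) y := fun y hy =>
    hasFDerivAt_fst.prodMk (hfd y hy)
  have hΨ : ContDiffOn ℂ ∞ Ψ (ball 0 r) :=
    contDiffOn_of_differentiableOn_complex isOpen_ball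
      (fun y hy => (hΨd y hy).differentiableAt.differentiableWithinAt) ⊤
  have h00 : f 0 = 0 := hf0 0 h0r
  have h3 : ∀ y, fderiv ℂ f 0 y = A 0 y.1 + y.2 := by
    intro y
    have h4 : y = (y.1, 0) + (0, y.2) := by simp
    conv_lhs => rw [h4, map_add, hf1 0 h0r, hf2]
    simp only [Prod.fst_zero, h00, Prod.mk_zero_zero]
  -- As $f(0,w)=w$, the derivative of `Ψ` at the origin is $(u,w)\mapsto(u,A(0)u+w)$, with an
  -- evident inverse.
  let L : (V × W) ≃L[ℂ] (V × W) := ContinuousLinearEquiv.equivOfInverse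
    ((ContinuousLinearMap.fst ℂ V W).prod (fderiv ℂ f 0))
    ((ContinuousLinearMap.fst ℂ V W).prod
      (ContinuousLinearMap.snd ℂ V W - (A 0).comp (ContinuousLinearMap.fst ℂ V W)))
    (by intro y; ext <;> simp [h3])
    (by intro y; ext <;> simp [h3])
  obtain ⟨Ψh, hs0, hsub, hΨh, hsymm⟩ := exists_openPartialHomeomorph_of_hasFDerivAt isOpen_ball hΨ
    h0r L (hΨd 0 h0r)
  have hΨ0 : Ψh 0 = 0 := by rw [hΨh]; simp [Ψ, h00]
  refine ⟨Ψh.symm, by simpa [hΨ0] using Ψh.map_source hs0, ?_, hsymm, ?_, ?_⟩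
  · intro z hz
    have h1 := hfΩ _ (hsub (Ψh.map_target hz))
    have h2 := Ψh.right_inv hz
    rw [hΨh] at h2
    rwa [← h2]
  · exact (hΨ.mono hsub).congr fun z _ => hΨh z
  · intro z hz v
    set q := Ψh.symm z
    have hq : q ∈ Ψh.source := Ψh.map_target hz
    have hqz : (q.1, f q) = z := (hΨh q).symm.trans (Ψh.right_inv hz)
    have hsd : HasFDerivAt Ψh.symm (fderiv ℂ Ψh.symm z) z :=
      ((hsymm.contDiffAt (Ψh.open_target.mem_nhds hz)).differentiableAt (by simp)).hasFDerivAt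
    have hqd := hΨd q (hsub hq)
    have hrl : ∀ y, ((ContinuousLinearMap.fst ℂ V W).prod (fderiv ℂ f q)) (fderiv ℂ Ψh.symm z y)
        = y := by
      intro y
      have h1 := hqd.comp z hsd
      have h2 : HasFDerivAt (Ψ ∘ Ψh.symm) (ContinuousLinearMap.id ℂ (V × W)) z := by
        refine (hasFDerivAt_id z).congr_of_eventuallyEq ?_
        filter_upwards [Ψh.open_target.mem_nhds hz] with x hx
        exact (hΨh _).symm.trans (Ψh.right_inv hx)
      exact congrArg (fun T => T y) (h1.unique h2)
    have hlr : ∀ y, fderiv ℂ Ψh.symm z ((ContinuousLinearMap.fst ℂ V W).prod (fderiv ℂ f q) y)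
        = y := by
      intro y
      have hsd' : HasFDerivAt Ψh.symm (fderiv ℂ Ψh.symm z) (Ψ q) := by
        rw [show Ψ q = z from hqz]; exact hsd
      have h1 := hsd'.comp q hqd
      have h2 : HasFDerivAt (Ψh.symm ∘ Ψ) (ContinuousLinearMap.id ℂ (V × W)) q := by
        refine (hasFDerivAt_id q).congr_of_eventuallyEq ?_
        filter_upwards [Ψh.open_source.mem_nhds hq] with x hx
        exact (congrArg Ψh.symm (hΨh x).symm).trans (Ψh.left_inv hx)
      exact congrArg (fun T => T y) (h1.unique h2)
    -- The total differential equation says that the derivative of `Ψ` carries `V × 0` onto the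
    -- graph of `A z`.
    have hgraph : ∀ a : V, ((ContinuousLinearMap.fst ℂ V W).prod (fderiv ℂ f q)) (a, 0) =
        (a, A z a) := by
      intro a
      rw [← hqz]
      simp [hf1 q (hsub hq)]
    constructor
    · intro hv
      have h1 := hrl v
      rw [show fderiv ℂ Ψh.symm z v = ((fderiv ℂ Ψh.symm z v).1, 0) from Prod.ext rfl hv,
        hgraph] at h1
      rw [← h1]
    · intro hv
      have h1 := hlr (v.1, 0)
      rw [hgraph, ← hv] at h1
      rw [h1]

end Frobenius

/-! ### Vector fields and Lie brackets in smooth charts. -/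

section Charts

variable {E : Type*} [NormedAddCommGroup E] [NormedSpace ℝ E]
  {M : Type*} [TopologicalSpace M] [ChartedSpace E M]
  {F : Type*} [NormedAddCommGroup F] [NormedSpace ℝ F]

/-- `φ` is a diffeomorphism from an open subset of `M` onto an open subset of `F`. -/
structure IsSmoothChart (φ : OpenPartialHomeomorph M F) : Prop where
  smooth : ContMDiffOn 𝓘(ℝ, E) 𝓘(ℝ, F) ∞ φ φ.source
  smooth_symm : ContMDiffOn 𝓘(ℝ, F) 𝓘(ℝ, E) ∞ φ.symm φ.target

/-- The differential of a map into a real normed space, with values in that space. -/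
def rdiff (φ : M → F) (y : M) : TangentSpace 𝓘(ℝ, E) y →L[ℝ] F :=
  mfderiv 𝓘(ℝ, E) 𝓘(ℝ, F) φ y

/-- `X` is a vector field which is smooth near `y`. -/
def SmoothFieldAt [IsManifold 𝓘(ℝ, E) ∞ M] (X : ∀ x : M, TangentSpace 𝓘(ℝ, E) x) (y : M) : Prop :=
  ContMDiffAt 𝓘(ℝ, E) 𝓘(ℝ, E).tangent ∞ (fun x => (⟨x, X x⟩ : TangentBundle 𝓘(ℝ, E) M)) y

/-- The expression of a vector field in a chart. -/
def push (φ : OpenPartialHomeomorph M F) (X : ∀ x : M, TangentSpace 𝓘(ℝ, E) x) (z : F) : F :=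
  rdiff φ (φ.symm z) (X (φ.symm z))

/-- The vector field with a given expression in a chart. -/
def pull (φ : OpenPartialHomeomorph M F) (Y : F → F) : ∀ x : M, TangentSpace 𝓘(ℝ, E) x :=
  mpullback 𝓘(ℝ, E) 𝓘(ℝ, F) φ Y

namespace IsSmoothChart

variable {φ : OpenPartialHomeomorph M F}

theorem mdifferentiable (hφ : IsSmoothChart (E := E) φ) :
    φ.MDifferentiable 𝓘(ℝ, E) 𝓘(ℝ, F) :=
  ⟨hφ.smooth.mdifferentiableOn (by simp), hφ.smooth_symm.mdifferentiableOn (by simp)⟩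

theorem isInvertible (hφ : IsSmoothChart (E := E) φ) {y : M} (hy : y ∈ φ.source) :
    (mfderiv 𝓘(ℝ, E) 𝓘(ℝ, F) φ y).IsInvertible :=
  ⟨hφ.mdifferentiable.mfderiv hy, rfl⟩

theorem isInvertible_symm (hφ : IsSmoothChart (E := E) φ) {z : F} (hz : z ∈ φ.target) :
    (mfderiv 𝓘(ℝ, F) 𝓘(ℝ, E) φ.symm z).IsInvertible :=
  ⟨hφ.mdifferentiable.symm.mfderiv hz, rfl⟩

theorem rdiff_injective (hφ : IsSmoothChart (E := E) φ) {y : M} (hy : y ∈ φ.source) :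
    Function.Injective (rdiff (E := E) φ y) :=
  (hφ.mdifferentiable.mfderiv hy).injective

theorem rdiff_surjective (hφ : IsSmoothChart (E := E) φ) {y : M} (hy : y ∈ φ.source) :
    Function.Surjective (rdiff (E := E) φ y) :=
  (hφ.mdifferentiable.mfderiv hy).surjective

theorem rdiff_pull (hφ : IsSmoothChart (E := E) φ) (Y : F → F) {y : M} (hy : y ∈ φ.source) :
    rdiff φ y (pull (E := E) φ Y y) = Y (φ y) := by
  obtain ⟨L, hL⟩ := hφ.isInvertible hy
  have h1 : (mfderiv 𝓘(ℝ, E) 𝓘(ℝ, F) φ y).inverse = L.symm := by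
    rw [← hL, ContinuousLinearMap.inverse_equiv]
  have h2 : pull (E := E) φ Y y = L.symm (Y (φ y)) := congrArg (fun T => T (Y (φ y))) h1
  rw [h2]
  exact (congrArg (fun T => T (L.symm (Y (φ y)))) hL.symm).trans (L.apply_symm_apply _)

theorem push_eq (hφ : IsSmoothChart (E := E) φ) (X : ∀ x : M, TangentSpace 𝓘(ℝ, E) x) {z : F}
    (hz : z ∈ φ.target) : push φ X z = mpullback 𝓘(ℝ, F) 𝓘(ℝ, E) φ.symm X z := by
  have h1 := hφ.mdifferentiable.comp_symm_deriv hz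
  obtain ⟨L, hL⟩ := hφ.isInvertible_symm hz
  have h3 : (mfderiv 𝓘(ℝ, F) 𝓘(ℝ, E) φ.symm z).inverse = L.symm := by
    rw [← hL, ContinuousLinearMap.inverse_equiv]
  have h4 : mpullback 𝓘(ℝ, F) 𝓘(ℝ, E) φ.symm X z = L.symm (X (φ.symm z)) :=
    congrArg (fun T => T (X (φ.symm z))) h3
  rw [h4]
  rw [← hL] at h1
  have h2 := congrArg (fun T => T (L.symm (X (φ.symm z)))) h1
  refine Eq.trans ?_ h2
  exact congrArg (rdiff φ (φ.symm z)) (L.apply_symm_apply _).symm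

/-- In the chart the field is its pull-back by the inverse diffeomorphism, and pull-back preserves
smoothness. -/
theorem contDiffAt_push (hφ : IsSmoothChart (E := E) φ) [CompleteSpace E] [CompleteSpace F]
    [IsManifold 𝓘(ℝ, E) ∞ M]
    {X : ∀ x : M, TangentSpace 𝓘(ℝ, E) x} {y : M} (hy : y ∈ φ.source)
    (hX : SmoothFieldAt X y) :
    ContDiffAt ℝ ∞ (push φ X) (φ y) := by
  have hz := φ.map_source hy
  have h1 : ContMDiffAt 𝓘(ℝ, F) 𝓘(ℝ, F).tangent ∞ (fun z => (⟨z,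
      mpullback 𝓘(ℝ, F) 𝓘(ℝ, E) φ.symm X z⟩ : TangentBundle 𝓘(ℝ, F) F)) (φ y) := by
    refine ContMDiffAt.mpullback_vectorField_preimage (n := ∞) ?_
      (hφ.smooth_symm.contMDiffAt (φ.open_target.mem_nhds hz)) (hφ.isInvertible_symm hz) (by simp)
    rw [φ.left_inv hy]
    exact hX
  refine (contMDiffAt_vectorSpace_iff_contDiffAt.1 h1).congr_of_eventuallyEq ?_
  filter_upwards [φ.open_target.mem_nhds hz] with z hz using hφ.push_eq X hz

theorem smoothFieldAt_pull (hφ : IsSmoothChart (E := E) φ) [CompleteSpace E] [CompleteSpace F]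
    [IsManifold 𝓘(ℝ, E) ∞ M]
    {Y : F → F} {y : M} (hy : y ∈ φ.source) (hY : ContDiffAt ℝ ∞ Y (φ y)) :
    SmoothFieldAt (E := E) (pull φ Y) y := by
  refine ContMDiffAt.mpullback_vectorField_preimage (n := ∞)
    (contMDiffAt_vectorSpace_iff_contDiffAt.2 hY)
    (hφ.smooth.contMDiffAt (φ.open_source.mem_nhds hy)) (hφ.isInvertible hy) (by simp)

/-- Naturality of the bracket under the inverse chart. It moves bracket computations to a vector
space of choice, in particular to $\mathbb C^n$ with its constant complex structure. -/
theorem rdiff_mlieBracket (hφ : IsSmoothChart (E := E) φ) [CompleteSpace E] [CompleteSpace F]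
    [IsManifold 𝓘(ℝ, E) ∞ M]
    {X Y : ∀ x : M, TangentSpace 𝓘(ℝ, E) x} {y : M} (hy : y ∈ φ.source)
    (hX : SmoothFieldAt X y) (hY : SmoothFieldAt Y y) :
    rdiff φ y (mlieBracket 𝓘(ℝ, E) X Y y) = lieBracket ℝ (push φ X) (push φ Y) (φ y) := by
  have hz := φ.map_source hy
  have : IsManifold 𝓘(ℝ, E) (minSmoothness ℝ 2) M := by
    simp only [minSmoothness_of_isRCLikeNormedField]
    exact IsManifold.of_le (n := ∞) (by norm_cast)
  have h1 := mpullback_mlieBracket (I := 𝓘(ℝ, F)) (I' := 𝓘(ℝ, E)) (f := φ.symm) (V := X) (W := Y)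
    (x₀ := φ y) (n := ∞)
    (by rw [φ.left_inv hy]; exact hX.mdifferentiableAt (by simp))
    (by rw [φ.left_inv hy]; exact hY.mdifferentiableAt (by simp))
    (hφ.smooth_symm.contMDiffAt (φ.open_target.mem_nhds hz)) (by simp; norm_cast)
  rw [← hφ.push_eq _ hz] at h1
  have h2 : push φ (mlieBracket 𝓘(ℝ, E) X Y) (φ y) = rdiff φ y (mlieBracket 𝓘(ℝ, E) X Y y) := by
    rw [push, φ.left_inv hy]
  have h3 : mlieBracket 𝓘(ℝ, F) (mpullback 𝓘(ℝ, F) 𝓘(ℝ, E) φ.symm X)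
      (mpullback 𝓘(ℝ, F) 𝓘(ℝ, E) φ.symm Y) = lieBracket ℝ (mpullback 𝓘(ℝ, F) 𝓘(ℝ, E) φ.symm X)
      (mpullback 𝓘(ℝ, F) 𝓘(ℝ, E) φ.symm Y) := by
    rw [← mlieBracketWithin_univ, mlieBracketWithin_eq_lieBracketWithin]
    exact lieBracketWithin_univ
  rw [← h2, h1, h3]
  refine Filter.EventuallyEq.lieBracket_vectorField_eq ?_ ?_
  · filter_upwards [φ.open_target.mem_nhds hz] with z hz using (hφ.push_eq X hz).symm
  · filter_upwards [φ.open_target.mem_nhds hz] with z hz using (hφ.push_eq Y hz).symm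

end IsSmoothChart
end Charts

/-! ### Smooth vector fields and the Nijenhuis tensor. -/

section Fields

variable {E : Type*} [NormedAddCommGroup E] [NormedSpace ℝ E]
  {M : Type*} [TopologicalSpace M] [ChartedSpace E M] [IsManifold 𝓘(ℝ, E) ∞ M]

theorem SmoothFieldOn.smoothFieldAt {X : ∀ x : M, TangentSpace 𝓘(ℝ, E) x} {U : Set M}
    (hX : SmoothFieldOn X U) (hU : IsOpen U) {y : M} (hy : y ∈ U) : SmoothFieldAt X y :=
  ContMDiffOn.contMDiffAt hX (hU.mem_nhds hy)

theorem smoothFieldOn_of_forall {X : ∀ x : M, TangentSpace 𝓘(ℝ, E) x} {U : Set M}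
    (hX : ∀ y ∈ U, SmoothFieldAt X y) : SmoothFieldOn X U :=
  fun y hy => ContMDiffAt.contMDiffWithinAt (hX y hy)

namespace SmoothFieldAt

variable {X Y : ∀ x : M, TangentSpace 𝓘(ℝ, E) x} {y : M}

theorem add (hX : SmoothFieldAt X y) (hY : SmoothFieldAt Y y) :
    SmoothFieldAt (fun x => X x + Y x) y :=
  ContMDiffAt.add_section hX hY

theorem const_smul (c : ℝ) (hX : SmoothFieldAt X y) : SmoothFieldAt (fun x => c • X x) y :=
  ContMDiffAt.const_smul_section (a := c) hX

theorem mdifferentiableAt (hX : SmoothFieldAt X y) : MDifferentiableAt 𝓘(ℝ, E) 𝓘(ℝ, E).tangent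
    (fun x => (⟨x, X x⟩ : TangentBundle 𝓘(ℝ, E) M)) y :=
  ContMDiffAt.mdifferentiableAt hX (by simp)

theorem acs (J : AlmostComplex E M) (hX : SmoothFieldAt X y) :
    SmoothFieldAt (fun x => J.J x (X x)) y :=
  ContMDiffAt.clm_bundle_apply (J.smooth y) hX

theorem congr (hX : SmoothFieldAt X y) (h : Y =ᶠ[𝓝 y] X) : SmoothFieldAt Y y := by
  refine ContMDiffAt.congr_of_eventuallyEq hX ?_
  filter_upwards [h] with x hx
  rw [hx]

theorem inner (g : RiemMetric E M) (hX : SmoothFieldAt X y) (hY : SmoothFieldAt Y y) :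
    ContMDiffAt 𝓘(ℝ, E) 𝓘(ℝ, ℝ) ∞ (fun x => g.inner x (X x) (Y x)) y := by
  have h : ContMDiffAt 𝓘(ℝ, E) (𝓘(ℝ, E).prod 𝓘(ℝ)) ∞
      (fun m ↦ Bundle.TotalSpace.mk' ℝ (E := Bundle.Trivial M ℝ) m (g.inner m (X m) (Y m))) y :=
    ContMDiffAt.clm_bundle_apply₂ (F₁ := E) (F₂ := E) (g.contMDiff y) hX hY
  simp only [Bundle.contMDiffAt_totalSpace] at h
  exact h.2

end SmoothFieldAt

variable [CompleteSpace E]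

omit [CompleteSpace E] in
theorem isSmoothChart_chartAt (x : M) : IsSmoothChart (E := E) (chartAt E x) :=
  ⟨contMDiffOn_chart, contMDiffOn_chart_symm⟩

/-- A field that is constant in the preferred chart. Such extensions allow pointwise statements on
forms to be proved with Cartan's formula. -/
theorem exists_smoothField (x : M) (v : TangentSpace 𝓘(ℝ, E) x) :
    ∃ X : ∀ y : M, TangentSpace 𝓘(ℝ, E) y, X x = v ∧ SmoothFieldAt X x := by
  have hφ := isSmoothChart_chartAt (E := E) x
  have hx := mem_chart_source E x
  refine ⟨pull (chartAt E x) fun _ => rdiff (chartAt E x) x v, ?_,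
    hφ.smoothFieldAt_pull hx contDiffAt_const⟩
  exact hφ.rdiff_injective hx (hφ.rdiff_pull _ hx)

section Holomorphic

variable {F : Type*} [NormedAddCommGroup F] [NormedSpace ℂ F] [CompleteSpace F]
  {J : AlmostComplex E M} {φ : OpenPartialHomeomorph M F}

omit [CompleteSpace E] [CompleteSpace F] in
theorem IsHolomorphicChart.isSmoothChart (hφ : IsHolomorphicChart J φ) :
    IsSmoothChart (E := E) φ :=
  ⟨hφ.smooth, hφ.smooth_symm⟩

omit [CompleteSpace E] [CompleteSpace F] in
theorem IsHolomorphicChart.rdiff_acs (hφ : IsHolomorphicChart J φ) {y : M} (hy : y ∈ φ.source)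
    (v : TangentSpace 𝓘(ℝ, E) y) : rdiff φ y (J.J y v) = Complex.I • rdiff φ y v :=
  hφ.holomorphic y hy v

omit [CompleteSpace E] [CompleteSpace F] in
theorem IsHolomorphicChart.push_acs (hφ : IsHolomorphicChart J φ)
    (X : ∀ x : M, TangentSpace 𝓘(ℝ, E) x) {y : M} (hy : y ∈ φ.source) :
    push φ (fun y => J.J y (X y)) =ᶠ[𝓝 (φ y)] fun z => Complex.I • push φ X z := by
  filter_upwards [φ.open_target.mem_nhds (φ.map_source hy)] with z hz
  exact hφ.rdiff_acs (φ.map_target hz) _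

/-- In a holomorphic chart `J` is the constant operator $i$, so $D(iX)=i\,DX$, and both sides reduce
to $i\,DY(iX)-i\,DX(iY)$. -/
theorem IsHolomorphicChart.nijenhuis (hφ : IsHolomorphicChart J φ)
    {X Y : ∀ x : M, TangentSpace 𝓘(ℝ, E) x} {x : M} (hx : x ∈ φ.source) (hX : SmoothFieldAt X x)
    (hY : SmoothFieldAt Y x) :
    mlieBracket 𝓘(ℝ, E) (fun y => J.J y (X y)) (fun y => J.J y (Y y)) x =
      mlieBracket 𝓘(ℝ, E) X Y x + J.J x (mlieBracket 𝓘(ℝ, E) (fun y => J.J y (X y)) Y x) +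
        J.J x (mlieBracket 𝓘(ℝ, E) X (fun y => J.J y (Y y)) x) := by
  have hs := hφ.isSmoothChart
  apply hs.rdiff_injective hx
  rw [map_add, map_add, hφ.rdiff_acs hx, hφ.rdiff_acs hx, hs.rdiff_mlieBracket hx (hX.acs J) (hY.acs J),
    hs.rdiff_mlieBracket hx hX hY, hs.rdiff_mlieBracket hx (hX.acs J) hY,
    hs.rdiff_mlieBracket hx hX (hY.acs J)]
  have hpX := hφ.push_acs X hx
  have hpY := hφ.push_acs Y hx
  rw [hpX.lieBracket_vectorField_eq hpY, hpX.lieBracket_vectorField_eq EventuallyEq.rfl,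
    (EventuallyEq.refl (𝓝 (φ x)) (push φ X)).lieBracket_vectorField_eq hpY]
  have dX : DifferentiableAt ℝ (push φ X) (φ x) :=
    (hs.contDiffAt_push hx hX).differentiableAt (by simp)
  have dY : DifferentiableAt ℝ (push φ Y) (φ x) :=
    (hs.contDiffAt_push hx hY).differentiableAt (by simp)
  simp only [lieBracket, fderiv_fun_const_smul dX, fderiv_fun_const_smul dY, smul_apply]
  simp only [smul_sub, smul_smul, Complex.I_mul_I, neg_smul, one_smul]
  abel

end Holomorphic

/-- The Nijenhuis tensor of an integrable almost complex structure vanishes. -/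
theorem AlmostComplex.Integrable.nijenhuis {J : AlmostComplex E M} (hJ : J.Integrable)
    {X Y : ∀ x : M, TangentSpace 𝓘(ℝ, E) x} {x : M} (hX : SmoothFieldAt X x)
    (hY : SmoothFieldAt Y x) :
    mlieBracket 𝓘(ℝ, E) (fun y => J.J y (X y)) (fun y => J.J y (Y y)) x =
      mlieBracket 𝓘(ℝ, E) X Y x + J.J x (mlieBracket 𝓘(ℝ, E) (fun y => J.J y (X y)) Y x) +
        J.J x (mlieBracket 𝓘(ℝ, E) X (fun y => J.J y (Y y)) x) := by
  obtain ⟨n, φ, hx, hφ⟩ := hJ x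
  exact hφ.nijenhuis hx hX hY

end Fields

/-! ### Smoothness of form-valued maps. -/

section AlternatingMaps

variable {E : Type*} [NormedAddCommGroup E] [NormedSpace ℝ E] [FiniteDimensional ℝ E]
  {G : Type*} [NormedAddCommGroup G] [NormedSpace ℝ G]

/-- A map into the space of alternating forms is smooth if its evaluations are. -/
theorem contDiffAt_continuousAlternatingMap {k : ℕ} {n : WithTop ℕ∞} {f : G → E [⋀^Fin k]→L[ℝ] ℝ}
    {z : G} (hf : ∀ v : Fin k → E, ContDiffAt ℝ n (fun y => f y v) z) : ContDiffAt ℝ n f z := by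
  let b := Module.finBasis ℝ E
  -- Evaluation on tuples of basis vectors is linear and injective; a left inverse recovers `f`
  -- linearly from finitely many smooth functions.
  let ev : (E [⋀^Fin k]→L[ℝ] ℝ) →ₗ[ℝ] ((Fin k → Fin (Module.finrank ℝ E)) → ℝ) :=
    { toFun := fun T s => T fun i => b (s i)
      map_add' := fun _ _ => rfl
      map_smul' := fun _ _ => rfl }
  have hinj : LinearMap.ker ev = ⊥ := by
    rw [LinearMap.ker_eq_bot]
    intro S T h
    have : S.toAlternatingMap.toMultilinearMap = T.toAlternatingMap.toMultilinearMap :=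
      Module.Basis.ext_multilinear (fun _ => b) fun s => congrFun h s
    ext v
    exact congrArg (fun T : MultilinearMap ℝ (fun _ : Fin k => E) ℝ => T v) this
  obtain ⟨r, hr⟩ := ev.exists_leftInverse_of_injective hinj
  have h1 : f = fun y => LinearMap.toContinuousLinearMap r (ev (f y)) := by
    funext y
    exact (congrArg (fun T => T (f y)) hr).symm
  rw [h1]
  refine (LinearMap.toContinuousLinearMap r).contDiff.contDiffAt.comp z ?_
  exact contDiffAt_pi.2 fun s => hf _

end AlternatingMaps

/-! ### Exterior derivative: Cartan's formula and pull-back. -/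

section ExteriorDerivative

variable {E : Type*} [NormedAddCommGroup E] [NormedSpace ℝ E]
  {M : Type*} [TopologicalSpace M] [ChartedSpace E M]

theorem form_congr {k : ℕ} (η : Form E M k) {y y' : M} (h : y = y') {w w' : Fin k → E}
    (hw : w = w') : η y w = η y' w' := by
  subst h hw
  rfl

theorem push_chartAt_self (x : M) (X : ∀ x : M, TangentSpace 𝓘(ℝ, E) x) :
    push (chartAt E x) X (chartAt E x x) = rdiff (chartAt E x) x (X x) := by
  rw [push, (chartAt E x).left_inv (mem_chart_source E x)]

/-- The derivative at `x` of a function in the direction of a tangent vector. -/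
def dirDeriv (x : M) (f : M → ℝ) (v : TangentSpace 𝓘(ℝ, E) x) : ℝ :=
  fderiv ℝ (f ∘ (chartAt E x).symm) (chartAt E x x) (rdiff (chartAt E x) x v)

theorem dirDeriv_congr {x : M} {f g : M → ℝ} (h : f =ᶠ[𝓝 x] g) (v : TangentSpace 𝓘(ℝ, E) x) :
    dirDeriv x f v = dirDeriv x g v := by
  have hx := mem_chart_source E x
  have : (f ∘ (chartAt E x).symm) =ᶠ[𝓝 (chartAt E x x)] (g ∘ (chartAt E x).symm) := by
    have h1 := (chartAt E x).continuousAt_symm ((chartAt E x).map_source hx)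
    rw [ContinuousAt, (chartAt E x).left_inv hx] at h1
    exact h1.eventually h
  rw [dirDeriv, this.fderiv_eq, dirDeriv]

theorem dirDeriv_const_mul (x : M) (c : ℝ) (f : M → ℝ) (v : TangentSpace 𝓘(ℝ, E) x) :
    dirDeriv x (fun y => c * f y) v = c * dirDeriv x f v := by
  have : (fun y => c * f y) ∘ (chartAt E x).symm = c • (f ∘ (chartAt E x).symm) := rfl
  rw [dirDeriv, this, fderiv_const_smul_field]
  rfl

theorem dirDeriv_zero (x : M) (v : TangentSpace 𝓘(ℝ, E) x) :
    dirDeriv x (fun _ => 0) v = 0 := by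
  have : (fun _ : M => (0 : ℝ)) ∘ (chartAt E x).symm = fun _ => 0 := rfl
  simp [dirDeriv, this]

variable [IsManifold 𝓘(ℝ, E) ∞ M]

/-- A form is smooth if its values on smooth vector fields are smooth functions. -/
def IsSmoothForm {k : ℕ} (η : Form E M k) : Prop :=
  ∀ (X : Fin k → ∀ x : M, TangentSpace 𝓘(ℝ, E) x) (x : M), (∀ i, SmoothFieldAt (X i) x) →
    ContMDiffAt 𝓘(ℝ, E) 𝓘(ℝ, ℝ) ∞ (fun y => η y fun i => X i y) x

/-- Fundamental forms are smooth. -/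
theorem isSmoothForm_fundamentalForm (g : RiemMetric E M) (J : AlmostComplex E M)
    (h : Compatible g J) : IsSmoothForm (fundamentalForm g J h) :=
  fun _ _ hX => ((hX 0).acs J).inner g (hX 1)

theorem chartSymmDiff_push (x : M) (X : ∀ x : M, TangentSpace 𝓘(ℝ, E) x) {z : E}
    (hz : z ∈ (chartAt E x).target) :
    chartSymmDiff x z (push (chartAt E x) X z) = X ((chartAt E x).symm z) := by
  have h := (isSmoothChart_chartAt (E := E) x).mdifferentiable.symm_comp_deriv
    ((chartAt E x).map_target hz)
  rw [(chartAt E x).right_inv hz] at h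
  exact congrArg (fun T => T (X ((chartAt E x).symm z))) h

theorem inChart_push {k : ℕ} (η : Form E M k) (x : M)
    (X : Fin k → ∀ x : M, TangentSpace 𝓘(ℝ, E) x) {z : E} (hz : z ∈ (chartAt E x).target) :
    inChart η x z (fun i => push (chartAt E x) (X i) z) =
      η ((chartAt E x).symm z) fun i => X i ((chartAt E x).symm z) :=
  congrArg (η ((chartAt E x).symm z)) (funext fun i => chartSymmDiff_push x (X i) hz)

variable [FiniteDimensional ℝ E]

/-- Evaluating the local expression on fixed vectors amounts to evaluating the form on the fields
with constant coordinates in the chart. -/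
theorem IsSmoothForm.differentiableAt_inChart {k : ℕ} {η : Form E M k} (hη : IsSmoothForm η)
    (x : M) : DifferentiableAt ℝ (inChart η x) (chartAt E x x) := by
  have := FiniteDimensional.complete ℝ E
  have hx := mem_chart_source E x
  have hφ := isSmoothChart_chartAt (E := E) x
  refine (contDiffAt_continuousAlternatingMap (n := ∞) fun v => ?_).differentiableAt (by simp)
  have h1 := hη (fun i => pull (chartAt E x) fun _ => v i) x
    fun i => hφ.smoothFieldAt_pull hx contDiffAt_const
  have hsm := hφ.smooth_symm.contMDiffAt ((chartAt E x).open_target.mem_nhds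
    ((chartAt E x).map_source hx))
  have h2 := ContMDiffAt.comp (chartAt E x x) (by rwa [(chartAt E x).left_inv hx]) hsm
  refine (contMDiffAt_iff_contDiffAt.1 h2).congr_of_eventuallyEq ?_
  filter_upwards [(chartAt E x).open_target.mem_nhds ((chartAt E x).map_source hx)] with z hz
  refine Eq.trans ?_ (inChart_push η x (fun i => pull (chartAt E x) fun _ => v i) hz)
  congr 1
  funext i
  exact (hφ.rdiff_pull (fun _ => v i) ((chartAt E x).map_target hz)).symm

/-- The exterior derivative of a 2-form on vector fields. -/
theorem IsSmoothForm.extD_apply {η : Form E M 2} (hη : IsSmoothForm η) {x : M}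
    {X Y Z : ∀ x : M, TangentSpace 𝓘(ℝ, E) x} (hX : SmoothFieldAt X x) (hY : SmoothFieldAt Y x)
    (hZ : SmoothFieldAt Z x) :
    extD η x ![X x, Y x, Z x] =
      dirDeriv x (fun y => η y ![Y y, Z y]) (X x) - dirDeriv x (fun y => η y ![X y, Z y]) (Y x)
      + dirDeriv x (fun y => η y ![X y, Y y]) (Z x)
      - η x ![mlieBracket 𝓘(ℝ, E) X Y x, Z x] + η x ![mlieBracket 𝓘(ℝ, E) X Z x, Y x]
      - η x ![mlieBracket 𝓘(ℝ, E) Y Z x, X x] := by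
  have := FiniteDimensional.complete ℝ E
  have hx := mem_chart_source E x
  have hz := (chartAt E x).map_source hx
  have hφ := isSmoothChart_chartAt (E := E) x
  let φ := chartAt E x
  let V : Fin 3 → E → E := ![push φ X, push φ Y, push φ Z]
  have hV : ∀ i, DifferentiableAt ℝ (V i) (φ x) := by
    intro i
    fin_cases i
    · exact (hφ.contDiffAt_push hx hX).differentiableAt (by simp)
    · exact (hφ.contDiffAt_push hx hY).differentiableAt (by simp)
    · exact (hφ.contDiffAt_push hx hZ).differentiableAt (by simp)
  -- Cartan's formula on the model space; the rest translates its terms back to `M` and unfolds the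
  -- sums over indices.
  have h1 : extDeriv (inChart η x) (φ x) (V · (φ x)) =
      (∑ i : Fin 3, (-1) ^ i.val •
        fderiv ℝ (fun z ↦ inChart η x z (i.removeNth (V · z))) (φ x) (V i (φ x))) -
        ∑ i : Fin 2, ∑ j ≥ i, (-1) ^ (i + j : ℕ) •
            inChart η x (φ x) (Matrix.vecCons (lieBracket ℝ (V i.castSucc) (V j.succ) (φ x))
              (j.removeNth <| i.castSucc.removeNth (V · (φ x)))) :=
    extDeriv_apply_vectorField (hη.differentiableAt_inChart x) hV
  have h0 : extD η x ![X x, Y x, Z x] = extDeriv (inChart η x) (φ x) (V · (φ x)) := by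
    refine congrArg (extDeriv (inChart η x) (φ x)) (funext fun i => ?_)
    fin_cases i
    · exact (push_chartAt_self x X).symm
    · exact (push_chartAt_self x Y).symm
    · exact (push_chartAt_self x Z).symm
  rw [h0, h1]
  have hD : ∀ (A B C : ∀ x : M, TangentSpace 𝓘(ℝ, E) x),
      fderiv ℝ (fun z => inChart η x z ![push φ A z, push φ B z]) (φ x) (push φ C (φ x)) =
        dirDeriv x (fun y => η y ![A y, B y]) (C x) := by
    intro A B C
    rw [dirDeriv, ← push_chartAt_self]
    congr 1
    refine Filter.EventuallyEq.fderiv_eq ?_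
    filter_upwards [φ.open_target.mem_nhds hz] with z hz
    have := inChart_push η x ![A, B] hz
    refine Eq.trans ?_ (this.trans ?_)
    · congr 1
      funext i
      fin_cases i <;> rfl
    · refine congrArg (η (φ.symm z)) (funext fun i => ?_)
      fin_cases i <;> rfl
  have hB : ∀ (A B C : ∀ x : M, TangentSpace 𝓘(ℝ, E) x), SmoothFieldAt A x → SmoothFieldAt B x →
      inChart η x (φ x) ![lieBracket ℝ (push φ A) (push φ B) (φ x), push φ C (φ x)] =
        η x ![mlieBracket 𝓘(ℝ, E) A B x, C x] := by
    intro A B C hA hB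
    rw [← hφ.rdiff_mlieBracket hx hA hB, ← push_chartAt_self]
    have h3 := inChart_push η x ![mlieBracket 𝓘(ℝ, E) A B, C] hz
    rw [φ.left_inv hx] at h3
    refine Eq.trans ?_ (h3.trans ?_)
    · congr 1
      funext i
      fin_cases i <;> rfl
    · refine congrArg (η x) (funext fun i => ?_)
      fin_cases i <;> rfl
  rw [← hD Y Z X, ← hD X Z Y, ← hD X Y Z, ← hB X Y Z hX hY, ← hB X Z Y hX hZ, ← hB Y Z X hY hZ]
  have r0 : ∀ z, (0 : Fin 3).removeNth (V · z) = ![push φ Y z, push φ Z z] := fun z => by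
    funext i; fin_cases i <;> rfl
  have r1 : ∀ z, (1 : Fin 3).removeNth (V · z) = ![push φ X z, push φ Z z] := fun z => by
    funext i; fin_cases i <;> rfl
  have r2 : ∀ z, (2 : Fin 3).removeNth (V · z) = ![push φ X z, push φ Y z] := fun z => by
    funext i; fin_cases i <;> rfl
  have s0 : Finset.Ici (0 : Fin 2) = {0, 1} := by decide
  have s1 : Finset.Ici (1 : Fin 2) = {1} := by decide
  have q0 : ∀ a b : E, (0 : Fin 2).removeNth ![a, b] = ![b] := fun a b => by
    funext i; fin_cases i; rfl
  have q1 : ∀ a b : E, (1 : Fin 2).removeNth ![a, b] = ![a] := fun a b => by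
    funext i; fin_cases i; rfl
  have c0 : (0 : Fin 2).castSucc = 0 := rfl
  have c1 : (1 : Fin 2).castSucc = 1 := rfl
  have d0 : (0 : Fin 2).succ = 1 := rfl
  have d1 : (1 : Fin 2).succ = 2 := rfl
  have v0 : V 0 = push φ X := rfl
  have v1 : V 1 = push φ Y := rfl
  have v2 : V 2 = push φ Z := rfl
  simp only [Fin.sum_univ_three, Fin.sum_univ_two, s0, s1, Finset.sum_singleton,
    Finset.sum_pair (zero_ne_one' (Fin 2)), r0, r1, r2, c0, c1, d0, d1, q0, q1, v0, v1, v2]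
  simp only [Fin.val_zero, Fin.val_one, Fin.val_two]
  ring

variable {E' : Type*} [NormedAddCommGroup E'] [NormedSpace ℝ E']
  {L : Type*} [TopologicalSpace L] [ChartedSpace E' L] [IsManifold 𝓘(ℝ, E') ∞ L]

/-- The pull-back of a form. -/
def pullForm {k : ℕ} (ι : L → M) (η : Form E M k) : Form E' L k := fun p =>
  (η (ι p)).compContinuousLinearMap (mfderiv 𝓘(ℝ, E') 𝓘(ℝ, E) ι p)

/-- The exterior derivative commutes with pull-back. -/
theorem IsSmoothForm.extD_pullForm {k : ℕ} {η : Form E M k} (hη : IsSmoothForm η) {ι : L → M}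
    (hι : ContMDiff 𝓘(ℝ, E') 𝓘(ℝ, E) ∞ ι) :
    extD (pullForm (E' := E') ι η) = pullForm ι (extD η) := by
  funext p
  let ψ := chartAt E' p
  let φ := chartAt E (ι p)
  have hp : p ∈ ψ.source := mem_chart_source E' p
  have hq : ι p ∈ φ.source := mem_chart_source E (ι p)
  have hψ := isSmoothChart_chartAt (E := E') p
  have hφ := isSmoothChart_chartAt (E := E) (ι p)
  let f : E' → E := φ ∘ ι ∘ ψ.symm
  let S : Set E' := ψ.target ∩ ψ.symm ⁻¹' (ι ⁻¹' φ.source)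
  have hS : IsOpen S := ψ.symm.isOpen_inter_preimage (φ.open_source.preimage hι.continuous)
  have hpS : ψ p ∈ S := ⟨ψ.map_source hp, by simpa [ψ.left_inv hp] using hq⟩
  have hfp : f (ψ p) = φ (ι p) := by simp [f, ψ.left_inv hp]
  have hf : ContMDiffOn 𝓘(ℝ, E') 𝓘(ℝ, E) ∞ f S := by
    refine hφ.smooth.comp (hι.comp_contMDiffOn (hψ.smooth_symm.mono inter_subset_left)) ?_
    exact fun z hz => hz.2
  have hfd : ∀ z ∈ S, ContDiffAt ℝ ∞ f z := fun z hz =>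
    contMDiffAt_iff_contDiffAt.1 (hf.contMDiffAt (hS.mem_nhds hz))
  have hη' := hη.differentiableAt_inChart (ι p)
  have hpull := extDeriv_pullback (x := ψ p) (f := f) (r := ∞) (by rw [hfp]; exact hη')
    (hfd _ hpS) (by simp; norm_cast)
  -- By the chain rule, the local expression of $\iota^*\eta$ is the pull-back of that of $\eta$ by
  -- the coordinate expression `f` of `ι`, so the vector space case applies.
  have heq : inChart (pullForm (E' := E') ι η) p =ᶠ[𝓝 (ψ p)]
      fun z => (inChart η (ι p) (f z)).compContinuousLinearMap (fderiv ℝ f z) := by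
    filter_upwards [hS.mem_nhds hpS] with z hz
    ext v
    refine form_congr η (φ.left_inv hz.2).symm (funext fun i => ?_)
    have hψz : MDifferentiableAt 𝓘(ℝ, E') 𝓘(ℝ, E') ψ.symm z :=
      hψ.mdifferentiable.symm.mdifferentiableAt hz.1
    have hιz : MDifferentiableAt 𝓘(ℝ, E') 𝓘(ℝ, E) ι (ψ.symm z) := hι.mdifferentiableAt (by simp)
    have hfz : MDifferentiableAt 𝓘(ℝ, E') 𝓘(ℝ, E) f z :=
      ((hfd z hz).differentiableAt (by simp)).mdifferentiableAt
    have hφz : MDifferentiableAt 𝓘(ℝ, E) 𝓘(ℝ, E) φ.symm (f z) :=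
      hφ.mdifferentiable.symm.mdifferentiableAt (φ.map_source hz.2)
    have h1 := mfderiv_comp z hιz hψz
    have h2 := mfderiv_comp z hφz hfz
    have h3 : (ι ∘ ψ.symm) =ᶠ[𝓝 z] (φ.symm ∘ f) := by
      filter_upwards [hS.mem_nhds hz] with y hy using (φ.left_inv hy.2).symm
    have h4 : (mfderiv 𝓘(ℝ, E') 𝓘(ℝ, E) (ι ∘ ψ.symm) z : E' →L[ℝ] E) =
        mfderiv 𝓘(ℝ, E') 𝓘(ℝ, E) (φ.symm ∘ f) z := h3.mfderiv_eq
    rw [mfderiv_eq_fderiv] at h2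
    exact (congrArg (fun T : E' →L[ℝ] E => T (v i)) h1).symm.trans
      ((congrArg (fun T : E' →L[ℝ] E => T (v i)) h4).trans
      (congrArg (fun T : E' →L[ℝ] E => T (v i)) h2))
  have h5 : extDeriv (inChart (pullForm (E' := E') ι η) p) (ψ p) =
      (extDeriv (inChart η (ι p)) (φ (ι p))).compContinuousLinearMap (fderiv ℝ f (ψ p)) := by
    rw [heq.extDeriv_eq, hpull, hfp]
  ext v
  have h6 : ∀ i, fderiv ℝ f (ψ p) (chartDiff p (v i)) =
      chartDiff (ι p) (mfderiv 𝓘(ℝ, E') 𝓘(ℝ, E) ι p (v i)) := by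
    intro i
    have hιp : MDifferentiableAt 𝓘(ℝ, E') 𝓘(ℝ, E) ι p := hι.mdifferentiableAt (by simp)
    have hψp : MDifferentiableAt 𝓘(ℝ, E') 𝓘(ℝ, E') ψ p := hψ.mdifferentiable.mdifferentiableAt hp
    have hφp : MDifferentiableAt 𝓘(ℝ, E) 𝓘(ℝ, E) φ (ι p) := hφ.mdifferentiable.mdifferentiableAt hq
    have hfz : MDifferentiableAt 𝓘(ℝ, E') 𝓘(ℝ, E) f (ψ p) :=
      ((hfd _ hpS).differentiableAt (by simp)).mdifferentiableAt
    have h1 := mfderiv_comp p hφp hιp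
    have h2 := mfderiv_comp p hfz hψp
    have h3 : (f ∘ ψ) =ᶠ[𝓝 p] (φ ∘ ι) := by
      filter_upwards [ψ.open_source.mem_nhds hp] with y hy
      simp [f, ψ.left_inv hy]
    have h4 : (mfderiv 𝓘(ℝ, E') 𝓘(ℝ, E) (f ∘ ψ) p : TangentSpace 𝓘(ℝ, E') p →L[ℝ] E) =
        mfderiv 𝓘(ℝ, E') 𝓘(ℝ, E) (φ ∘ ι) p := h3.mfderiv_eq
    rw [mfderiv_eq_fderiv] at h2
    exact (congrArg (fun T : TangentSpace 𝓘(ℝ, E') p →L[ℝ] E => T (v i)) h2).symm.trans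
      ((congrArg (fun T : TangentSpace 𝓘(ℝ, E') p →L[ℝ] E => T (v i)) h4).trans
      (congrArg (fun T : TangentSpace 𝓘(ℝ, E') p →L[ℝ] E => T (v i)) h1))
  refine (congrArg (fun T : E' [⋀^Fin (k + 1)]→L[ℝ] ℝ => T fun i => chartDiff p (v i)) h5).trans ?_
  exact congrArg (extDeriv (inChart η (ι p)) (φ (ι p))) (funext h6)

end ExteriorDerivative

/-! ### Eigendistributions of a commuting pair: involutivity and the Cauchy-Riemann operator. -/

section CommutingPairs

variable {E : Type*} [NormedAddCommGroup E] [NormedSpace ℝ E]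
  {M : Type*} [TopologicalSpace M] [ChartedSpace E M] [IsManifold 𝓘(ℝ, E) ∞ M]

/-- Two commuting integrable complex structures compatible with `g` whose fundamental forms satisfy
`dᶜ₁F₁ + dᶜ₂F₂ = 0`. -/
structure IsCommutingPair (g : RiemMetric E M) (J₁ J₂ : AlmostComplex E M) : Prop where
  integrable_left : J₁.Integrable
  integrable_right : J₂.Integrable
  compatible_left : Compatible g J₁
  compatible_right : Compatible g J₂
  comm : ∀ (x : M) (v : TangentSpace 𝓘(ℝ, E) x), J₁.J x (J₂.J x v) = J₂.J x (J₁.J x v)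
  extD_add : ∀ (x : M) (u v w : TangentSpace 𝓘(ℝ, E) x),
    extD (fundamentalForm g J₁ compatible_left) x ![J₁.J x u, J₁.J x v, J₁.J x w] +
      extD (fundamentalForm g J₂ compatible_right) x ![J₂.J x u, J₂.J x v, J₂.J x w] = 0

/-- The tangent vectors `v` with `J₂v = -εJ₁v`. For commuting `J₁`, `J₂` and `ε = ±1` this is the
eigenspace of `J₁J₂` for the eigenvalue `ε`. -/
def eig (J₁ J₂ : AlmostComplex E M) (ε : ℝ) (x : M) : Submodule ℝ (TangentSpace 𝓘(ℝ, E) x) where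
  carrier := {v | J₂.J x v = -ε • J₁.J x v}
  add_mem' := by
    intro v w hv hw
    simp only [mem_ofPred_eq] at *
    rw [map_add, map_add, hv, hw, smul_add]
  zero_mem' := by simp
  smul_mem' := by
    intro c v hv
    simp only [mem_ofPred_eq] at *
    rw [map_smul, map_smul, hv, smul_comm]

theorem mem_eig {J₁ J₂ : AlmostComplex E M} {ε : ℝ} {x : M} {v : TangentSpace 𝓘(ℝ, E) x} :
    v ∈ eig J₁ J₂ ε x ↔ J₂.J x v = -ε • J₁.J x v := Iff.rfl

theorem eig_swap (J₁ J₂ : AlmostComplex E M) {ε : ℝ} (hε : ε * ε = 1) :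
    eig J₂ J₁ ε = eig J₁ J₂ ε := by
  have key : ∀ (J₁ J₂ : AlmostComplex E M) (x : M) (v : TangentSpace 𝓘(ℝ, E) x),
      v ∈ eig J₁ J₂ ε x → v ∈ eig J₂ J₁ ε x := by
    intro J₁ J₂ x v hv
    rw [mem_eig] at *
    rw [hv, smul_smul, neg_mul_neg, hε, one_smul]
  funext x
  ext v
  exact ⟨key _ _ x v, key _ _ x v⟩

/-- The projection onto `eig J₁ J₂ ε` along `eig J₁ J₂ (-ε)`. -/
def eigProj (J₁ J₂ : AlmostComplex E M) (ε : ℝ) (x : M) (v : TangentSpace 𝓘(ℝ, E) x) :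
    TangentSpace 𝓘(ℝ, E) x :=
  (1 / 2 : ℝ) • (v + ε • J₁.J x (J₂.J x v))

theorem SmoothFieldAt.eigProj {X : ∀ x : M, TangentSpace 𝓘(ℝ, E) x} {x : M}
    (hX : SmoothFieldAt X x) (J₁ J₂ : AlmostComplex E M) (ε : ℝ) :
    SmoothFieldAt (fun y => eigProj J₁ J₂ ε y (X y)) x :=
  (hX.add (((hX.acs J₂).acs J₁).const_smul ε)).const_smul (1 / 2)

variable {g : RiemMetric E M} {J₁ J₂ : AlmostComplex E M} {ε : ℝ} {x : M}

theorem eigProj_of_mem (hε : ε * ε = 1) {v : TangentSpace 𝓘(ℝ, E) x} (hv : v ∈ eig J₁ J₂ ε x) :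
    eigProj J₁ J₂ ε x v = v := by
  rw [eigProj, mem_eig.1 hv, map_smul, J₁.sq]
  have h2 : (ε * ε) • v = v := by rw [hε, one_smul]
  linear_combination (norm := module) (1 / 2 : ℝ) • h2

theorem eigProj_add_eigProj (v : TangentSpace 𝓘(ℝ, E) x) :
    eigProj J₁ J₂ ε x v + eigProj J₁ J₂ (-ε) x v = v := by
  simp only [eigProj]
  module

theorem eig_acs (hc : ∀ (x : M) (v : TangentSpace 𝓘(ℝ, E) x),
    J₁.J x (J₂.J x v) = J₂.J x (J₁.J x v)) {v : TangentSpace 𝓘(ℝ, E) x}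
    (hv : v ∈ eig J₁ J₂ ε x) : J₁.J x v ∈ eig J₁ J₂ ε x := by
  rw [mem_eig] at *
  rw [← hc, hv, map_smul]

theorem eigProj_mem (hc : ∀ (x : M) (v : TangentSpace 𝓘(ℝ, E) x),
    J₁.J x (J₂.J x v) = J₂.J x (J₁.J x v)) (hε : ε * ε = 1) (v : TangentSpace 𝓘(ℝ, E) x) :
    eigProj J₁ J₂ ε x v ∈ eig J₁ J₂ ε x := by
  rw [mem_eig, eigProj]
  simp only [map_smul, map_add, ← hc, J₂.sq, J₁.sq, map_neg]
  have h2 : (ε * ε) • J₂.J x v = J₂.J x v := by rw [hε, one_smul]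
  linear_combination (norm := module) -(1 / 2 : ℝ) • h2

theorem Compatible.inner_left (h : Compatible g J₁) (v w : TangentSpace 𝓘(ℝ, E) x) :
    g.inner x (J₁.J x v) w = -g.inner x v (J₁.J x w) := by
  have := h x v (J₁.J x w)
  rw [J₁.sq, map_neg] at this
  linarith

/-- $g(v,w)=g(J_2v,J_2w)=-\varepsilon^2g(J_1v,J_1w)=-g(v,w)$. -/
theorem inner_eq_zero_of_mem_eig (h₁ : Compatible g J₁) (h₂ : Compatible g J₂) (hε : ε * ε = 1)
    {v w : TangentSpace 𝓘(ℝ, E) x} (hv : v ∈ eig J₁ J₂ ε x) (hw : w ∈ eig J₁ J₂ (-ε) x) :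
    g.inner x v w = 0 := by
  have h := h₂ x v w
  rw [mem_eig.1 hv, mem_eig.1 hw] at h
  simp only [map_smul, smul_apply, smul_eq_mul, h₁ x] at h
  linear_combination (-1 / 2 : ℝ) * h - (1 / 2 : ℝ) * g.inner x v w * hε

/-- The component of `v` in the opposite eigenspace is orthogonal to `v` and to the other component,
hence to itself, so it vanishes. -/
theorem mem_eig_of_inner_eq_zero (hc : ∀ (x : M) (v : TangentSpace 𝓘(ℝ, E) x),
    J₁.J x (J₂.J x v) = J₂.J x (J₁.J x v)) (h₁ : Compatible g J₁) (h₂ : Compatible g J₂)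
    (hε : ε * ε = 1) {v : TangentSpace 𝓘(ℝ, E) x}
    (hv : ∀ w ∈ eig J₁ J₂ (-ε) x, g.inner x v w = 0) : v ∈ eig J₁ J₂ ε x := by
  have hε' : -ε * -ε = 1 := by rw [neg_mul_neg, hε]
  have hp := eigProj_mem hc hε v
  have hm := eigProj_mem hc hε' v
  have hs := eigProj_add_eigProj (J₁ := J₁) (J₂ := J₂) (ε := ε) v
  have h := hv _ hm
  have h3 : g.inner x (eigProj J₁ J₂ (-ε) x v) (eigProj J₁ J₂ (-ε) x v) = 0 := by
    nth_rewrite 1 [← hs] at h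
    rw [map_add, add_apply, inner_eq_zero_of_mem_eig h₁ h₂ hε hp hm, zero_add] at h
    exact h
  have h4 : eigProj J₁ J₂ (-ε) x v = 0 := by
    by_contra hne
    exact (g.pos x _ hne).ne' h3
  rw [h4, add_zero] at hs
  rwa [← hs]

theorem isCompl_eig (hc : ∀ (x : M) (v : TangentSpace 𝓘(ℝ, E) x),
    J₁.J x (J₂.J x v) = J₂.J x (J₁.J x v)) (hε : ε * ε = 1) :
    IsCompl (eig J₁ J₂ ε x) (eig J₁ J₂ (-ε) x) := by
  have hε' : -ε * -ε = 1 := by rw [neg_mul_neg, hε]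
  refine IsCompl.of_eq ?_ ?_
  · refine (Submodule.eq_bot_iff _).2 fun v hv => ?_
    have h1 := eigProj_of_mem hε hv.1
    have h2 := eigProj_of_mem hε' hv.2
    have h3 := eigProj_add_eigProj (J₁ := J₁) (J₂ := J₂) (ε := ε) v
    rw [h1, h2] at h3
    simpa using h3
  · refine (Submodule.eq_top_iff').2 fun v => ?_
    rw [← eigProj_add_eigProj (J₁ := J₁) (J₂ := J₂) (ε := ε) v]
    exact Submodule.add_mem_sup (eigProj_mem hc hε v) (eigProj_mem hc hε' v)

namespace IsCommutingPair

theorem symm (h : IsCommutingPair g J₁ J₂) : IsCommutingPair g J₂ J₁ :=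
  ⟨h.integrable_right, h.integrable_left, h.compatible_right, h.compatible_left,
    fun x v => (h.comm x v).symm, fun x u v w => (add_comm _ _).trans (h.extD_add x u v w)⟩

theorem fundamentalForm_eq_left (h : IsCommutingPair g J₁ J₂) {v : TangentSpace 𝓘(ℝ, E) x}
    (hv : v ∈ eig J₁ J₂ ε x) (w : TangentSpace 𝓘(ℝ, E) x) :
    fundamentalForm g J₂ h.compatible_right x ![v, w] =
      -ε * fundamentalForm g J₁ h.compatible_left x ![v, w] := by
  change g.inner x (J₂.J x v) w = -ε * g.inner x (J₁.J x v) w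
  rw [mem_eig.1 hv, map_smul]
  rfl

/-- Both structures are skew for `g`, so they can be moved to the argument on which they are
proportional. -/
theorem fundamentalForm_eq_right (h : IsCommutingPair g J₁ J₂) (v : TangentSpace 𝓘(ℝ, E) x)
    {w : TangentSpace 𝓘(ℝ, E) x} (hw : w ∈ eig J₁ J₂ ε x) :
    fundamentalForm g J₂ h.compatible_right x ![v, w] =
      -ε * fundamentalForm g J₁ h.compatible_left x ![v, w] := by
  change g.inner x (J₂.J x v) w = -ε * g.inner x (J₁.J x v) w
  rw [h.compatible_right.inner_left, h.compatible_left.inner_left, mem_eig.1 hw, map_smul,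
    smul_eq_mul]
  ring

theorem fundamentalForm_eq_zero (h : IsCommutingPair g J₁ J₂) (hε : ε * ε = 1)
    {v w : TangentSpace 𝓘(ℝ, E) x} (hv : v ∈ eig J₁ J₂ ε x) (hw : w ∈ eig J₁ J₂ (-ε) x) :
    fundamentalForm g J₁ h.compatible_left x ![v, w] = 0 :=
  inner_eq_zero_of_mem_eig h.compatible_left h.compatible_right hε (eig_acs h.comm hv) hw

/-- The exterior derivatives of the two fundamental forms on eigenvectors of `J₁J₂`. -/
theorem extD_add_mul (h : IsCommutingPair g J₁ J₂) {a b c : ℝ} {u v w : TangentSpace 𝓘(ℝ, E) x}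
    (hu : u ∈ eig J₁ J₂ a x) (hv : v ∈ eig J₁ J₂ b x) (hw : w ∈ eig J₁ J₂ c x) :
    extD (fundamentalForm g J₁ h.compatible_left) x ![u, v, w] -
      a * b * c * extD (fundamentalForm g J₂ h.compatible_right) x ![u, v, w] = 0 := by
  -- These arguments are chosen because $J_1(-J_1u)=u$, while $J_2(-J_1u)=-a\,u$ for $u$ in the
  -- eigenspace of $a$.
  have h1 := h.extD_add x (-J₁.J x u) (-J₁.J x v) (-J₁.J x w)
  have key : ∀ {e : ℝ} {u : TangentSpace 𝓘(ℝ, E) x}, u ∈ eig J₁ J₂ e x →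
      J₂.J x (J₁.J x u) = e • u := by
    intro e u hu
    rw [← h.comm, mem_eig.1 hu, map_smul, J₁.sq, smul_neg, neg_smul, neg_neg]
  simp only [map_neg, J₁.sq, neg_neg, key hu, key hv, key hw] at h1
  have h2 : ![-(a • u), -(b • v), -(c • w)] = fun i => ![-a, -b, -c] i • ![u, v, w] i := by
    funext i
    fin_cases i <;> simp
  rw [h2, ContinuousAlternatingMap.map_smul_univ, Fin.prod_univ_three] at h1
  simp only [Matrix.cons_val_zero, Matrix.cons_val_one, Matrix.cons_val, smul_eq_mul] at h1
  linear_combination h1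

variable [FiniteDimensional ℝ E]

/-- For a section $Z$ of $T_{-\varepsilon}$ one has $dF_1(X,Y,Z)=-\varepsilon\,dF_2(X,Y,Z)$. In
Cartan's formulas $F_2=-\varepsilon F_1$ on every surviving term except $F_2([X,Y],Z)=\varepsilon
F_1([X,Y],Z)$. All other terms cancel, so $g(J_1[X,Y],Z)=0$ for all such $Z$. -/
theorem mlieBracket_mem (h : IsCommutingPair g J₁ J₂) (hε : ε * ε = 1)
    {X Y : ∀ x : M, TangentSpace 𝓘(ℝ, E) x} (hX : SmoothFieldAt X x) (hY : SmoothFieldAt Y x)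
    (hXm : ∀ᶠ y in 𝓝 x, X y ∈ eig J₁ J₂ ε y) (hYm : ∀ᶠ y in 𝓝 x, Y y ∈ eig J₁ J₂ ε y) :
    mlieBracket 𝓘(ℝ, E) X Y x ∈ eig J₁ J₂ ε x := by
  have := FiniteDimensional.complete ℝ E
  have hε' : -ε * -ε = 1 := by rw [neg_mul_neg, hε]
  have hJ : J₁.J x (mlieBracket 𝓘(ℝ, E) X Y x) ∈ eig J₁ J₂ ε x := by
    refine mem_eig_of_inner_eq_zero h.comm h.compatible_left h.compatible_right hε fun w hw => ?_
    obtain ⟨Z₀, hZ₀x, hZ₀⟩ := exists_smoothField x w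
    -- Projecting the extension makes it a section of the opposite eigendistribution near `x`
    -- without changing its value `w`; then $F_i(X,Z)$ and $F_i(Y,Z)$ vanish identically near `x`.
    set Z : ∀ x : M, TangentSpace 𝓘(ℝ, E) x := fun y => eigProj J₁ J₂ (-ε) y (Z₀ y) with hZdef
    have hZ : SmoothFieldAt Z x := hZ₀.eigProj J₁ J₂ (-ε)
    have hZx : Z x = w := by change eigProj J₁ J₂ (-ε) x (Z₀ x) = w; rw [hZ₀x]; exact eigProj_of_mem hε' hw
    have hZm : ∀ y, Z y ∈ eig J₁ J₂ (-ε) y := fun y => eigProj_mem h.comm hε' _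
    have e1 := (isSmoothForm_fundamentalForm g J₁ h.compatible_left).extD_apply hX hY hZ
    have e2 := (isSmoothForm_fundamentalForm g J₂ h.compatible_right).extD_apply hX hY hZ
    have e3 := h.extD_add_mul hXm.self_of_nhds hYm.self_of_nhds (hZm x)
    have z1 : ∀ {X : ∀ x : M, TangentSpace 𝓘(ℝ, E) x}, (∀ᶠ y in 𝓝 x, X y ∈ eig J₁ J₂ ε y) →
        ∀ v : TangentSpace 𝓘(ℝ, E) x, dirDeriv x (fun y => fundamentalForm g J₁ h.compatible_left y ![X y, Z y]) v = 0 := by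
      intro X hXm v
      rw [dirDeriv_congr (g := fun _ => 0) ?_, dirDeriv_zero]
      filter_upwards [hXm] with y hy using h.fundamentalForm_eq_zero hε hy (hZm y)
    have z2 : ∀ {X : ∀ x : M, TangentSpace 𝓘(ℝ, E) x}, (∀ᶠ y in 𝓝 x, X y ∈ eig J₁ J₂ ε y) →
        ∀ v : TangentSpace 𝓘(ℝ, E) x, dirDeriv x (fun y => fundamentalForm g J₂ h.compatible_right y ![X y, Z y]) v = 0 := by
      intro X hXm v
      rw [dirDeriv_congr (g := fun _ => 0) ?_, dirDeriv_zero]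
      filter_upwards [hXm] with y hy
      rw [h.fundamentalForm_eq_left hy, h.fundamentalForm_eq_zero hε hy (hZm y), mul_zero]
    have z3 : dirDeriv x (fun y => fundamentalForm g J₂ h.compatible_right y ![X y, Y y]) (Z x) =
        -ε * dirDeriv x (fun y => fundamentalForm g J₁ h.compatible_left y ![X y, Y y]) (Z x) := by
      rw [← dirDeriv_const_mul]
      refine dirDeriv_congr ?_ _
      filter_upwards [hXm] with y hy using h.fundamentalForm_eq_left hy _
    rw [z1 hXm, z1 hYm] at e1
    rw [z2 hXm, z2 hYm, z3, h.fundamentalForm_eq_right _ (hZm x),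
      h.fundamentalForm_eq_right _ hXm.self_of_nhds,
      h.fundamentalForm_eq_right _ hYm.self_of_nhds] at e2
    rw [e1, e2] at e3
    have e4 : fundamentalForm g J₁ h.compatible_left x ![mlieBracket 𝓘(ℝ, E) X Y x, Z x] = 0 := by
      generalize dirDeriv x (fun y => fundamentalForm g J₁ h.compatible_left y ![X y, Y y]) (Z x) = A
        at e3
      generalize fundamentalForm g J₁ h.compatible_left x ![mlieBracket 𝓘(ℝ, E) X Y x, Z x] = B
        at e3 ⊢
      generalize fundamentalForm g J₁ h.compatible_left x ![mlieBracket 𝓘(ℝ, E) X Z x, Y x] = C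
        at e3
      generalize fundamentalForm g J₁ h.compatible_left x ![mlieBracket 𝓘(ℝ, E) Y Z x, X x] = D'
        at e3
      linear_combination (-1 / 2 : ℝ) * e3 + (-1 / 2 : ℝ) * (A + B + C - D') * (ε * ε + 1) * hε
    rw [hZx] at e4
    exact e4
  have h5 := (eig J₁ J₂ ε x).neg_mem (eig_acs h.comm hJ)
  rwa [J₁.sq, neg_neg] at h5

theorem isInvolutive (h : IsCommutingPair g J₁ J₂) (hε : ε * ε = 1) :
    IsInvolutive (eig J₁ J₂ ε) := fun _ hU _ _ hX hY hXm hYm _ hy =>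
  h.mlieBracket_mem hε (hX.smoothFieldAt hU hy) (hY.smoothFieldAt hU hy)
    (mem_of_superset (hU.mem_nhds hy) hXm) (mem_of_superset (hU.mem_nhds hy) hYm)

theorem dbar_mem_of_mem (h : IsCommutingPair g J₁ J₂) (hε : ε * ε = 1)
    {X Y : ∀ x : M, TangentSpace 𝓘(ℝ, E) x} (hX : SmoothFieldAt X x) (hY : SmoothFieldAt Y x)
    (hXm : ∀ᶠ y in 𝓝 x, X y ∈ eig J₁ J₂ ε y) (hYm : ∀ᶠ y in 𝓝 x, Y y ∈ eig J₁ J₂ ε y) :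
    J₁.dbar X Y x ∈ eig J₁ J₂ ε x := by
  refine Submodule.smul_mem _ _ (Submodule.add_mem _ (h.mlieBracket_mem hε hX hY hXm hYm)
    (eig_acs h.comm (h.mlieBracket_mem hε (hX.acs J₁) hY ?_ hYm)))
  filter_upwards [hXm] with y hy using eig_acs h.comm hy

/-- Here $J_2X=\varepsilon J_1X$ and $J_2Y=-\varepsilon J_1Y$, so in the sum of the two Nijenhuis
identities $[J_1X,J_1Y]$ cancels. With $\pi_{\pm\varepsilon}$ the projections onto the eigenspaces,
this leaves $[X,Y]+J_1\pi_{-\varepsilon}[J_1X,Y]+J_1\pi_\varepsilon[X,J_1Y]=0$. Applying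
$\pi_{-\varepsilon}$ gives $\pi_{-\varepsilon}([X,Y]+J_1[J_1X,Y])=0$. -/
theorem dbar_mem_of_mem_neg (h : IsCommutingPair g J₁ J₂) (hε : ε * ε = 1)
    {X Y : ∀ x : M, TangentSpace 𝓘(ℝ, E) x} (hX : SmoothFieldAt X x) (hY : SmoothFieldAt Y x)
    (hXm : ∀ᶠ y in 𝓝 x, X y ∈ eig J₁ J₂ (-ε) y) (hYm : ∀ᶠ y in 𝓝 x, Y y ∈ eig J₁ J₂ ε y) :
    J₁.dbar X Y x ∈ eig J₁ J₂ ε x := by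
  have := FiniteDimensional.complete ℝ E
  have n1 := h.integrable_left.nijenhuis hX hY
  have n2 := h.integrable_right.nijenhuis hX hY
  have eX : (fun y => J₂.J y (X y)) =ᶠ[𝓝 x] (ε • fun y => J₁.J y (X y)) := by
    filter_upwards [hXm] with y hy
    rw [mem_eig.1 hy, neg_neg]
    rfl
  have eY : (fun y => J₂.J y (Y y)) =ᶠ[𝓝 x] (-ε • fun y => J₁.J y (Y y)) := by
    filter_upwards [hYm] with y hy using mem_eig.1 hy
  have mX := (hX.acs J₁).mdifferentiableAt
  have mY := (hY.acs J₁).mdifferentiableAt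
  rw [eX.mlieBracket_vectorField_eq eY, eX.mlieBracket_vectorField_eq (EventuallyEq.refl (𝓝 x) Y),
    (EventuallyEq.refl (𝓝 x) X).mlieBracket_vectorField_eq eY, mlieBracket_const_smul_left mX,
    mlieBracket_const_smul_right mY, mlieBracket_const_smul_left mX,
    mlieBracket_const_smul_right mY] at n2
  rw [AlmostComplex.dbar]
  refine Submodule.smul_mem _ _ ?_
  generalize mlieBracket 𝓘(ℝ, E) X Y x = p at *
  generalize mlieBracket 𝓘(ℝ, E) (fun y => J₁.J y (X y)) Y x = q at *
  generalize mlieBracket 𝓘(ℝ, E) X (fun y => J₁.J y (Y y)) x = r at *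
  generalize mlieBracket 𝓘(ℝ, E) (fun y => J₁.J y (X y)) (fun y => J₁.J y (Y y)) x = s at *
  have n3 : (2 : ℝ) • p + J₁.J x q + ε • J₂.J x q + J₁.J x r - ε • J₂.J x r = 0 := by
    simp only [map_smul] at n2
    have h2 : (ε * ε) • s = s := by rw [hε, one_smul]
    linear_combination (norm := module) -n1 - n2 - h2
  have n4 := congrArg (J₂.J x) n3
  have n5 := congrArg (J₁.J x) n3
  simp only [map_add, map_sub, map_smul, J₁.sq, J₂.sq, map_zero, ← h.comm] at n4 n5
  rw [mem_eig]
  simp only [map_add, J₁.sq, ← h.comm]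
  have h2 : ∀ t : TangentSpace 𝓘(ℝ, E) x, (ε * ε) • t = t := fun t => by rw [hε, one_smul]
  -- This applies $\frac12(J_2+\varepsilon J_1)$, whose kernel is the eigenspace of $\varepsilon$,
  -- to `n3`.
  linear_combination (norm := module) (1 / 2 : ℝ) • n4 + (ε / 2 : ℝ) • n5
    - (1 / 2 : ℝ) • h2 (J₁.J x (J₂.J x q)) + (1 / 2 : ℝ) • h2 (J₁.J x (J₂.J x r))

/-- $\bar\partial_XY$ is additive in $X$, and the eigencomponents of a smooth field are smooth. -/
theorem dbar_mem (h : IsCommutingPair g J₁ J₂) (hε : ε * ε = 1)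
    {X Y : ∀ x : M, TangentSpace 𝓘(ℝ, E) x} (hX : SmoothFieldAt X x) (hY : SmoothFieldAt Y x)
    (hYm : ∀ᶠ y in 𝓝 x, Y y ∈ eig J₁ J₂ ε y) :
    J₁.dbar X Y x ∈ eig J₁ J₂ ε x := by
  have := FiniteDimensional.complete ℝ E
  have hε' : -ε * -ε = 1 := by rw [neg_mul_neg, hε]
  have hA := hX.eigProj J₁ J₂ ε
  have hB := hX.eigProj J₁ J₂ (-ε)
  have h1 := h.dbar_mem_of_mem hε hA hY (.of_forall fun y => eigProj_mem h.comm hε _) hYm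
  have h2 := h.dbar_mem_of_mem_neg hε hB hY (.of_forall fun y => eigProj_mem h.comm hε' _) hYm
  have h3 : X = (fun y => eigProj J₁ J₂ ε y (X y)) + fun y => eigProj J₁ J₂ (-ε) y (X y) :=
    funext fun y => (eigProj_add_eigProj _).symm
  have h4 : (fun y => J₁.J y (X y)) = (fun y => J₁.J y (eigProj J₁ J₂ ε y (X y))) +
      fun y => J₁.J y (eigProj J₁ J₂ (-ε) y (X y)) := by
    funext y
    refine Eq.trans ?_ (map_add (J₁.J y) _ _)
    rw [eigProj_add_eigProj]
  have h5 := mlieBracket_add_left (W := Y) hA.mdifferentiableAt hB.mdifferentiableAt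
  have h6 := mlieBracket_add_left (W := Y) (hA.acs J₁).mdifferentiableAt
    (hB.acs J₁).mdifferentiableAt
  rw [← h3] at h5
  rw [← h4] at h6
  have h7 := Submodule.add_mem _ h1 h2
  rw [AlmostComplex.dbar, h5, h6]
  convert h7 using 1
  rw [AlmostComplex.dbar, AlmostComplex.dbar, map_add]
  module

end IsCommutingPair

theorem GeneralizedKahler.T_eq_eig (K : GeneralizedKahler E M) (ε : ℝ) :
    K.T ε = eig K.Jp K.Jm ε := by
  funext x
  ext v
  rw [mem_eig, GeneralizedKahler.T, Module.End.mem_eigenspace_iff]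
  change K.Jp.J x (K.Jm.J x v) = ε • v ↔ _
  constructor
  · intro h
    have h1 := congrArg (K.Jp.J x) h
    rw [K.Jp.sq, map_smul] at h1
    rw [neg_smul, ← h1, neg_neg]
  · intro h
    rw [h, map_smul, K.Jp.sq, smul_neg, neg_smul, neg_neg]

/-- $F$ is of type $(1,1)$, which is the compatibility of $g$ and $J$ once more. -/
theorem actInv_fundamentalForm (h : Compatible g J₁) :
    J₁.actInv (fundamentalForm g J₁ h) = fundamentalForm g J₁ h := by
  funext x
  ext v
  exact h x (J₁.J x (v 0)) (v 1)

/-- As $F$ is fixed by `actInv`, only the outer action remains; the sign is $(-1)^3$, from the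
action of $-J$ on each argument. -/
theorem dc_fundamentalForm_apply (h : Compatible g J₁) (u v w : TangentSpace 𝓘(ℝ, E) x) :
    J₁.dc (fundamentalForm g J₁ h) x ![u, v, w] =
      -extD (fundamentalForm g J₁ h) x ![J₁.J x u, J₁.J x v, J₁.J x w] := by
  rw [AlmostComplex.dc, actInv_fundamentalForm]
  have h1 : (fun i => (-(J₁.J x)) (![u, v, w] i)) =
      fun i => (-1 : ℝ) • ![J₁.J x u, J₁.J x v, J₁.J x w] i := by
    funext i
    fin_cases i <;> simp
  change extD (fundamentalForm g J₁ h) x (fun i => (-(J₁.J x)) (![u, v, w] i)) = _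
  rw [h1, ContinuousAlternatingMap.map_smul_univ]
  simp only [Finset.prod_const, Finset.card_univ, Fintype.card_fin, smul_eq_mul]
  ring

theorem GeneralizedKahler.isCommutingPair (K : GeneralizedKahler E M)
    (hc : ∀ (x : M) (v : TangentSpace 𝓘(ℝ, E) x),
      K.Jp.J x (K.Jm.J x v) = K.Jm.J x (K.Jp.J x v)) : IsCommutingPair K.g K.Jp K.Jm where
  integrable_left := K.integrable_p
  integrable_right := K.integrable_m
  compatible_left := K.compatible_p
  compatible_right := K.compatible_m
  comm := hc
  extD_add := by
    intro x u v w
    have h := congrArg (fun η : Form E M 3 => η x ![u, v, w]) K.dc_add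
    have h1 : K.Jp.dc (fundamentalForm K.g K.Jp K.compatible_p) x ![u, v, w] +
      K.Jm.dc (fundamentalForm K.g K.Jm K.compatible_m) x ![u, v, w] = 0 := h
    rw [dc_fundamentalForm_apply, dc_fundamentalForm_apply] at h1
    linarith

end CommutingPairs

/-! ### Graphs of projections, and real versus complex derivatives. -/

section Flat

/-- The image of a smooth family of projections is locally the family of graphs of a smooth family
of linear maps. -/
theorem exists_graph_of_projection {V W : Type*} [NormedAddCommGroup V] [NormedSpace ℝ V]
    [CompleteSpace V] [NormedAddCommGroup W] [NormedSpace ℝ W] [CompleteSpace W]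
    {P : V × W → V × W →L[ℝ] V × W} {U : Set (V × W)} (hU : IsOpen U) (h0 : 0 ∈ U)
    (hP : ContDiffOn ℝ ∞ P U) (hPP : ∀ z ∈ U, ∀ w, P z (P z w) = P z w)
    (hP1 : ∀ u, P 0 (u, 0) = (u, 0)) (hP2 : ∀ w, (P 0 w).2 = 0) :
    ∃ (Ω : Set (V × W)) (A : V × W → V →L[ℝ] W), IsOpen Ω ∧ 0 ∈ Ω ∧ Ω ⊆ U ∧ ContDiffOn ℝ ∞ A Ω ∧
      ∀ z ∈ Ω, ∀ w, P z w = w ↔ w.2 = A z w.1 := by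
  -- `a` and `d` are the diagonal blocks of `P` and `1 - P`, both the identity at the origin. Where
  -- `a` is invertible, the image of `P` contains the graph of $P_{21}a^{-1}$; where `d` is, it
  -- contains no vertical vector, so it is this graph.
  let a : V × W → V →L[ℝ] V := fun z =>
    ContinuousLinearMap.fst ℝ V W ∘L P z ∘L ContinuousLinearMap.inl ℝ V W
  let d : V × W → W →L[ℝ] W := fun z =>
    1 - ContinuousLinearMap.snd ℝ V W ∘L P z ∘L ContinuousLinearMap.inr ℝ V W
  have ha : ContDiffOn ℝ ∞ a U :=
    contDiffOn_const.clm_comp (hP.clm_comp contDiffOn_const)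
  have hd : ContDiffOn ℝ ∞ d U :=
    contDiffOn_const.sub (contDiffOn_const.clm_comp (hP.clm_comp contDiffOn_const))
  have ha0 : a 0 = 1 := by
    ext u
    simp [a, hP1]
  have hd0 : d 0 = 1 := by
    ext w
    simp [d, hP2]
  let Ω : Set (V × W) := (U ∩ a ⁻¹' {x | IsUnit x}) ∩ (U ∩ d ⁻¹' {x | IsUnit x})
  have hΩU : Ω ⊆ U := fun z hz => hz.1.1
  refine ⟨Ω, fun z => ContinuousLinearMap.snd ℝ V W ∘L P z ∘L ContinuousLinearMap.inl ℝ V W ∘L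
    Ring.inverse (a z), ?_, ?_, hΩU, ?_, ?_⟩
  · exact (ha.continuousOn.isOpen_inter_preimage hU Units.isOpen).inter
      (hd.continuousOn.isOpen_inter_preimage hU Units.isOpen)
  · refine ⟨⟨h0, ?_⟩, h0, ?_⟩
    · change IsUnit (a 0)
      rw [ha0]; exact isUnit_one
    · change IsUnit (d 0)
      rw [hd0]; exact isUnit_one
  · have hinv : ContDiffOn ℝ ∞ (fun z => Ring.inverse (a z)) Ω := by
      intro z hz
      obtain ⟨e, he⟩ : IsUnit (a z) := hz.1.2
      have := contDiffAt_ringInverse (n := ∞) ℝ e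
      rw [he] at this
      exact this.comp_contDiffWithinAt z ((ha z hz.1.1).mono hΩU)
    exact contDiffOn_const.clm_comp ((hP.mono hΩU).clm_comp (contDiffOn_const.clm_comp hinv))
  · intro z hz w
    have hau : IsUnit (a z) := hz.1.2
    have hdu : IsUnit (d z) := hz.2.2
    let u : V := Ring.inverse (a z) w.1
    let s : V × W := P z (u, 0)
    have hs1 : s.1 = w.1 := by
      have := congrArg (fun T : V →L[ℝ] V => T w.1) (Ring.mul_inverse_cancel _ hau)
      exact this
    have hsP : P z s = s := hPP z (hΩU hz) _
    change _ ↔ w.2 = s.2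
    constructor
    · intro h
      have ht : P z (w - s) = w - s := by rw [map_sub, h, hsP]
      have ht1 : w - s = (0, (w - s).2) := by
        ext
        · simp [hs1]
        · rfl
      have hdt : d z (w - s).2 = 0 := by
        change (w - s).2 - (P z (0, (w - s).2)).2 = 0
        rw [← ht1, ht, sub_self]
      have h3 := congrArg (fun T : W →L[ℝ] W => T (w - s).2) (Ring.inverse_mul_cancel _ hdu)
      have h4 : Ring.inverse (d z) (d z (w - s).2) = (w - s).2 := h3
      rw [hdt, map_zero] at h4
      exact sub_eq_zero.1 h4.symm
    · intro h
      have : w = s := Prod.ext hs1.symm h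
      rw [this, hsP]

theorem complex_smul_eq {G : Type*} [NormedAddCommGroup G] [NormedSpace ℂ G] (c : ℂ) (w : G) :
    c • w = c.re • w + c.im • Complex.I • w := by
  nth_rewrite 1 [← Complex.re_add_im c]
  rw [add_smul, mul_smul, Complex.coe_smul, Complex.coe_smul]

/-- A real differentiable map with complex linear derivative is complex differentiable. -/
theorem differentiableAt_complex_of_fderiv {E F : Type*} [NormedAddCommGroup E] [NormedSpace ℂ E]
    [NormedAddCommGroup F] [NormedSpace ℂ F] {f : E → F} {x : E} (hf : DifferentiableAt ℝ f x)
    (h : ∀ v, fderiv ℝ f x (Complex.I • v) = Complex.I • fderiv ℝ f x v) :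
    DifferentiableAt ℂ f x := by
  rw [differentiableAt_iff_restrictScalars ℝ hf]
  refine ⟨⟨{ toFun := fderiv ℝ f x, map_add' := map_add _, map_smul' := ?_ },
    (fderiv ℝ f x).continuous⟩, rfl⟩
  intro c v
  rw [complex_smul_eq c v, map_add, map_smul, map_smul, h, RingHom.id_apply, ← complex_smul_eq]

theorem fderiv_real_eq_fderiv_complex {E F : Type*} [NormedAddCommGroup E] [NormedSpace ℂ E]
    [NormedAddCommGroup F] [NormedSpace ℂ F] {f : E → F} {x : E} (hf : DifferentiableAt ℂ f x)
    (v : E) : fderiv ℝ f x v = fderiv ℂ f x v := by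
  rw [hf.fderiv_restrictScalars ℝ]
  rfl

end Flat

/-! ### Changes of holomorphic charts. -/

section HolomorphicCharts

variable {E : Type*} [NormedAddCommGroup E] [NormedSpace ℝ E]
  {M : Type*} [TopologicalSpace M] [ChartedSpace E M]
  {F : Type*} [NormedAddCommGroup F] [NormedSpace ℂ F]
  {F' : Type*} [NormedAddCommGroup F'] [NormedSpace ℂ F'] {φ : OpenPartialHomeomorph M F}

theorem rdiff_trans (hφ : IsSmoothChart (E := E) φ) {Φ : OpenPartialHomeomorph F F'}
    (hΦ : ContDiffOn ℂ ∞ Φ Φ.source) {y : M} (hy : y ∈ (φ.trans Φ).source)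
    (v : TangentSpace 𝓘(ℝ, E) y) :
    rdiff (φ.trans Φ) y v = fderiv ℂ Φ (φ y) (rdiff φ y v) := by
  rw [OpenPartialHomeomorph.trans_source] at hy
  have hd : DifferentiableAt ℂ Φ (φ y) :=
    (hΦ.contDiffAt (Φ.open_source.mem_nhds hy.2)).differentiableAt (by simp)
  have h1 := mfderiv_comp (I := 𝓘(ℝ, E)) (I' := 𝓘(ℝ, F)) (I'' := 𝓘(ℝ, F')) y
    (hd.restrictScalars ℝ).mdifferentiableAt
    (hφ.mdifferentiable.mdifferentiableAt hy.1)
  rw [mfderiv_eq_fderiv, hd.fderiv_restrictScalars ℝ] at h1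
  exact congrArg (fun T => T v) h1

variable [IsManifold 𝓘(ℝ, E) ∞ M] {J : AlmostComplex E M}

/-- The composition of a holomorphic chart with a biholomorphic map. -/
theorem IsHolomorphicChart.trans (hφ : IsHolomorphicChart J φ) {Φ : OpenPartialHomeomorph F F'}
    (hΦ : ContDiffOn ℂ ∞ Φ Φ.source) (hΦ' : ContDiffOn ℂ ∞ Φ.symm Φ.target) :
    IsHolomorphicChart J (φ.trans Φ) where
  smooth := by
    refine (contMDiffOn_iff_contDiffOn.2 (hΦ.restrict_scalars ℝ)).comp
      (hφ.smooth.mono ?_) ?_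
    · rw [OpenPartialHomeomorph.trans_source]; exact inter_subset_left
    · rw [OpenPartialHomeomorph.trans_source]; exact inter_subset_right
  smooth_symm := by
    refine hφ.smooth_symm.comp (contMDiffOn_iff_contDiffOn.2 ((hΦ'.restrict_scalars ℝ).mono ?_)) ?_
    · rw [OpenPartialHomeomorph.trans_target]; exact inter_subset_left
    · rw [OpenPartialHomeomorph.trans_target]; exact inter_subset_right
  holomorphic := by
    intro y hy v
    have h1 := rdiff_trans hφ.isSmoothChart hΦ hy (J.J y v)
    have h2 := rdiff_trans hφ.isSmoothChart hΦ hy v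
    rw [OpenPartialHomeomorph.trans_source] at hy
    rw [hφ.rdiff_acs hy.1, map_smul, ← h2] at h1
    exact h1

end HolomorphicCharts

/-! ### From invariant involutive distributions to holomorphic foliations. -/

section Foliations

variable {E : Type*} [NormedAddCommGroup E] [NormedSpace ℝ E]
  {M : Type*} [TopologicalSpace M] [ChartedSpace E M] [IsManifold 𝓘(ℝ, E) ∞ M]
  {J : AlmostComplex E M} {D : ∀ x : M, Submodule ℝ (TangentSpace 𝓘(ℝ, E) x)}

/-- A complex subspace of `ℂⁿ` is the first factor of a splitting `ℂⁿ ≅ ℂᵃ × ℂᵇ`. -/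
theorem exists_splitting {n : ℕ} (V : Submodule ℂ (Fin n → ℂ)) :
    ∃ (a b : ℕ) (T : (Fin n → ℂ) ≃L[ℂ] (Fin a → ℂ) × (Fin b → ℂ)), ∀ w, (T w).2 = 0 ↔ w ∈ V := by
  obtain ⟨W, hW⟩ := V.exists_isCompl
  let S := V.prodEquivOfIsCompl W hW
  let e := (Module.finBasis ℂ V).equivFun
  let f := (Module.finBasis ℂ W).equivFun
  refine ⟨_, _, (S.symm.trans (e.prodCongr f)).toContinuousLinearEquiv, fun w => ?_⟩
  change f (S.symm w).2 = 0 ↔ _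
  rw [LinearEquiv.map_eq_zero_iff, Submodule.prodEquivOfIsCompl_symm_apply_snd_eq_zero]

/-- By `J`-invariance the image of `D x` in $\mathbb C^n$ is a complex subspace; a translation and a
complex linear splitting bring it to the first factor. -/
theorem exists_adapted_chart (hJ : J.Integrable) (hDJ : ∀ x, ∀ v ∈ D x, J.J x v ∈ D x) (x : M) :
    ∃ (a b : ℕ) (φ : OpenPartialHomeomorph M ((Fin a → ℂ) × (Fin b → ℂ))),
      x ∈ φ.source ∧ IsHolomorphicChart J φ ∧ φ x = 0 ∧
        ∀ v : TangentSpace 𝓘(ℝ, E) x, v ∈ D x ↔ (rdiff φ x v).2 = 0 := by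
  obtain ⟨n, φ, hx, hφ⟩ := hJ x
  have hs := hφ.isSmoothChart
  let V : Submodule ℂ (Fin n → ℂ) :=
    { carrier := {w | ∃ v ∈ D x, rdiff φ x v = w}
      add_mem' := by
        rintro _ _ ⟨v, hv, rfl⟩ ⟨w, hw, rfl⟩
        exact ⟨v + w, (D x).add_mem hv hw, map_add _ _ _⟩
      zero_mem' := ⟨0, (D x).zero_mem, map_zero _⟩
      smul_mem' := by
        rintro c _ ⟨v, hv, rfl⟩
        refine ⟨c.re • v + c.im • J.J x v, (D x).add_mem ((D x).smul_mem _ hv)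
          ((D x).smul_mem _ (hDJ x v hv)), ?_⟩
        rw [map_add, map_smul, map_smul, hφ.rdiff_acs hx, ← complex_smul_eq] }
  obtain ⟨a, b, T, hT⟩ := exists_splitting V
  let Φ : OpenPartialHomeomorph (Fin n → ℂ) ((Fin a → ℂ) × (Fin b → ℂ)) :=
    ((Homeomorph.addRight (-φ x)).trans T.toHomeomorph).toOpenPartialHomeomorph
  have hΦc : ContDiff ℂ ∞ Φ := T.contDiff.comp (contDiff_id.add contDiff_const)
  have hΦ : ContDiffOn ℂ ∞ Φ Φ.source := hΦc.contDiffOn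
  have hΦs : ContDiff ℂ ∞ Φ.symm := by
    have : (Φ.symm : _ → _) = fun w => T.symm w + - -φ x := rfl
    rw [this]
    exact T.symm.contDiff.add contDiff_const
  have hΦd : ∀ z, HasFDerivAt Φ (T : (Fin n → ℂ) →L[ℂ] (Fin a → ℂ) × (Fin b → ℂ)) z := fun z => by
    have h1 : HasFDerivAt (fun w : Fin n → ℂ => w + -φ x)
      (ContinuousLinearMap.id ℂ (Fin n → ℂ)) z := (hasFDerivAt_id z).add_const _
    exact T.hasFDerivAt.comp z h1
  have hxs : x ∈ (φ.trans Φ).source := by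
    rw [OpenPartialHomeomorph.trans_source]
    exact ⟨hx, mem_univ _⟩
  refine ⟨a, b, φ.trans Φ, hxs, hφ.trans hΦ hΦs.contDiffOn, ?_, fun v => ?_⟩
  · change T (φ x + -φ x) = 0
    rw [add_neg_cancel, map_zero]
  · rw [rdiff_trans hs hΦ hxs, (hΦd _).fderiv]
    refine Iff.trans ?_ (hT _).symm
    constructor
    · exact fun h => ⟨v, h, rfl⟩
    · rintro ⟨w, hw, hwv⟩
      rwa [← hs.rdiff_injective hx hwv]

variable [FiniteDimensional ℝ E]

/-- A distribution with a smooth family of projections is, in an adapted chart, the family of graphs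
of a smooth family of linear maps. -/
theorem exists_graph_in_chart {V W : Type*} [NormedAddCommGroup V] [NormedSpace ℝ V]
    [FiniteDimensional ℝ V] [NormedAddCommGroup W] [NormedSpace ℝ W] [FiniteDimensional ℝ W]
    {φ : OpenPartialHomeomorph M (V × W)} (hφ : IsSmoothChart (E := E) φ) {x : M}
    (hx : x ∈ φ.source) (hφx : φ x = 0)
    (hDx : ∀ v : TangentSpace 𝓘(ℝ, E) x, v ∈ D x ↔ (rdiff φ x v).2 = 0)
    {P : ∀ x : M, TangentSpace 𝓘(ℝ, E) x →L[ℝ] TangentSpace 𝓘(ℝ, E) x}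
    (hPs : ∀ (X : ∀ x : M, TangentSpace 𝓘(ℝ, E) x) (x : M), SmoothFieldAt X x →
      SmoothFieldAt (fun y => P y (X y)) x)
    (hPD : ∀ x v, P x v ∈ D x) (hDP : ∀ x, ∀ v ∈ D x, P x v = v) :
    ∃ (Ω : Set (V × W)) (A : V × W → V →L[ℝ] W), IsOpen Ω ∧ 0 ∈ Ω ∧ Ω ⊆ φ.target ∧
      ContDiffOn ℝ ∞ A Ω ∧ ∀ y ∈ φ.source, φ y ∈ Ω → ∀ v : TangentSpace 𝓘(ℝ, E) y,
        v ∈ D y ↔ (rdiff φ y v).2 = A (φ y) (rdiff φ y v).1 := by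
  have := FiniteDimensional.complete ℝ E
  have := FiniteDimensional.complete ℝ V
  have := FiniteDimensional.complete ℝ W
  -- The family of projections conjugated into the chart; its smoothness is tested on constant
  -- vectors.
  let Pt : V × W → V × W →L[ℝ] V × W := fun z =>
    rdiff φ (φ.symm z) ∘L P (φ.symm z) ∘L (mfderiv 𝓘(ℝ, E) 𝓘(ℝ, V × W) φ (φ.symm z)).inverse
  have hPt : ∀ y ∈ φ.source, ∀ v : TangentSpace 𝓘(ℝ, E) y,
      Pt (φ y) (rdiff φ y v) = rdiff φ y (P y v) := by
    intro y hy v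
    have h1 : Pt (φ y) (rdiff φ y v) =
        push φ (fun y' => P y' (pull φ (fun _ => rdiff φ y v) y')) (φ y) := rfl
    rw [h1, push, φ.left_inv hy]
    congr 2
    exact hφ.rdiff_injective hy (hφ.rdiff_pull _ hy)
  have hsurj : ∀ z ∈ φ.target, ∀ w, ∃ y ∈ φ.source, φ y = z ∧
      ∃ v : TangentSpace 𝓘(ℝ, E) y, rdiff φ y v = w := fun z hz w =>
    ⟨φ.symm z, φ.map_target hz, φ.right_inv hz, hφ.rdiff_surjective (φ.map_target hz) w⟩
  have hsm : ContDiffOn ℝ ∞ Pt φ.target := by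
    rw [contDiffOn_clm_apply]
    intro w z hz
    have h1 := hφ.contDiffAt_push (φ.map_target hz)
      (hPs _ _ (hφ.smoothFieldAt_pull (φ.map_target hz) (Y := fun _ => w) contDiffAt_const))
    rw [φ.right_inv hz] at h1
    exact h1.contDiffWithinAt
  have h0 : (0 : V × W) ∈ φ.target := hφx ▸ φ.map_source hx
  obtain ⟨Ω, A, hΩ, h0Ω, hΩt, hA, hgr⟩ := exists_graph_of_projection φ.open_target h0 hsm
    (by
      intro z hz w
      obtain ⟨y, hy, rfl, v, rfl⟩ := hsurj z hz w
      rw [hPt y hy, hPt y hy, hDP _ _ (hPD _ _)])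
    (by
      intro u
      obtain ⟨v, hv⟩ := hφ.rdiff_surjective hx (u, 0)
      rw [← hφx, ← hv, hPt x hx, hDP]
      rw [hDx, hv])
    (by
      intro w
      obtain ⟨v, rfl⟩ := hφ.rdiff_surjective hx w
      rw [← hφx, hPt x hx]
      exact (hDx _).1 (hPD _ _))
  refine ⟨Ω, A, hΩ, h0Ω, hΩt, hA, fun y hy hyΩ v => ?_⟩
  rw [← hgr _ hyΩ, hPt y hy]
  constructor
  · intro h
    rw [hDP _ _ h]
  · intro h
    rw [← hφ.rdiff_injective hy h]
    exact hPD _ _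

/-- An involutive distribution which is preserved by the Cauchy-Riemann operator and has a smooth
family of projections is tangent to a holomorphic foliation. -/
theorem isHolomorphicFoliation_of_projection (hJ : J.Integrable)
    (hDJ : ∀ x, ∀ v ∈ D x, J.J x v ∈ D x)
    {P : ∀ x : M, TangentSpace 𝓘(ℝ, E) x →L[ℝ] TangentSpace 𝓘(ℝ, E) x}
    (hPs : ∀ (X : ∀ x : M, TangentSpace 𝓘(ℝ, E) x) (x : M), SmoothFieldAt X x →
      SmoothFieldAt (fun y => P y (X y)) x)
    (hPD : ∀ x v, P x v ∈ D x) (hDP : ∀ x, ∀ v ∈ D x, P x v = v)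
    (hbar : ∀ (x : M) (X Y : ∀ x : M, TangentSpace 𝓘(ℝ, E) x), SmoothFieldAt X x →
      SmoothFieldAt Y x → (∀ᶠ y in 𝓝 x, Y y ∈ D y) → J.dbar X Y x ∈ D x)
    (hinv : ∀ (x : M) (X Y : ∀ x : M, TangentSpace 𝓘(ℝ, E) x), SmoothFieldAt X x →
      SmoothFieldAt Y x → (∀ᶠ y in 𝓝 x, X y ∈ D y) → (∀ᶠ y in 𝓝 x, Y y ∈ D y) →
      mlieBracket 𝓘(ℝ, E) X Y x ∈ D x) :
    IsHolomorphicFoliation J D := by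
  have := FiniteDimensional.complete ℝ E
  intro x
  obtain ⟨a, b, φ, hx, hφ, hφx, hDx⟩ := exists_adapted_chart hJ hDJ x
  have hs := hφ.isSmoothChart
  obtain ⟨Ω, A₀, hΩ, h0Ω, hΩt, hA₀, hD⟩ := exists_graph_in_chart hs hx hφx hDx hPs hPD hDP
  have hA₀I : ∀ z ∈ Ω, ∀ v, A₀ z (Complex.I • v) = Complex.I • A₀ z v := by
    intro z hz v
    have hy := φ.map_target (hΩt hz)
    have hyz := φ.right_inv (hΩt hz)
    obtain ⟨w, hw⟩ := hs.rdiff_surjective hy (v, A₀ z v)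
    have h1 : w ∈ D (φ.symm z) := by rw [hD _ hy (by rwa [hyz]), hyz, hw]
    have h2 := hDJ _ _ h1
    rw [hD _ hy (by rwa [hyz]), hyz, hφ.rdiff_acs hy, hw] at h2
    exact h2.symm
  have hdA : ∀ z ∈ Ω, DifferentiableAt ℝ A₀ z := fun z hz =>
    (hA₀.contDiffAt (hΩ.mem_nhds hz)).differentiableAt (by simp)
  -- These fields span the distribution. Their first component is constant, so a bracket of two of
  -- them, or of one with a constant field, is vertical; if it lies in the distribution it vanishes.
  let Y : (Fin a → ℂ) → (Fin a → ℂ) × (Fin b → ℂ) → (Fin a → ℂ) × (Fin b → ℂ) :=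
    fun v z => (v, A₀ z v)
  have hYs : ∀ v, ∀ z ∈ Ω, ContDiffAt ℝ ∞ (Y v) z := fun v z hz =>
    contDiffAt_const.prodMk ((hA₀.contDiffAt (hΩ.mem_nhds hz)).clm_apply contDiffAt_const)
  have hYd : ∀ v, ∀ z ∈ Ω, ∀ c, fderiv ℝ (Y v) z c = (0, fderiv ℝ A₀ z c v) := by
    intro v z hz c
    have h1 : HasFDerivAt (fun z => A₀ z v) _ z :=
      (hdA z hz).hasFDerivAt.clm_apply (hasFDerivAt_const v z)
    have h2 := ((hasFDerivAt_const v z).prodMk h1).fderiv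
    have h3 := congrArg (fun T => T c) h2
    refine h3.trans ?_
    simp
  have hYf : ∀ v, ∀ y ∈ φ.source, φ y ∈ Ω → SmoothFieldAt (pull (E := E) φ (Y v)) y :=
    fun v y hy hyΩ => hs.smoothFieldAt_pull hy (hYs v _ hyΩ)
  have hYm : ∀ v, ∀ y ∈ φ.source, φ y ∈ Ω → ∀ᶠ y' in 𝓝 y, pull (E := E) φ (Y v) y' ∈ D y' := by
    intro v y hy hyΩ
    filter_upwards [φ.open_source.mem_nhds hy,
      (φ.continuousAt hy).preimage_mem_nhds (hΩ.mem_nhds hyΩ)] with y' hy' hy'Ω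
    rw [hD y' hy' hy'Ω, hs.rdiff_pull _ hy']
  have hpush : ∀ (Z : (Fin a → ℂ) × (Fin b → ℂ) → (Fin a → ℂ) × (Fin b → ℂ)), ∀ y ∈ φ.source,
      push φ (pull (E := E) φ Z) =ᶠ[𝓝 (φ y)] Z := by
    intro Z y hy
    filter_upwards [φ.open_target.mem_nhds (φ.map_source hy)] with z hz
    rw [push, hs.rdiff_pull _ (φ.map_target hz), φ.right_inv hz]
  -- For the constant field `c` one finds $2\bar\partial_cY_v=(0,DA(c)v+i\,DA(ic)v)$. It is vertical
  -- and lies in the graph, so it is zero: these are the Cauchy-Riemann equations for $A$.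
  have hCR : ∀ z ∈ Ω, ∀ c v,
      fderiv ℝ A₀ z (Complex.I • c) v = Complex.I • fderiv ℝ A₀ z c v := by
    intro z hz c v
    have hy := φ.map_target (hΩt hz)
    have hyz := φ.right_inv (hΩt hz)
    have hyΩ : φ (φ.symm z) ∈ Ω := by rwa [hyz]
    have hX := hs.smoothFieldAt_pull (E := E) hy (Y := fun _ => c) contDiffAt_const
    have h1 := hbar _ _ _ hX (hYf v _ hy hyΩ) (hYm v _ hy hyΩ)
    have h2 : push φ (fun y => J.J y (pull (E := E) φ (fun _ => c) y)) =ᶠ[𝓝 (φ (φ.symm z))]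
        fun _ => Complex.I • c := by
      filter_upwards [hφ.push_acs (pull (E := E) φ fun _ => c) hy,
        hpush (fun _ => c) _ hy] with w hw hw'
      rw [hw, hw']
    rw [hD _ hy hyΩ, AlmostComplex.dbar, map_smul, map_add, hφ.rdiff_acs hy,
      hs.rdiff_mlieBracket hy hX (hYf v _ hy hyΩ),
      hs.rdiff_mlieBracket hy (hX.acs J) (hYf v _ hy hyΩ),
      (hpush _ _ hy).lieBracket_vectorField_eq (hpush _ _ hy),
      h2.lieBracket_vectorField_eq (hpush _ _ hy), hyz] at h1
    simp only [lieBracket, hYd v z hz, fderiv_fun_const, Pi.zero_apply, zero_apply, sub_zero] at h1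
    simp only [Prod.smul_mk, Prod.mk_add_mk, smul_zero, add_zero, map_zero] at h1
    have h3 := (smul_eq_zero.1 h1).resolve_left (by norm_num)
    have h4 := congrArg (fun w => Complex.I • w) h3
    simp only [smul_add, smul_smul, Complex.I_mul_I, neg_smul, one_smul, smul_zero] at h4
    exact (add_neg_eq_zero.1 h4).symm
  have hint : ∀ z ∈ Ω, ∀ u v,
      fderiv ℝ A₀ z (u, A₀ z u) v = fderiv ℝ A₀ z (v, A₀ z v) u := by
    intro z hz u v
    have hy := φ.map_target (hΩt hz)
    have hyz := φ.right_inv (hΩt hz)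
    have hyΩ : φ (φ.symm z) ∈ Ω := by rwa [hyz]
    have h1 := hinv _ _ _ (hYf u _ hy hyΩ) (hYf v _ hy hyΩ) (hYm u _ hy hyΩ) (hYm v _ hy hyΩ)
    rw [hD _ hy hyΩ, hs.rdiff_mlieBracket hy (hYf u _ hy hyΩ) (hYf v _ hy hyΩ),
      (hpush _ _ hy).lieBracket_vectorField_eq (hpush _ _ hy), hyz] at h1
    simp only [lieBracket, hYd v z hz, hYd u z hz] at h1
    simp only [Prod.mk_sub_mk, sub_zero, map_zero] at h1
    exact sub_eq_zero.1 h1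
  classical
  -- The family regarded as complex linear maps. The default value `0` is never used on `Ω`, where
  -- `hA₀I` holds.
  let A : (Fin a → ℂ) × (Fin b → ℂ) → (Fin a → ℂ) →L[ℂ] (Fin b → ℂ) := fun z =>
    if h : ∀ v, A₀ z (Complex.I • v) = Complex.I • A₀ z v then
      ⟨{ toFun := A₀ z
         map_add' := map_add _
         map_smul' := fun c v => by
          rw [complex_smul_eq c v, map_add, map_smul, map_smul, h, RingHom.id_apply,
            ← complex_smul_eq] }, (A₀ z).continuous⟩
    else 0
  have hAA : ∀ z ∈ Ω, ∀ v, A z v = A₀ z v := by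
    intro z hz v
    simp only [A, dif_pos (hA₀I z hz)]
    rfl
  have hA : DifferentiableOn ℂ A Ω := by
    have h1 : ContDiffOn ℂ 1 A Ω := by
      rw [contDiffOn_clm_apply]
      intro v
      refine contDiffOn_of_differentiableOn_complex hΩ (fun z hz => ?_) 1
      refine DifferentiableAt.differentiableWithinAt ?_
      have h2 : (fun z => A z v) =ᶠ[𝓝 z] fun z => A₀ z v := by
        filter_upwards [hΩ.mem_nhds hz] with z hz using hAA z hz v
      refine DifferentiableAt.congr_of_eventuallyEq ?_ h2
      have h3 : HasFDerivAt (fun z => A₀ z v) _ z :=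
        (hdA z hz).hasFDerivAt.clm_apply (hasFDerivAt_const v z)
      refine differentiableAt_complex_of_fderiv h3.differentiableAt fun c => ?_
      rw [h3.fderiv]
      simpa using hCR z hz c v
    exact h1.differentiableOn (by simp)
  have hAd : ∀ z ∈ Ω, ∀ c v, fderiv ℂ A z c v = fderiv ℝ A₀ z c v := by
    intro z hz c v
    have hAz := hA.differentiableAt (hΩ.mem_nhds hz)
    have h1 : HasFDerivAt (fun z => A z v) _ z := hAz.hasFDerivAt.clm_apply (hasFDerivAt_const v z)
    have h2 : HasFDerivAt (fun z => A₀ z v) _ z :=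
      (hdA z hz).hasFDerivAt.clm_apply (hasFDerivAt_const v z)
    have h3 : (fun z => A z v) =ᶠ[𝓝 z] fun z => A₀ z v := by
      filter_upwards [hΩ.mem_nhds hz] with z hz using hAA z hz v
    have h4 := fderiv_real_eq_fderiv_complex h1.differentiableAt c
    rw [h3.fderiv_eq, h1.fderiv, h2.fderiv] at h4
    simpa using h4.symm
  obtain ⟨Φ, h0Φ, hΦΩ, hΦ, hΦs, hker⟩ := exists_frobenius_chart hΩ h0Ω hA (by
    intro z hz u v
    rw [hAd z hz, hAd z hz, hAA z hz, hAA z hz, hint z hz])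
  refine ⟨a, b, φ.trans Φ, ?_, hφ.trans hΦ hΦs, fun y hy v => ?_⟩
  · rw [OpenPartialHomeomorph.trans_source]
    exact ⟨hx, by rw [mem_preimage, hφx]; exact h0Φ⟩
  · have h1 : diff (φ.trans Φ) y v = fderiv ℂ Φ (φ y) (rdiff φ y v) := rdiff_trans hs hΦ hy v
    rw [OpenPartialHomeomorph.trans_source] at hy
    rw [h1, hker _ hy.2, hAA _ (hΦΩ hy.2), hD y hy.1 (hΦΩ hy.2)]

end Foliations

/-! ### Smoothness of tensor fields tested on vector fields. -/

section Sections

variable {E : Type*} [NormedAddCommGroup E] [NormedSpace ℝ E]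
  {M : Type*} [TopologicalSpace M] [ChartedSpace E M]

/-- A map into a space of linear maps is smooth if its evaluations are. -/
theorem contMDiffAt_clm_of_apply {V G : Type*} [NormedAddCommGroup V] [NormedSpace ℝ V]
    [FiniteDimensional ℝ V] [NormedAddCommGroup G] [NormedSpace ℝ G] {f : M → V →L[ℝ] G} {x : M}
    (h : ∀ v, ContMDiffAt 𝓘(ℝ, E) 𝓘(ℝ, G) ∞ (fun y => f y v) x) :
    ContMDiffAt 𝓘(ℝ, E) 𝓘(ℝ, V →L[ℝ] G) ∞ f x := by
  let b := Module.finBasis ℝ V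
  let Λ : (Fin (Module.finrank ℝ V) → G) →L[ℝ] (V →L[ℝ] G) :=
    ∑ i, (ContinuousLinearMap.smulRightL ℝ V G (LinearMap.toContinuousLinearMap (b.coord i))) ∘L
      ContinuousLinearMap.proj i
  have h1 : f = fun y => Λ fun i => f y (b i) := by
    funext y
    ext v
    have h2 : f y v = ∑ i, b.repr v i • f y (b i) := by
      simpa only [map_sum, map_smul] using congrArg (f y) (b.sum_repr v).symm
    simpa [Λ] using h2
  rw [h1]
  exact Λ.contMDiff.contMDiffAt.comp x (contMDiffAt_pi_space.2 fun i => h (b i))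

variable [IsManifold 𝓘(ℝ, E) ∞ M]

/-- The vector field with constant coordinates in a trivialization of the tangent bundle. -/
theorem smoothFieldAt_trivializationAt_symm (x : M) (c : E) :
    SmoothFieldAt (fun y =>
      (trivializationAt E (fun y : M => TangentSpace 𝓘(ℝ, E) y) x).symm y c) x := by
  refine (Bundle.contMDiffAt_section x).2 (contMDiffAt_const (c := c) |>.congr_of_eventuallyEq ?_)
  filter_upwards [(trivializationAt E (fun y : M => TangentSpace 𝓘(ℝ, E) y) x).open_baseSet.mem_nhds
    (FiberBundle.mem_baseSet_trivializationAt' x)] with y hy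
  rw [Bundle.Trivialization.apply_mk_symm _ hy]

variable [FiniteDimensional ℝ E]

/-- A field of endomorphisms of the tangent spaces is smooth if it preserves smooth fields. -/
theorem contMDiffAt_endomorphism
    {A : ∀ x : M, TangentSpace 𝓘(ℝ, E) x →L[ℝ] TangentSpace 𝓘(ℝ, E) x} {x : M}
    (hA : ∀ X : ∀ x : M, TangentSpace 𝓘(ℝ, E) x, SmoothFieldAt X x →
      SmoothFieldAt (fun y => A y (X y)) x) :
    ContMDiffAt 𝓘(ℝ, E) (𝓘(ℝ, E).prod 𝓘(ℝ, E →L[ℝ] E)) ∞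
      (fun x => Bundle.TotalSpace.mk' (E →L[ℝ] E)
        (E := fun x : M => TangentSpace 𝓘(ℝ, E) x →L[ℝ] TangentSpace 𝓘(ℝ, E) x) x (A x)) x := by
  rw [contMDiffAt_hom_bundle]
  refine ⟨contMDiffAt_id, contMDiffAt_clm_of_apply fun c => ?_⟩
  have h1 := (Bundle.contMDiffAt_section x).1 (hA _ (smoothFieldAt_trivializationAt_symm x c))
  refine h1.congr_of_eventuallyEq ?_
  filter_upwards [(trivializationAt E (fun y : M => TangentSpace 𝓘(ℝ, E) y) x).open_baseSet.mem_nhds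
    (FiberBundle.mem_baseSet_trivializationAt' x)] with y hy
  change ContinuousLinearMap.inCoordinates E (fun y : M => TangentSpace 𝓘(ℝ, E) y) E
    (fun y : M => TangentSpace 𝓘(ℝ, E) y) x y x y (A y) c = _
  rw [ContinuousLinearMap.inCoordinates_eq hy hy]
  rfl

/-- A field of bilinear forms on the tangent spaces is smooth if its values on smooth fields are. -/
theorem contMDiffAt_bilinear
    {B : ∀ x : M, TangentSpace 𝓘(ℝ, E) x →L[ℝ] TangentSpace 𝓘(ℝ, E) x →L[ℝ] ℝ} {x : M}
    (hB : ∀ X Y : ∀ x : M, TangentSpace 𝓘(ℝ, E) x, SmoothFieldAt X x → SmoothFieldAt Y x →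
      ContMDiffAt 𝓘(ℝ, E) 𝓘(ℝ, ℝ) ∞ (fun y => B y (X y) (Y y)) x) :
    ContMDiffAt 𝓘(ℝ, E) (𝓘(ℝ, E).prod 𝓘(ℝ, E →L[ℝ] E →L[ℝ] ℝ)) ∞
      (fun x => Bundle.TotalSpace.mk' (E →L[ℝ] E →L[ℝ] ℝ)
        (E := fun x : M => TangentSpace 𝓘(ℝ, E) x →L[ℝ] TangentSpace 𝓘(ℝ, E) x →L[ℝ] ℝ) x (B x))
      x := by
  rw [contMDiffAt_hom_bundle]
  refine ⟨contMDiffAt_id, contMDiffAt_clm_of_apply fun c => contMDiffAt_clm_of_apply fun d => ?_⟩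
  have h1 := hB _ _ (smoothFieldAt_trivializationAt_symm x c)
    (smoothFieldAt_trivializationAt_symm x d)
  refine h1.congr_of_eventuallyEq ?_
  filter_upwards [(trivializationAt E (fun y : M => TangentSpace 𝓘(ℝ, E) y) x).open_baseSet.mem_nhds
    (FiberBundle.mem_baseSet_trivializationAt' x)] with y hy
  refine (inCoordinates_apply_eq₂ (F₃ := ℝ) (E₃ := Bundle.Trivial M ℝ) (x₀ := x) (x := y)
    hy hy (mem_univ _)).trans ?_
  exact LinearMap.congr_fun (Bundle.Trivial.linearMapAt_trivialization ℝ M ℝ y) _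

end Sections

/-! ### Smooth frames from foliation charts. -/

section Subbundles

variable {E : Type*} [NormedAddCommGroup E] [NormedSpace ℝ E] [FiniteDimensional ℝ E]
  {M : Type*} [TopologicalSpace M] [ChartedSpace E M] [IsManifold 𝓘(ℝ, E) ∞ M]
  {J : AlmostComplex E M} {D : ∀ x : M, Submodule ℝ (TangentSpace 𝓘(ℝ, E) x)}

/-- The tangent distribution of a holomorphic foliation is a smooth sub-bundle. -/
theorem IsHolomorphicFoliation.isSmoothSubbundle (h : IsHolomorphicFoliation J D) :
    IsSmoothSubbundle D := by
  have := FiniteDimensional.complete ℝ E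
  intro x
  obtain ⟨a, b, φ, hx, hφ, hD⟩ := h x
  have hs := hφ.isSmoothChart
  let e := Module.finBasis ℝ (Fin a → ℂ)
  have hr : ∀ y ∈ φ.source, ∀ i,
      rdiff φ y (pull (E := E) φ (fun _ => (e i, (0 : Fin b → ℂ))) y) = (e i, 0) :=
    fun y hy i => hs.rdiff_pull _ hy
  refine ⟨φ.source, φ.open_source, hx, _, fun i => pull φ fun _ => (e i, 0), fun i => ?_,
    fun y hy => ⟨?_, ?_⟩⟩
  · exact smoothFieldOn_of_forall fun y hy => hs.smoothFieldAt_pull hy contDiffAt_const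
  · refine LinearIndependent.of_comp (rdiff (E := E) φ y).toLinearMap ?_
    have h1 : (rdiff (E := E) φ y).toLinearMap ∘
        (fun i => pull (E := E) φ (fun _ => (e i, (0 : Fin b → ℂ))) y) =
        LinearMap.inl ℝ (Fin a → ℂ) (Fin b → ℂ) ∘ e := funext fun i => hr y hy i
    rw [h1]
    exact e.linearIndependent.map' _ (LinearMap.ker_eq_bot.2 LinearMap.inl_injective)
  · refine le_antisymm (Submodule.span_le.2 ?_) fun v hv => ?_
    · rintro _ ⟨i, rfl⟩
      exact (hD y hy _).2 (congrArg Prod.snd (hr y hy i))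
    · have h1 : v = ∑ i, e.repr (rdiff φ y v).1 i •
          pull (E := E) φ (fun _ => (e i, (0 : Fin b → ℂ))) y := by
        apply hs.rdiff_injective hy
        rw [map_sum]
        simp only [map_smul, hr y hy]
        refine Prod.ext ?_ ?_
        · rw [Prod.fst_sum]
          exact (e.sum_repr _).symm
        · rw [Prod.snd_sum]
          refine ((hD y hy v).1 hv).trans ?_
          simp
      rw [h1]
      exact Submodule.sum_mem _ fun i _ =>
        Submodule.smul_mem _ _ (Submodule.subset_span ⟨i, rfl⟩)

end Subbundles

/-! ### Foliations by eigendistributions and closedness along them. -/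

section Eigendistributions

variable {E : Type*} [NormedAddCommGroup E] [NormedSpace ℝ E] [FiniteDimensional ℝ E]
  {M : Type*} [TopologicalSpace M] [ChartedSpace E M] [IsManifold 𝓘(ℝ, E) ∞ M]
  {g : RiemMetric E M} {J₁ J₂ : AlmostComplex E M} {ε : ℝ}

theorem IsCommutingPair.isHolomorphicFoliation (h : IsCommutingPair g J₁ J₂) (hε : ε * ε = 1) :
    IsHolomorphicFoliation J₁ (eig J₁ J₂ ε) :=
  isHolomorphicFoliation_of_projection h.integrable_left (fun _ _ hv => eig_acs h.comm hv)
    (P := fun x => (1 / 2 : ℝ) • (ContinuousLinearMap.id ℝ _ + ε • (J₁.J x ∘L J₂.J x)))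
    (fun _ _ hX => hX.eigProj J₁ J₂ ε) (fun _ v => eigProj_mem h.comm hε v)
    (fun _ _ hv => eigProj_of_mem hε hv) (fun _ _ _ hX hY hYm => h.dbar_mem hε hX hY hYm)
    (fun _ _ _ hX hY hXm hYm => h.mlieBracket_mem hε hX hY hXm hYm)

theorem IsCommutingPair.isHolomorphicSubbundle (h : IsCommutingPair g J₁ J₂) (hε : ε * ε = 1) :
    IsHolomorphicSubbundle J₁ (eig J₁ J₂ ε) where
  smooth := (h.isHolomorphicFoliation hε).isSmoothSubbundle
  invariant := fun _ _ hv => eig_acs h.comm hv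
  dbar_mem := fun _ hU _ _ hX hY hYm _ hy => h.dbar_mem hε (hX.smoothFieldAt hU hy)
    (hY.smoothFieldAt hU hy) (mem_of_superset (hU.mem_nhds hy) hYm)

/-- The fundamental form is closed along the eigendistributions. -/
theorem IsCommutingPair.extD_eq_zero (h : IsCommutingPair g J₁ J₂) (hε : ε * ε = 1) {x : M}
    {u v w : TangentSpace 𝓘(ℝ, E) x} (hu : u ∈ eig J₁ J₂ ε x) (hv : v ∈ eig J₁ J₂ ε x)
    (hw : w ∈ eig J₁ J₂ ε x) :
    extD (fundamentalForm g J₁ h.compatible_left) x ![u, v, w] = 0 := by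
  have := FiniteDimensional.complete ℝ E
  have hext : ∀ u ∈ eig J₁ J₂ ε x, ∃ X : ∀ y : M, TangentSpace 𝓘(ℝ, E) y, X x = u ∧
      SmoothFieldAt X x ∧ ∀ y, X y ∈ eig J₁ J₂ ε y := by
    intro u hu
    obtain ⟨X, hXx, hX⟩ := exists_smoothField x u
    refine ⟨fun y => eigProj J₁ J₂ ε y (X y), ?_, hX.eigProj J₁ J₂ ε,
      fun y => eigProj_mem h.comm hε _⟩
    change eigProj J₁ J₂ ε x (X x) = u
    rw [hXx, eigProj_of_mem hε hu]
  obtain ⟨X, rfl, hX, hXm⟩ := hext u hu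
  obtain ⟨Y, rfl, hY, hYm⟩ := hext v hv
  obtain ⟨Z, rfl, hZ, hZm⟩ := hext w hw
  have e1 := (isSmoothForm_fundamentalForm g J₁ h.compatible_left).extD_apply hX hY hZ
  have e2 := (isSmoothForm_fundamentalForm g J₂ h.compatible_right).extD_apply hX hY hZ
  have e3 := h.extD_add_mul hu hv hw
  simp only [h.fundamentalForm_eq_right _ (hXm _), h.fundamentalForm_eq_right _ (hYm _),
    h.fundamentalForm_eq_right _ (hZm _), dirDeriv_const_mul] at e2
  -- Every term of Cartan's formula has an argument in the eigendistribution, so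
  -- $dF_2=-\varepsilon\,dF_1$. With $dF_1=\varepsilon^3dF_2$ this gives $dF_1=-dF_1$.
  have e4 : extD (fundamentalForm g J₂ h.compatible_right) x ![X x, Y x, Z x] =
      -ε * extD (fundamentalForm g J₁ h.compatible_left) x ![X x, Y x, Z x] := by
    rw [e1, e2]
    ring
  rw [e4] at e3
  generalize extD (fundamentalForm g J₁ h.compatible_left) x ![X x, Y x, Z x] = t at e3 ⊢
  linear_combination (1 / 2 : ℝ) * e3 - (1 / 2 : ℝ) * t * (ε * ε + 1) * hε

end Eigendistributions

/-! ### Induced Kähler structures on integral manifolds. -/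

section Leaves

variable {E : Type*} [NormedAddCommGroup E] [NormedSpace ℝ E]
  {M : Type*} [TopologicalSpace M] [ChartedSpace E M]
  {E' : Type*} [NormedAddCommGroup E'] [NormedSpace ℝ E']
  {L : Type*} [TopologicalSpace L] [ChartedSpace E' L]
  {D : ∀ x : M, Submodule ℝ (TangentSpace 𝓘(ℝ, E) x)} {ι : L → M}

section LeafCharts

variable {V W : Type*} [NormedAddCommGroup V] [NormedSpace ℝ V]
  [NormedAddCommGroup W] [NormedSpace ℝ W]

/-- `κ` is the chart of the integral manifold `ι : L → M` of the plaques of `φ` given by the first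
component of `φ`. -/
structure IsLeafChart (ι : L → M) (φ : OpenPartialHomeomorph M (V × W))
    (κ : OpenPartialHomeomorph L V) : Prop where
  isSmoothChart : IsSmoothChart (E := E') κ
  mem_source : ∀ q ∈ κ.source, ι q ∈ φ.source
  apply_eq : ∀ q ∈ κ.source, κ q = (φ (ι q)).1
  rdiff_eq : ∀ q ∈ κ.source, ∀ v : TangentSpace 𝓘(ℝ, E') q,
    rdiff (E := E) φ (ι q) (mfderiv 𝓘(ℝ, E') 𝓘(ℝ, E) ι q v) = (rdiff κ q v, 0)

theorem rdiff_fst_comp {φ : OpenPartialHomeomorph M (V × W)} (hφ : IsSmoothChart (E := E) φ)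
    (hι : ContMDiff 𝓘(ℝ, E') 𝓘(ℝ, E) ∞ ι) {q : L} (hq : ι q ∈ φ.source)
    (v : TangentSpace 𝓘(ℝ, E') q) :
    rdiff (fun q => (φ (ι q)).1) q v =
      (rdiff (E := E) φ (ι q) (mfderiv 𝓘(ℝ, E') 𝓘(ℝ, E) ι q v)).1 := by
  have hφq : MDifferentiableAt 𝓘(ℝ, E) 𝓘(ℝ, V × W) φ (ι q) :=
    hφ.mdifferentiable.mdifferentiableAt hq
  have hιq : MDifferentiableAt 𝓘(ℝ, E') 𝓘(ℝ, E) ι q := hι.mdifferentiableAt (by simp)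
  have hfst : MDifferentiableAt 𝓘(ℝ, V × W) 𝓘(ℝ, V) (ContinuousLinearMap.fst ℝ V W)
    ((φ ∘ ι) q) := (ContinuousLinearMap.fst ℝ V W).differentiableAt.mdifferentiableAt
  have h1 := mfderiv_comp q hφq hιq
  have h2 := mfderiv_comp q hfst (hφq.comp q hιq)
  rw [mfderiv_eq_fderiv, ContinuousLinearMap.fderiv] at h2
  refine (congrArg (fun T : TangentSpace 𝓘(ℝ, E') q →L[ℝ] V => T v) h2).trans ?_
  exact congrArg (fun T : TangentSpace 𝓘(ℝ, E') q →L[ℝ] V × W => (T v).1) h1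

variable [FiniteDimensional ℝ E'] [IsManifold 𝓘(ℝ, E') ∞ L] [FiniteDimensional ℝ V]

/-- The derivative of $\varphi_2\circ\iota$ vanishes and that of $\iota$ is onto the tangent space
of the plaque. So the derivative of $\varphi_1\circ\iota$ is bijective, and the inverse function
theorem applies. -/
theorem IsIntegralManifold.exists_isLeafChart (hι : IsIntegralManifold E' ι D)
    {φ : OpenPartialHomeomorph M (V × W)} (hφ : IsSmoothChart (E := E) φ)
    (hD : ∀ y ∈ φ.source, ∀ v : TangentSpace 𝓘(ℝ, E) y, v ∈ D y ↔ (rdiff φ y v).2 = 0)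
    {p : L} (hp : ι p ∈ φ.source) :
    ∃ κ : OpenPartialHomeomorph L V, p ∈ κ.source ∧
      IsLeafChart (E := E) (E' := E') ι φ κ := by
  have := FiniteDimensional.complete ℝ E'
  have := FiniteDimensional.complete ℝ V
  have hmem : ∀ (q : L) (v : TangentSpace 𝓘(ℝ, E') q),
      mfderiv 𝓘(ℝ, E') 𝓘(ℝ, E) ι q v ∈ D (ι q) := fun q v => by
    rw [← hι.tangent q]
    exact ⟨v, rfl⟩
  let ψ : L → V := fun q => (φ (ι q)).1
  let χ := chartAt E' p
  have hχ := isSmoothChart_chartAt (E := E') p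
  have hpχ : p ∈ χ.source := mem_chart_source E' p
  let f : E' → V := ψ ∘ χ.symm
  let S : Set E' := χ.target ∩ χ.symm ⁻¹' (ι ⁻¹' φ.source)
  have hS : IsOpen S := χ.symm.isOpen_inter_preimage (φ.open_source.preimage hι.smooth.continuous)
  have hpS : χ p ∈ S := ⟨χ.map_source hpχ, by simpa [χ.left_inv hpχ] using hp⟩
  have hψ : ContMDiffOn 𝓘(ℝ, E') 𝓘(ℝ, V) ∞ ψ (ι ⁻¹' φ.source) :=
    (ContinuousLinearMap.fst ℝ V W).contMDiff.comp_contMDiffOn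
      (hφ.smooth.comp hι.smooth.contMDiffOn fun _ h => h)
  have hf : ContDiffOn ℝ ∞ f S := contMDiffOn_iff_contDiffOn.1
    (hψ.comp (hχ.smooth_symm.mono inter_subset_left) fun _ h => h.2)
  have hfp : DifferentiableAt ℝ f (χ p) :=
    (hf.contDiffAt (hS.mem_nhds hpS)).differentiableAt (by simp)
  have hder : ∀ v : TangentSpace 𝓘(ℝ, E') p, fderiv ℝ f (χ p) (rdiff χ p v) =
      (rdiff (E := E) φ (ι p) (mfderiv 𝓘(ℝ, E') 𝓘(ℝ, E) ι p v)).1 := by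
    intro v
    rw [← rdiff_fst_comp hφ hι.smooth hp]
    have h1 := mfderiv_comp p hfp.mdifferentiableAt (hχ.mdifferentiable.mdifferentiableAt hpχ)
    have h2 : (f ∘ χ) =ᶠ[𝓝 p] ψ := by
      filter_upwards [χ.open_source.mem_nhds hpχ] with q hq
      simp [f, χ.left_inv hq]
    have h3 : (mfderiv 𝓘(ℝ, E') 𝓘(ℝ, V) (f ∘ χ) p : TangentSpace 𝓘(ℝ, E') p →L[ℝ] V) =
      mfderiv 𝓘(ℝ, E') 𝓘(ℝ, V) ψ p := h2.mfderiv_eq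
    rw [mfderiv_eq_fderiv] at h1
    exact (congrArg (fun T : TangentSpace 𝓘(ℝ, E') p →L[ℝ] V => T v) h1).symm.trans
      (congrArg (fun T : TangentSpace 𝓘(ℝ, E') p →L[ℝ] V => T v) h3)
  have hbij : Function.Bijective (fderiv ℝ f (χ p)) := by
    constructor
    · refine (injective_iff_map_eq_zero _).2 fun c hc => ?_
      obtain ⟨v, rfl⟩ := hχ.rdiff_surjective hpχ c
      rw [hder] at hc
      have h1 : rdiff (E := E) φ (ι p) (mfderiv 𝓘(ℝ, E') 𝓘(ℝ, E) ι p v) = 0 :=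
        Prod.ext hc ((hD _ hp _).1 (hmem p v))
      have h2 := (injective_iff_map_eq_zero _).1 (hφ.rdiff_injective hp) _ h1
      rw [(injective_iff_map_eq_zero _).1 (hι.injective p) v h2]
      exact map_zero _
    · intro u
      obtain ⟨w, hw⟩ := hφ.rdiff_surjective hp (u, 0)
      have h1 : w ∈ D (ι p) := (hD _ hp w).2 (by rw [hw])
      rw [← hι.tangent p] at h1
      obtain ⟨v, rfl⟩ := h1
      exact ⟨rdiff χ p v, (hder v).trans (congrArg Prod.fst hw)⟩
  let T : E' ≃L[ℝ] V :=
    (LinearEquiv.ofBijective (fderiv ℝ f (χ p)).toLinearMap hbij).toContinuousLinearEquiv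
  have hT : HasFDerivAt f (T : E' →L[ℝ] V) (χ p) := by
    have : (T : E' →L[ℝ] V) = fderiv ℝ f (χ p) := by
      ext c
      rfl
    rw [this]
    exact hfp.hasFDerivAt
  obtain ⟨Ψ, hpΨ, hΨS, hΨf, hΨs⟩ := exists_openPartialHomeomorph_of_hasFDerivAt hS hf hpS T hT
  have hsrc : (χ.trans Ψ).source = χ.source ∩ χ ⁻¹' Ψ.source := χ.trans_source Ψ
  have hφsrc : ∀ q ∈ (χ.trans Ψ).source, ι q ∈ φ.source := by
    intro q hq
    rw [hsrc] at hq
    have := (hΨS hq.2).2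
    rwa [mem_preimage, mem_preimage, χ.left_inv hq.1] at this
  have hκψ : ∀ q ∈ (χ.trans Ψ).source, (χ.trans Ψ) q = ψ q := by
    intro q hq
    rw [hsrc] at hq
    exact (hΨf (χ q)).trans (congrArg ψ (χ.left_inv hq.1))
  refine ⟨χ.trans Ψ, ?_, ⟨⟨?_, ?_⟩, hφsrc, hκψ, fun q hq v => ?_⟩⟩
  · rw [hsrc]
    exact ⟨hpχ, hpΨ⟩
  · exact (hψ.mono hφsrc).congr hκψ
  · refine hχ.smooth_symm.comp (contMDiffOn_iff_contDiffOn.2 (hΨs.mono ?_)) ?_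
    · rw [OpenPartialHomeomorph.trans_target]; exact inter_subset_left
    · rw [OpenPartialHomeomorph.trans_target]; exact inter_subset_right
  · have h2 : (χ.trans Ψ : L → V) =ᶠ[𝓝 q] ψ := by
      filter_upwards [(χ.trans Ψ).open_source.mem_nhds hq] with y hy using hκψ y hy
    have h3 : (mfderiv 𝓘(ℝ, E') 𝓘(ℝ, V) (χ.trans Ψ) q : TangentSpace 𝓘(ℝ, E') q →L[ℝ] V) =
      mfderiv 𝓘(ℝ, E') 𝓘(ℝ, V) ψ q := h2.mfderiv_eq
    refine Prod.ext ?_ ((hD _ (hφsrc q hq) _).1 (hmem q v))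
    rw [← rdiff_fst_comp hφ hι.smooth (hφsrc q hq)]
    exact (congrArg (fun T : TangentSpace 𝓘(ℝ, E') q →L[ℝ] V => T v) h3).symm

/-- Vector fields on an integral manifold of a foliation extend locally. -/
theorem IsLeafChart.exists_extension [IsManifold 𝓘(ℝ, E) ∞ M] [FiniteDimensional ℝ E] [FiniteDimensional ℝ W]
    {φ : OpenPartialHomeomorph M (V × W)} {κ : OpenPartialHomeomorph L V}
    (hκ : IsLeafChart (E := E) (E' := E') ι φ κ) (hφ : IsSmoothChart (E := E) φ) {p : L}
    (hp : p ∈ κ.source) {X : ∀ q : L, TangentSpace 𝓘(ℝ, E') q} (hX : SmoothFieldAt X p) :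
    ∃ X' : ∀ y : M, TangentSpace 𝓘(ℝ, E) y, SmoothFieldAt X' (ι p) ∧
      ∀ᶠ q in 𝓝 p, X' (ι q) = mfderiv 𝓘(ℝ, E') 𝓘(ℝ, E) ι q (X q) := by
  have := FiniteDimensional.complete ℝ E
  have := FiniteDimensional.complete ℝ E'
  have := FiniteDimensional.complete ℝ V
  have := FiniteDimensional.complete ℝ W
  -- The extension is horizontal and independent of the transverse coordinate.
  refine ⟨pull φ fun z => (push κ X z.1, 0), hφ.smoothFieldAt_pull (hκ.mem_source p hp) ?_, ?_⟩
  · have h1 := hκ.isSmoothChart.contDiffAt_push hp hX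
    rw [hκ.apply_eq p hp] at h1
    exact (h1.comp _ contDiffAt_fst).prodMk contDiffAt_const
  · filter_upwards [κ.open_source.mem_nhds hp] with q hq
    apply hφ.rdiff_injective (hκ.mem_source q hq)
    rw [hφ.rdiff_pull _ (hκ.mem_source q hq), hκ.rdiff_eq q hq, ← hκ.apply_eq q hq, push,
      κ.left_inv hq]

end LeafCharts

variable [IsManifold 𝓘(ℝ, E) ∞ M] [FiniteDimensional ℝ E']
  [IsManifold 𝓘(ℝ, E') ∞ L]

/-- The pull-back of a metric to an integral manifold of a foliation. -/
theorem exists_pullback_metric [FiniteDimensional ℝ E] (g : RiemMetric E M) {J : AlmostComplex E M}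
    (hfol : IsHolomorphicFoliation J D) (hι : IsIntegralManifold E' ι D) :
    ∃ h : RiemMetric E' L, ∀ (p : L) (v w : TangentSpace 𝓘(ℝ, E') p),
      h.inner p v w = g.inner (ι p) (mfderiv 𝓘(ℝ, E') 𝓘(ℝ, E) ι p v)
        (mfderiv 𝓘(ℝ, E') 𝓘(ℝ, E) ι p w) := by
  let B : ∀ p : L, TangentSpace 𝓘(ℝ, E') p →L[ℝ] TangentSpace 𝓘(ℝ, E') p →L[ℝ] ℝ := fun p =>
    ContinuousLinearMap.bilinearComp (E := E) (F := E) (G := ℝ) (E' := E') (F' := E')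
      (g.inner (ι p)) (mfderiv 𝓘(ℝ, E') 𝓘(ℝ, E) ι p) (mfderiv 𝓘(ℝ, E') 𝓘(ℝ, E) ι p)
  have hB : ∀ (p : L) (v w : TangentSpace 𝓘(ℝ, E') p), B p v w =
      g.inner (ι p) (mfderiv 𝓘(ℝ, E') 𝓘(ℝ, E) ι p v) (mfderiv 𝓘(ℝ, E') 𝓘(ℝ, E) ι p w) :=
    fun _ _ _ => rfl
  refine ⟨⟨B, fun p v w => ?_, fun p v hv => ?_, fun p => ?_, fun p => ?_⟩, hB⟩
  · rw [hB, hB, g.symm]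
  · rw [hB]
    refine g.pos _ _ fun h => hv ?_
    exact (injective_iff_map_eq_zero _).1 (hι.injective p) v h
  -- The unit ball of the pulled-back metric is the preimage of that of `g` under an injective
  -- linear map from a finite-dimensional space, which is antilipschitz.
  · have h1 : Bornology.IsVonNBounded ℝ {v : E | g.inner (ι p) v v < 1} := g.isVonNBounded (ι p)
    rw [NormedSpace.isVonNBounded_iff] at h1
    let T : E' →L[ℝ] E := mfderiv 𝓘(ℝ, E') 𝓘(ℝ, E) ι p
    obtain ⟨K, -, hK⟩ := T.toLinearMap.exists_antilipschitzWith
      (LinearMap.ker_eq_bot.2 (hι.injective p))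
    have h2 := hK.isBounded_preimage h1
    exact (NormedSpace.isVonNBounded_iff (E := E') ℝ).2 h2
  · refine contMDiffAt_bilinear fun X Y hX hY => ?_
    obtain ⟨a, b, φ, hp, hφ, hD⟩ := hfol (ι p)
    have hs := hφ.isSmoothChart
    obtain ⟨κ, hpκ, hκ⟩ := hι.exists_isLeafChart hs hD hp
    obtain ⟨X', hX', hXX'⟩ := hκ.exists_extension hs hpκ hX
    obtain ⟨Y', hY', hYY'⟩ := hκ.exists_extension hs hpκ hY
    have h1 := (hX'.inner g hY').comp p (hι.smooth p)
    refine h1.congr_of_eventuallyEq ?_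
    filter_upwards [hXX', hYY'] with q hq hq'
    rw [hB, Function.comp_apply, hq, hq']

/-- The complex structure induced on an integral manifold of a holomorphic foliation. -/
theorem exists_induced_complex {J : AlmostComplex E M} (hDJ : ∀ x, ∀ v ∈ D x, J.J x v ∈ D x)
    (hfol : IsHolomorphicFoliation J D) (hι : IsIntegralManifold E' ι D) :
    ∃ j : AlmostComplex E' L, (∀ (p : L) (v : TangentSpace 𝓘(ℝ, E') p),
      mfderiv 𝓘(ℝ, E') 𝓘(ℝ, E) ι p (j.J p v) =
        J.J (ι p) (mfderiv 𝓘(ℝ, E') 𝓘(ℝ, E) ι p v)) ∧ j.Integrable := by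
  have := FiniteDimensional.complete ℝ E'
  -- The image of the differential is `J`-invariant, so conjugating `J` by the differential and a
  -- left inverse of it works.
  have hex : ∀ p : L, ∃ T : TangentSpace 𝓘(ℝ, E') p →L[ℝ] TangentSpace 𝓘(ℝ, E') p, ∀ v,
      mfderiv 𝓘(ℝ, E') 𝓘(ℝ, E) ι p (T v) = J.J (ι p) (mfderiv 𝓘(ℝ, E') 𝓘(ℝ, E) ι p v) := by
    intro p
    let S : E' →ₗ[ℝ] E := (mfderiv 𝓘(ℝ, E') 𝓘(ℝ, E) ι p).toLinearMap
    let A : E →ₗ[ℝ] E := (J.J (ι p)).toLinearMap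
    have hS : LinearMap.ker S = ⊥ := LinearMap.ker_eq_bot.2 (hι.injective p)
    obtain ⟨R, hR⟩ := S.exists_leftInverse_of_injective hS
    let T : E' →L[ℝ] E' := LinearMap.toContinuousLinearMap (R ∘ₗ A ∘ₗ S)
    refine ⟨T, fun v => ?_⟩
    have h1 : J.J (ι p) (mfderiv 𝓘(ℝ, E') 𝓘(ℝ, E) ι p v) ∈ D (ι p) := by
      refine hDJ _ _ ?_
      rw [← hι.tangent p]
      exact ⟨v, rfl⟩
    rw [← hι.tangent p] at h1
    obtain ⟨w, hw⟩ := h1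
    have h2 : R (A (S v)) = w := by
      have : A (S v) = S w := hw.symm
      rw [this]
      exact congrArg (fun T : E' →ₗ[ℝ] E' => T w) hR
    exact (congrArg S h2).trans hw
  choose j hj using hex
  -- In a leaf chart `j` is multiplication by $i$, which yields its smoothness and its integrability
  -- together.
  have hloc : ∀ p : L, ∃ (a : ℕ) (κ : OpenPartialHomeomorph L (Fin a → ℂ)), p ∈ κ.source ∧
      IsSmoothChart (E := E') κ ∧ ∀ q ∈ κ.source, ∀ v : TangentSpace 𝓘(ℝ, E') q,
        rdiff κ q (j q v) = Complex.I • rdiff κ q v := by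
    intro p
    obtain ⟨a, b, φ, hp, hφ, hD⟩ := hfol (ι p)
    have hs := hφ.isSmoothChart
    obtain ⟨κ, hpκ, hκ⟩ := hι.exists_isLeafChart hs hD hp
    refine ⟨a, κ, hpκ, hκ.isSmoothChart, fun q hq v => ?_⟩
    have h1 := hκ.rdiff_eq q hq (j q v)
    rw [hj, hφ.rdiff_acs (hκ.mem_source q hq), hκ.rdiff_eq q hq] at h1
    exact (congrArg Prod.fst h1).symm
  have hsm : ∀ p : L, ∀ X : ∀ q : L, TangentSpace 𝓘(ℝ, E') q, SmoothFieldAt X p →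
      SmoothFieldAt (fun q => j q (X q)) p := by
    intro p X hX
    obtain ⟨a, κ, hp, hκ, hκj⟩ := hloc p
    have h1 : SmoothFieldAt (E := E') (pull κ fun z => Complex.I • push κ X z) p :=
      hκ.smoothFieldAt_pull hp ((hκ.contDiffAt_push hp hX).const_smul Complex.I)
    refine h1.congr ?_
    filter_upwards [κ.open_source.mem_nhds hp] with q hq
    apply hκ.rdiff_injective hq
    rw [hκ.rdiff_pull _ hq, hκj q hq, push, κ.left_inv hq]
  refine ⟨⟨j, fun p => contMDiffAt_endomorphism (hsm p), fun p v => ?_⟩, hj, fun p => ?_⟩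
  · apply hι.injective p
    rw [hj, hj, J.sq, map_neg]
  · obtain ⟨a, κ, hp, hκ, hκj⟩ := hloc p
    exact ⟨a, κ, hp, hκ.smooth, hκ.smooth_symm, hκj⟩

/-- The fundamental form of the induced pair is $\iota^*F_1$, and $d\iota^*F_1=\iota^*dF_1$ vanishes
since $dF_1$ is zero on triples tangent to the leaf. -/
theorem IsCommutingPair.restrictsToKahler [FiniteDimensional ℝ E] {g : RiemMetric E M} {J₁ J₂ : AlmostComplex E M} {ε : ℝ}
    (hJ : IsCommutingPair g J₁ J₂) (hε : ε * ε = 1)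
    (hι : IsIntegralManifold E' ι (eig J₁ J₂ ε)) : RestrictsToKahler E' g J₁ ι := by
  have hfol := hJ.isHolomorphicFoliation hε
  obtain ⟨h, hh⟩ := exists_pullback_metric g hfol hι
  obtain ⟨j, hj, hint⟩ := exists_induced_complex (fun _ _ hv => eig_acs hJ.comm hv) hfol hι
  have hc : Compatible h j := fun p v w => by
    rw [hh, hh, hj, hj, hJ.compatible_left]
  refine ⟨h, j, hh, hj, hint, hc, ?_⟩
  have h1 : fundamentalForm h j hc =
      pullForm (E' := E') ι (fundamentalForm g J₁ hJ.compatible_left) := by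
    funext p
    ext v
    change h.inner p (j.J p (v 0)) (v 1) = g.inner (ι p)
      (J₁.J (ι p) (mfderiv 𝓘(ℝ, E') 𝓘(ℝ, E) ι p (v 0))) (mfderiv 𝓘(ℝ, E') 𝓘(ℝ, E) ι p (v 1))
    rw [hh, hj]
  rw [h1, (isSmoothForm_fundamentalForm g J₁ hJ.compatible_left).extD_pullForm hι.smooth]
  have hmem : ∀ (q : L) (v : TangentSpace 𝓘(ℝ, E') q),
      mfderiv 𝓘(ℝ, E') 𝓘(ℝ, E) ι q v ∈ eig J₁ J₂ ε (ι q) := fun q v => by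
    rw [← hι.tangent q]
    exact ⟨v, rfl⟩
  funext p
  ext v
  have h2 := hJ.extD_eq_zero hε (hmem p (v 0)) (hmem p (v 1)) (hmem p (v 2))
  refine Eq.trans ?_ h2
  refine congrArg (extD (fundamentalForm g J₁ hJ.compatible_left) (ι p)) (funext fun i => ?_)
  fin_cases i <;> rfl

end Leaves

end GenKahler

end

theorem theorem2 {E : Type*} [NormedAddCommGroup E] [NormedSpace ℝ E] [FiniteDimensional ℝ E]
    {M : Type*} [TopologicalSpace M] [T2Space M] [ChartedSpace E M] [IsManifold 𝓘(ℝ, E) ∞ M]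
    (K : GenKahler.GeneralizedKahler E M)
    (hcomm : ∀ (x : M) (v : TangentSpace 𝓘(ℝ, E) x),
      K.Jp.J x (K.Jm.J x v) = K.Jm.J x (K.Jp.J x v)) :
    (∀ x : M, IsCompl (K.T 1 x) (K.T (-1) x)) ∧
    (∀ x : M, ∀ v ∈ K.T 1 x, ∀ w ∈ K.T (-1) x, K.g.inner x v w = 0) ∧
    ∀ ε : ℝ, ε = 1 ∨ ε = -1 →
      GenKahler.IsInvolutive (K.T ε) ∧
      ∀ J : GenKahler.AlmostComplex E M, J = K.Jp ∨ J = K.Jm →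
        GenKahler.IsHolomorphicSubbundle J (K.T ε) ∧
        GenKahler.IsHolomorphicFoliation J (K.T ε) ∧
        ∀ (E' : Type*) [NormedAddCommGroup E'] [NormedSpace ℝ E'] [FiniteDimensional ℝ E']
          (L : Type*) [TopologicalSpace L] [ChartedSpace E' L] [IsManifold 𝓘(ℝ, E') ∞ L]
          (ι : L → M), GenKahler.IsIntegralManifold E' ι (K.T ε) → GenKahler.RestrictsToKahler E' K.g J ι := by
  have hK := K.isCommutingPair hcomm
  simp only [GenKahler.GeneralizedKahler.T_eq_eig]
  refine ⟨fun x => GenKahler.isCompl_eig hcomm (one_mul 1), fun x v hv w hw =>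
    GenKahler.inner_eq_zero_of_mem_eig hK.compatible_left hK.compatible_right (one_mul 1) hv hw, ?_⟩
  intro ε hε
  have hεε : ε * ε = 1 := by rcases hε with rfl | rfl <;> norm_num
  refine ⟨hK.isInvolutive hεε, ?_⟩
  rintro J (rfl | rfl)
  · exact ⟨hK.isHolomorphicSubbundle hεε, hK.isHolomorphicFoliation hεε,
      fun E' _ _ _ L _ _ _ ι hι => hK.restrictsToKahler hεε hι⟩
  -- For $J_-$ the roles in the pair are exchanged; the eigendistribution is the same.
  · rw [← GenKahler.eig_swap _ _ hεε]
    exact ⟨hK.symm.isHolomorphicSubbundle hεε, hK.symm.isHolomorphicFoliation hεε,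
      fun E' _ _ _ L _ _ _ ι hι => hK.symm.restrictsToKahler hεε hι⟩
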